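/- Setting. Let $G$ be a compact abelian Lie group with dual group $\hat G$, and let $A$ be a finite partially ordered set with least element $0$. Let $X_*=(X_\alpha)_{\alpha\in A}$ be an iterated space: compact non-empty manifolds with corners $X_\alpha$ whose boundary hypersurfaces are partitioned into collective (disjoint unions of) boundary hypersurfaces $H_\beta(X_\alpha)$, $\beta>\alpha$, of which two intersect if and only if their indices are comparable, with fibrations $\psi_{\beta,\alpha}:H_\beta(X_\alpha)\to X_\beta$ such that, for $\alpha<\beta<\gamma$, $\psi_{\beta,\alpha}$ maps $H_\beta(X_\alpha)\cap H_\gamma(X_\alpha)$ onto $H_\gamma(X_\beta)$ and $\psi_{\gamma,\alpha}=\psi_{\gamma,\beta}\circ\psi_{\beta,\alpha}$ there. Let $G$ act smoothly and boundary-freely, compatibly with the $\psi_{\beta,\alpha}$, with fixed isotropy group $B_\alpha$ on $X_\alpha$; let $Y_\alpha=X_\alpha/G$, with the induced fibrations $\phi_{\beta,\alpha}:H_\beta(Y_\alpha)\to Y_\beta$, be the quotient iterated space. (This includes the resolution of any smooth action of $G$ on a compact manifold.) Write $\iota$ for the inclusion $H_\beta(Y_\alpha)\to Y_\alpha$. The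 group $\widehat{G/B_\alpha}$ is the group of characters of $G$ trivial on $B_\alpha$, and $\widehat{B_\alpha}=\hat G/\widehat{G/B_\alpha}$. Fix principal connections on the principal $G/B_\alpha$-bundles $X_\alpha\to Y_\alpha$ which are compatible in that, over $H_\beta(X_\alpha)$, the connection on $X_\alpha$ reduces modulo the Lie algebra of $B_\beta$ to the pull-back of the connection on $X_\beta$. For $\hat h\in\widehat{G/B_\alpha}$ let $\mathrm{sh}(\hat h)$ be the line bundle over $Y_\alpha$ obtained by descent from $X_\alpha\times\mathbb C$ with action $g(x,z)=(gx,\hat h(g)z)$, with the connection $\nabla_{\hat h}$ induced by the principal connection, and let $\mathrm{Ch}(\hat h)$ be its Chern character form. The Chern character form of a bundle with connection $\nabla$ is $\operatorname{tr}\exp(i\nabla^2/2\pi)$. Reduced bundles and connections. A reduced bundle $W_*$ consists of smooth complex vector bundles $W_{\alpha,\hat g}$ over $Y_\alpha$, $\hat g\in\hat G$, whose support projects to a finite subset of $\widehat{B_\alpha}$, with isomorphisms $$\mathrm{sh}(\hat h)\otimes W_{\alpha,\hat h\hat g}\cong W_{\alpha,\hat g},\qquad \hat h\in\widehat{G/B_\alpha},$$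 consistent with products of characters, and with isomorphisms over $H_\beta(Y_\alpha)$, for $\alpha<\beta$, $$T_{\alpha\beta}:(\pi^{\#}W_\beta)_{\hat g}=\bigoplus_{\hat b\in\widehat{B_\beta},\ \hat b|_{B_\alpha}=\hat g|_{B_\alpha}}\mathrm{sh}(\hat h_{\hat b})\otimes\phi_{\beta,\alpha}^*W_{\beta,\hat h_{\hat b}\hat g}\ \cong\ W_{\alpha,\hat g}\big|_{H_\beta(Y_\alpha)},\qquad (\hat h_{\hat b}\hat g)|_{B_\beta}=\hat b,\ \hat h_{\hat b}\in\widehat{G/B_\alpha},$$ natural with respect to the twisting isomorphisms and compatible along chains $\alpha<\beta<\gamma$. A compatible (iterated) connection on $W_*$ consists of connections $\nabla_{\alpha,\hat g}$ on the $W_{\alpha,\hat g}$ such that the twisting isomorphisms identify $\nabla_{\hat h}\otimes\nabla_{\alpha,\hat h\hat g}$ with $\nabla_{\alpha,\hat g}$ and the $T_{\alpha\beta}$ intertwine the induced connections. Delocalized forms. The space $C^\infty(Y_\alpha;\Lambda^*_{\mathrm{dl}})=C^\infty(Y_\alpha;\Lambda^*)\otimes_{\mathrm{Ch}}R(G)$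 is the space of finite formal sums $\sum_i u_i\otimes\hat g_i$, with $u_i$ smooth complex forms on $Y_\alpha$ and $\hat g_i\in\hat G$, modulo the span of the relations $$(\mathrm{Ch}(\hat h)\wedge u)\otimes\hat g= u\otimes\hat h\hat g,\qquad \hat h\in\widehat{G/B_\alpha};$$ twisted forms on $H_\beta(Y_\alpha)$ are defined in the same way with $\iota^*\mathrm{Ch}(\hat h)$. The augmented pull-back is $\pi_{\alpha\beta}^{\#}(\sum_i u_i\otimes\hat g_i)=\sum_i\phi_{\beta,\alpha}^*u_i\otimes\hat g_i$. An element of the delocalized de Rham complex $C^\infty(Y_*;\Lambda^*_{\mathrm{dl}})$ is a family $u_\alpha\in C^\infty(Y_\alpha;\Lambda^*_{\mathrm{dl}})$, $\alpha\in A$, with $u_\alpha|_{H_\beta(Y_\alpha)}=\pi^{\#}_{\alpha\beta}u_\beta$ for all $\alpha<\beta$. Proposition. Let $W_*$ be a reduced bundle with compatible connection. Then the forms $\mathrm{Ch}(W_{\alpha,\hat g},\nabla_{\alpha,\hat g})$ are smooth forms on $Y_\alpha$ which satisfy the twisting relation $$\mathrm{Ch}(W_{\alpha,\hat g})=\mathrm{Ch}(\hat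 h)\wedge\mathrm{Ch}(W_{\alpha,\hat h\hat g}),\qquad \hat h\in\widehat{G/B_\alpha},$$ with support projecting to a finite subset of $\widehat{B_\alpha}$, and the Chern character of $W_*$, with components $$\mathrm{Ch}(W_*)_\alpha=\sum_{\hat b\in\widehat{B_\alpha}}\mathrm{Ch}(W_{\alpha,\sigma(\hat b)})\otimes\sigma(\hat b)\in C^\infty(Y_\alpha;\Lambda^*_{\mathrm{dl}}),$$ which do not depend on the section $\sigma:\widehat{B_\alpha}\to\hat G$ of the restriction map, is an element of the delocalized de Rham complex $C^\infty(Y_*;\Lambda^*_{\mathrm{dl}})$. -/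

import Mathlib

open scoped Manifold ContDiff TensorProduct

universe u

noncomputable section

namespace EqK

/-! ### Manifolds with corners -/

/-- The model with corners `[0,∞)ⁿ ⊆ ℝⁿ`. -/
abbrev quadrant (n : ℕ) := modelWithCornersEuclideanQuadrant n

section Hypersurfaces

variable {n : ℕ} (M : Type u) [TopologicalSpace M] [ChartedSpace (EuclideanQuadrant n) M]

/-- The codimension of the boundary face whose interior contains `x`: the number of coordinates
vanishing at `x` in the preferred chart at `x`. -/
def cornerDepth (x : M) : ℕ :=
  Set.ncard {i : Fin n | (chartAt (EuclideanQuadrant n) x x).1 i = 0}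

/-- The boundary hypersurfaces: closures of the components of the codimension one stratum. -/
def boundaryHypersurfaces : Set (Set M) :=
  {K | ∃ x : M, cornerDepth (n := n) M x = 1 ∧
    K = closure (connectedComponentIn {y : M | cornerDepth (n := n) M y = 1} x)}

end Hypersurfaces

/-- Compact manifolds with corners, with embedded boundary hypersurfaces: at a point of a
codimension `k` corner exactly `k` distinct boundary hypersurfaces meet. -/
structure CornerMfd where
  dim : ℕ
  carrier : Type u
  [top : TopologicalSpace carrier]
  [charted : ChartedSpace (EuclideanQuadrant dim) carrier]
  [mfd : IsManifold (quadrant dim) ∞ carrier]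
  [compact : CompactSpace carrier]
  [t2 : T2Space carrier]
  embedded : ∀ x : carrier,
    Set.encard {K ∈ boundaryHypersurfaces (n := dim) carrier | x ∈ K}
      = (cornerDepth (n := dim) carrier x : ℕ∞)

instance : CoeSort CornerMfd.{u} (Type u) := ⟨CornerMfd.carrier⟩

attribute [instance] CornerMfd.top CornerMfd.charted CornerMfd.mfd CornerMfd.compact CornerMfd.t2

/-- The model with corners of `M`. -/
abbrev CornerMfd.I (M : CornerMfd.{u}) := quadrant M.dim

/-- The tangent space of `M` at `x`. -/
abbrev CornerMfd.T (M : CornerMfd.{u}) (x : M) : Type := TangentSpace M.I x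

/-- The set `𝓜₁(M)` of boundary hypersurfaces. -/
def CornerMfd.hyps (M : CornerMfd.{u}) : Set (Set M) := boundaryHypersurfaces (n := M.dim) M

/-- Smooth maps between manifolds with corners. -/
def SmoothMap {M N : CornerMfd.{u}} (f : M → N) : Prop := ContMDiff M.I N.I ∞ f

/-- Complex valued functions smooth on a set. -/
def SmoothFunOn {M : CornerMfd.{u}} (U : Set M) (f : M → ℂ) : Prop := ContMDiffOn M.I 𝓘(ℝ, ℂ) ∞ f U

/-- The derivative of a map of manifolds with corners. -/
def D {M N : CornerMfd.{u}} (f : M → N) (x : M) : M.T x →L[ℝ] N.T (f x) := mfderiv M.I N.I f x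

/-- The differential of a complex valued function. -/
def dfun {M : CornerMfd.{u}} (f : M → ℂ) (x : M) : M.T x →L[ℝ] ℂ := mfderiv M.I 𝓘(ℝ, ℂ) f x

/-- `ρ` is a boundary defining function for the boundary hypersurface `K`. -/
structure IsBdf {M : CornerMfd.{u}} (K : Set M) (ρ : M → ℝ) : Prop where
  smooth : ContMDiff M.I 𝓘(ℝ, ℝ) ∞ ρ
  nonneg : ∀ x, 0 ≤ ρ x
  zero_iff : ∀ x, ρ x = 0 ↔ x ∈ K
  simple : ∀ x ∈ K, mfderiv M.I 𝓘(ℝ, ℝ) ρ x ≠ 0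

/-- Smooth interior b-maps: the pull-back of a boundary defining function is a smooth positive
function times a product of powers of boundary defining functions. -/
structure IsInteriorBMap {M N : CornerMfd.{u}} (f : M → N) : Prop where
  smooth : SmoothMap f
  bmap : ∀ K ∈ N.hyps, ∀ ρ : N → ℝ, IsBdf K ρ →
    ∃ (r : Set M → M → ℝ) (e : Set M → ℕ) (a : M → ℝ),
      (∀ L ∈ M.hyps, IsBdf L (r L)) ∧ ContMDiff M.I 𝓘(ℝ, ℝ) ∞ a ∧ (∀ x, 0 < a x) ∧
      ∀ x, ρ (f x) = a x * ∏ᶠ L ∈ M.hyps, (r L x) ^ (e L)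

/-- Fibrations: surjective interior b-maps with surjective differential. -/
structure IsFibration {M N : CornerMfd.{u}} (f : M → N) : Prop where
  bmap : IsInteriorBMap f
  surj : Function.Surjective f
  submersion : ∀ x, Function.Surjective (D f x)

/-- `i : H → M` is the inclusion of a collective boundary hypersurface, i.e. of a union of pairwise
disjoint boundary hypersurfaces, with its structure of a manifold with corners. -/
structure IsHypersurfaceInclusion {H M : CornerMfd.{u}} (i : H → M) : Prop where
  dim_eq : H.dim + 1 = M.dim
  smooth : SmoothMap i
  closedEmbedding : Topology.IsClosedEmbedding i
  immersion : ∀ p, Function.Injective (D i p)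
  range_eq : ∃ S ⊆ M.hyps, S.PairwiseDisjoint id ∧ Set.range i = ⋃₀ S

/-! ### Iterated spaces -/

/-- Iterated spaces indexed by a finite partially ordered set with least element (the index of the
principal space). For `α < β`, `H h` is the collective boundary hypersurface `H_β(X_α)`, `incl h` its
inclusion into `X_α` and `fib h` its fibration over `X_β`. -/
structure IteratedSpace (A : Type u) [PartialOrder A] [OrderBot A] where
  X : A → CornerMfd.{u}
  H : ∀ {α β : A}, α < β → CornerMfd.{u}
  incl : ∀ {α β : A} (h : α < β), H h → X α
  fib : ∀ {α β : A} (h : α < β), H h → X β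
  nonempty : ∀ α, Nonempty (X α)
  isIncl : ∀ {α β : A} (h : α < β), IsHypersurfaceInclusion (incl h)
  isFib : ∀ {α β : A} (h : α < β), IsFibration (fib h)
  /-- The boundary hypersurfaces of `X_α` are partitioned into the collective ones. -/
  partition : ∀ α, ∀ K ∈ (X α).hyps, ∃! β, ∃ h : α < β, K ⊆ Set.range (incl h)
  /-- Two collective boundary hypersurfaces intersect if and only if they are related. -/
  inter_iff : ∀ {α β γ : A} (h : α < β) (k : α < γ),
    (Set.range (incl h) ∩ Set.range (incl k)).Nonempty ↔ (β ≤ γ ∨ γ ≤ β)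
  /-- `H_γ(X_β)` is the image of `H_β(X_α) ∩ H_γ(X_α)`. -/
  image_inter : ∀ {α β γ : A} (h : α < β) (k : β < γ),
    fib h '' (incl h ⁻¹' Set.range (incl (h.trans k))) = Set.range (incl k)
  /-- Over `H_β(X_α) ∩ H_γ(X_α)` the fibration over `X_γ` factors through `H_γ(X_β)`. -/
  factor : ∀ {α β γ : A} (h : α < β) (k : β < γ) (p : H h) (p' : H (h.trans k)) (r : H k),
    incl h p = incl (h.trans k) p' → incl k r = fib h p → fib k r = fib (h.trans k) p'

/-! ### Compact abelian Lie groups and their actions -/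

/-- Compact abelian Lie groups. -/
structure AbLieGroup where
  dim : ℕ
  carrier : Type u
  [grp : CommGroup carrier]
  [top : TopologicalSpace carrier]
  [charted : ChartedSpace (EuclideanSpace ℝ (Fin dim)) carrier]
  [lie : LieGroup (𝓡 dim) ∞ carrier]
  [compact : CompactSpace carrier]
  [t2 : T2Space carrier]

instance : CoeSort AbLieGroup.{u} (Type u) := ⟨AbLieGroup.carrier⟩

attribute [instance] AbLieGroup.grp AbLieGroup.top AbLieGroup.charted AbLieGroup.lie
  AbLieGroup.compact AbLieGroup.t2

/-- The Lie algebra of `G`. -/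
abbrev AbLieGroup.lieAlg (G : AbLieGroup.{u}) : Type := TangentSpace (𝓡 G.dim) (1 : G)

/-- The dual group `Ĝ` of smooth characters `G → U(1)` (continuous characters of a Lie group are
automatically smooth). -/
def dual (G : AbLieGroup.{u}) : Subgroup (PontryaginDual G) where
  carrier := {χ | ContMDiff (𝓡 G.dim) 𝓘(ℝ, ℂ) ∞ (fun g : G => (χ g : ℂ))}
  one_mem' := by
    simpa using (contMDiff_const : ContMDiff (𝓡 G.dim) 𝓘(ℝ, ℂ) ∞ (fun _ : G => (1 : ℂ)))
  mul_mem' := by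
    intro χ ψ h k
    have e : (fun g : G => ((χ * ψ) g : ℂ)) = fun g : G => (χ g : ℂ) * (ψ g : ℂ) := by
      funext g
      exact Circle.coe_mul _ _
    simp only [Set.mem_ofPred_eq] at h k ⊢
    rw [e]
    exact (contDiff_mul (𝕜 := ℝ) (𝔸 := ℂ) (n := ∞)).contMDiff.comp (h.prodMk_space k)
  inv_mem' := by
    intro χ h
    have e : (fun g : G => ((χ⁻¹) g : ℂ)) = (fun g : G => (χ g : ℂ)) ∘ (fun g : G => g⁻¹) := by
      funext g
      simp only [Function.comp, map_inv]
      rfl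
    simp only [Set.mem_ofPred_eq] at h ⊢
    rw [e]
    exact h.comp (contMDiff_inv (𝓡 G.dim) ∞)

/-- The type of characters of `G`. -/
abbrev Dual (G : AbLieGroup.{u}) : Type u := ↥(dual G)

/-- The complex value of a character. -/
def Dual.val {G : AbLieGroup.{u}} (χ : Dual G) (g : G) : ℂ := (χ.1 g : ℂ)

/-- The dual of `G/B`: the characters of `G` which are trivial on `B`. The dual of `B` is the
quotient of `Dual G` by this subgroup. -/
def ann {G : AbLieGroup.{u}} (B : Subgroup G) : Subgroup (Dual G) where
  carrier := {χ | ∀ b ∈ B, χ.1 b = 1}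
  one_mem' := fun _ _ => rfl
  mul_mem' := by
    intro χ ψ h k b hb
    have : (χ * ψ).1 b = χ.1 b * ψ.1 b := rfl
    rw [this, h b hb, k b hb, mul_one]
  inv_mem' := by
    intro χ h b hb
    have : (χ⁻¹).1 b = (χ.1 b)⁻¹ := rfl
    rw [this, h b hb, inv_one]

/-- The differential `dχ_g : T_g G → ℂ` of a character. -/
def Dual.d {G : AbLieGroup.{u}} (χ : Dual G) (g : G) : TangentSpace (𝓡 G.dim) g →L[ℝ] ℂ :=
  mfderiv (𝓡 G.dim) 𝓘(ℝ, ℂ) χ.val g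

/-- Smooth, boundary free actions. -/
structure IsSmoothAction (G : AbLieGroup.{u}) (M : CornerMfd.{u}) [MulAction G M] : Prop where
  smooth : ContMDiff ((𝓡 G.dim).prod M.I) M.I ∞ (fun p : G × M => p.1 • p.2)
  boundaryFree : ∀ (g : G), ∀ K ∈ M.hyps,
    (fun x => g • x) '' K = K ∨ (fun x => g • x) '' K ∩ K = ∅

/-- A local trivialization of `q : M → N` as a principal bundle for the action of `G` modulo
isotropy: a smooth section `s` over an open set `U` such that points over `U` are smoothly related
to the section, `x = γ(x) • s(q(x))` with `γ` locally a smooth map to `G`. -/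
structure LocalTriv (G : AbLieGroup.{u}) {M N : CornerMfd.{u}} [MulAction G M] (q : M → N) where
  U : Set N
  isOpen_U : IsOpen U
  s : N → M
  smooth_s : ContMDiffOn N.I M.I ∞ s U
  sec : ∀ y ∈ U, q (s y) = y
  translate : ∀ x, q x ∈ U → ∃ (V : Set M) (γ : M → G), IsOpen V ∧ x ∈ V ∧
    ContMDiffOn M.I (𝓡 G.dim) ∞ γ V ∧ ∀ x' ∈ V, q x' ∈ U → x' = γ x' • s (q x')

/-- `q : M → N` is the smooth quotient `M → M/G` for an action with fixed isotropy group `B`; it is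
a principal `G/B`-bundle. -/
structure IsQuotient (G : AbLieGroup.{u}) {M N : CornerMfd.{u}} [MulAction G M] (B : Subgroup G)
    (q : M → N) : Prop where
  smooth : SmoothMap q
  surj : Function.Surjective q
  isotropy : ∀ x : M, MulAction.stabilizer G x = B
  orbit : ∀ x x' : M, q x = q x' ↔ ∃ g : G, x' = g • x
  triv : ∀ y : N, ∃ t : LocalTriv G q, y ∈ t.U

/-- An iterated space `X_*` with smooth `G`-action with fixed isotropy group `B_α` on each `X_α`,
together with its quotient `Y_*`, again an iterated space. -/
structure IteratedAction (G : AbLieGroup.{u}) (A : Type u) [PartialOrder A] [OrderBot A] where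
  total : IteratedSpace.{u} A
  base : IteratedSpace.{u} A
  actX : ∀ α, MulAction G (total.X α)
  actH : ∀ {α β : A} (h : α < β), MulAction G (total.H h)
  smoothX : ∀ α, IsSmoothAction G (total.X α)
  smoothH : ∀ {α β : A} (h : α < β), IsSmoothAction G (total.H h)
  incl_equivariant : ∀ {α β : A} (h : α < β) (g : G) (p : total.H h),
    total.incl h (g • p) = g • total.incl h p
  fib_equivariant : ∀ {α β : A} (h : α < β) (g : G) (p : total.H h),
    total.fib h (g • p) = g • total.fib h p
  B : A → Subgroup G
  closedB : ∀ α, IsClosed (B α : Set G)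
  q : ∀ α, total.X α → base.X α
  qH : ∀ {α β : A} (h : α < β), total.H h → base.H h
  quot : ∀ α, IsQuotient G (B α) (q α)
  quotH : ∀ {α β : A} (h : α < β), IsQuotient G (B α) (qH h)
  incl_q : ∀ {α β : A} (h : α < β) (p : total.H h), base.incl h (qH h p) = q α (total.incl h p)
  fib_q : ∀ {α β : A} (h : α < β) (p : total.H h), base.fib h (qH h p) = q β (total.fib h p)

attribute [instance] IteratedAction.actX IteratedAction.actH

/-! ### Differential forms -/

/-- A 1-form is smooth on `U` if it is locally a finite sum of terms `f dg`, with `f`, `g` smooth. -/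
def SmoothOneFormOn {M : CornerMfd.{u}} (U : Set M) (a : ∀ x : M, M.T x →L[ℝ] ℂ) : Prop :=
  ∀ x ∈ U, ∃ (V : Set M) (k : ℕ) (f g : Fin k → M → ℂ), IsOpen V ∧ x ∈ V ∧ V ⊆ U ∧
    (∀ j, SmoothFunOn V (f j)) ∧ (∀ j, SmoothFunOn V (g j)) ∧
    ∀ y ∈ V, a y = ∑ j, f j y • dfun (g j) y

/-- The complexified exterior algebra `Λ^*_x` of the cotangent space at `x`. -/
abbrev Lam (M : CornerMfd.{u}) (x : M) : Type := ExteriorAlgebra ℂ (M.T x →L[ℝ] ℂ)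

/-- Arbitrary (not necessarily continuous) sections of `Λ^*`; the product is the wedge product. -/
abbrev RawForm (M : CornerMfd.{u}) : Type u := ∀ x : M, Lam M x

/-- The sections of `Λ^*` given on `U` by sums of products of smooth functions and differentials of
smooth functions. -/
inductive SmoothFormOn {M : CornerMfd.{u}} (U : Set M) : RawForm M → Prop
  | func (f : M → ℂ) (hf : SmoothFunOn U f) : SmoothFormOn U (fun x => algebraMap ℂ (Lam M x) (f x))
  | diff (f : M → ℂ) (hf : SmoothFunOn U f) : SmoothFormOn U (fun x => ExteriorAlgebra.ι ℂ (dfun f x))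
  | add (v w : RawForm M) (hv : SmoothFormOn U v) (hw : SmoothFormOn U w) : SmoothFormOn U (v + w)
  | mul (v w : RawForm M) (hv : SmoothFormOn U v) (hw : SmoothFormOn U w) : SmoothFormOn U (v * w)
  | congr (v w : RawForm M) (hv : SmoothFormOn U v) (h : ∀ x ∈ U, v x = w x) : SmoothFormOn U w

/-- Smooth differential forms, with complex coefficients and of mixed degree. -/
def SmoothForm {M : CornerMfd.{u}} (v : RawForm M) : Prop :=
  ∀ x : M, ∃ U : Set M, IsOpen U ∧ x ∈ U ∧ SmoothFormOn U v

/-- Pull-back of differential forms. -/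
def pullForm {M N : CornerMfd.{u}} (f : M → N) (v : RawForm N) : RawForm M := fun x =>
  ExteriorAlgebra.map
    ({ toFun := fun l => l.comp (D f x)
       map_add' := fun _ _ => rfl
       map_smul' := fun _ _ => rfl } : (N.T (f x) →L[ℝ] ℂ) →ₗ[ℂ] (M.T x →L[ℝ] ℂ)) (v (f x))

/-- The exterior derivative of a 1-form: `d (∑ aⱼ dxⱼ) = ∑ᵢ dxᵢ ∧ ∑ⱼ ∂ᵢaⱼ dxⱼ` in the preferred chart
at `x`, in which the tangent space at `x` is identified with `ℝⁿ`. -/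
def extd {M : CornerMfd.{u}} (a : ∀ x : M, M.T x →L[ℝ] ℂ) (x : M) : Lam M x :=
  let φ := extChartAt M.I x
  let ã : EuclideanSpace ℝ (Fin M.dim) → (EuclideanSpace ℝ (Fin M.dim) →L[ℝ] ℂ) := fun z =>
    (a (φ.symm z)).comp
      (mfderivWithin 𝓘(ℝ, EuclideanSpace ℝ (Fin M.dim)) M.I φ.symm (Set.range M.I) z)
  ∑ i : Fin M.dim,
    ExteriorAlgebra.ι ℂ (M := M.T x →L[ℝ] ℂ)
        (Complex.ofRealCLM.comp (EuclideanSpace.proj (𝕜 := ℝ) i)) *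
      ExteriorAlgebra.ι ℂ (M := M.T x →L[ℝ] ℂ)
        (fderivWithin ℝ ã (Set.range M.I) (φ x) (EuclideanSpace.single i (1 : ℝ)))


/-- Restriction of the set on which a 1-form is smooth. -/
theorem SmoothOneFormOn.mono {M : CornerMfd.{u}} {U V : Set M} {a : ∀ x : M, M.T x →L[ℝ] ℂ}
    (h : SmoothOneFormOn U a) (hV : IsOpen V) (hVU : V ⊆ U) : SmoothOneFormOn V a := by
  intro x hx
  obtain ⟨W, k, f, g, hW, hxW, -, hf, hg, e⟩ := h x (hVU hx)
  exact ⟨W ∩ V, k, f, g, hW.inter hV, ⟨hxW, hx⟩, Set.inter_subset_right,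
    fun j => (hf j).mono Set.inter_subset_left, fun j => (hg j).mono Set.inter_subset_left,
    fun y hy => e y hy.1⟩

theorem SmoothOneFormOn.zero {M : CornerMfd.{u}} {U : Set M} (hU : IsOpen U) :
    SmoothOneFormOn U (fun _ : M => 0) := fun x hx =>
  ⟨U, 0, fun _ _ => 0, fun _ _ => 0, hU, hx, subset_rfl, fun j => j.elim0, fun j => j.elim0,
    fun y _ => by simp⟩

theorem SmoothOneFormOn.add {M : CornerMfd.{u}} {U : Set M} {a b : ∀ x : M, M.T x →L[ℝ] ℂ}
    (ha : SmoothOneFormOn U a) (hb : SmoothOneFormOn U b) :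
    SmoothOneFormOn U (fun x => a x + b x) := by
  intro x hx
  obtain ⟨V, k, f, g, hV, hxV, hVU, hf, hg, e⟩ := ha x hx
  obtain ⟨V', k', f', g', hV', hxV', -, hf', hg', e'⟩ := hb x hx
  refine ⟨V ∩ V', k + k', Fin.append f f', Fin.append g g', hV.inter hV', ⟨hxV, hxV'⟩,
    Set.inter_subset_left.trans hVU, ?_, ?_, ?_⟩
  · intro j
    refine Fin.addCases (fun i => ?_) (fun i => ?_) j
    · simpa [SmoothFunOn] using (hf i).mono Set.inter_subset_left
    · simpa [SmoothFunOn] using (hf' i).mono Set.inter_subset_right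
  · intro j
    refine Fin.addCases (fun i => ?_) (fun i => ?_) j
    · simpa [SmoothFunOn] using (hg i).mono Set.inter_subset_left
    · simpa [SmoothFunOn] using (hg' i).mono Set.inter_subset_right
  · intro y hy
    have : a y + b y = (∑ j, f j y • dfun (g j) y) + ∑ j, f' j y • dfun (g' j) y := by
      rw [e y hy.1, e' y hy.2]
    refine this.trans ?_
    rw [Fin.sum_univ_add]
    simp

theorem SmoothFunOn.pull {M N : CornerMfd.{u}} {f : M → N} {U : Set M} {V : Set N} {g : N → ℂ}
    (hf : ContMDiffOn M.I N.I ∞ f U) (hg : SmoothFunOn V g) (h : Set.MapsTo f U V) :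
    SmoothFunOn U (fun x => g (f x)) :=
  ContMDiffOn.comp hg hf h

/-- The chain rule `d(g ∘ f) = dg ∘ Df` at a point of an open set. -/
theorem dfun_comp {M N : CornerMfd.{u}} {f : M → N} {U : Set M} {V : Set N} {g : N → ℂ}
    (hU : IsOpen U) (hV : IsOpen V) (hf : ContMDiffOn M.I N.I ∞ f U) (hg : SmoothFunOn V g)
    {x : M} (hx : x ∈ U) (hfx : f x ∈ V) :
    dfun (fun x => g (f x)) x = (dfun g (f x)).comp (D f x) := by
  have h1 : MDifferentiableAt N.I 𝓘(ℝ, ℂ) g (f x) :=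
    (hg.contMDiffAt (hV.mem_nhds hfx)).mdifferentiableAt (by simp)
  have h2 : MDifferentiableAt M.I N.I f x :=
    (hf.contMDiffAt (hU.mem_nhds hx)).mdifferentiableAt (by simp)
  exact mfderiv_comp x h1 h2

theorem SmoothOneFormOn.pull {M N : CornerMfd.{u}} {f : M → N} {U : Set M} {V : Set N}
    {a : ∀ x : N, N.T x →L[ℝ] ℂ} (hU : IsOpen U) (hf : ContMDiffOn M.I N.I ∞ f U)
    (ha : SmoothOneFormOn V a) (h : Set.MapsTo f U V) :
    SmoothOneFormOn U (fun x => (a (f x)).comp (D f x)) := by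
  intro x hx
  obtain ⟨W, k, F, g, hW, hxW, hWV, hF, hg, e⟩ := ha (f x) (h hx)
  have ho : IsOpen (U ∩ f ⁻¹' W) := hf.continuousOn.isOpen_inter_preimage hU hW
  have hfo : ContMDiffOn M.I N.I ∞ f (U ∩ f ⁻¹' W) := hf.mono Set.inter_subset_left
  refine ⟨U ∩ f ⁻¹' W, k, fun j x => F j (f x), fun j x => g j (f x), ho, ⟨hx, hxW⟩,
    Set.inter_subset_left, fun j => (hF j).pull hfo fun y hy => hy.2,
    fun j => (hg j).pull hfo fun y hy => hy.2, fun y hy => ?_⟩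
  have : (a (f y)).comp (D f y) = (∑ j, F j (f y) • dfun (g j) (f y)).comp (D f y) := by
    rw [e (f y) hy.2]
  refine this.trans ?_
  ext v
  simp only [ContinuousLinearMap.comp_apply, _root_.sum_apply,
    _root_.smul_apply]
  refine Finset.sum_congr rfl fun j _ => ?_
  rw [dfun_comp ho hW hfo (hg j) hy hy.2]
  rfl

theorem SmoothFormOn.mono {M : CornerMfd.{u}} {U V : Set M} {v : RawForm M} (hv : SmoothFormOn U v)
    (h : V ⊆ U) : SmoothFormOn V v := by
  induction hv with
  | func f hf => exact .func f (hf.mono h)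
  | diff f hf => exact .diff f (hf.mono h)
  | add v w _ _ ihv ihw => exact .add v w ihv ihw
  | mul v w _ _ ihv ihw => exact .mul v w ihv ihw
  | congr v w _ e ih => exact .congr v w ih fun x hx => e x (h hx)

theorem SmoothFormOn.pull {M N : CornerMfd.{u}} {f : M → N} (hf : SmoothMap f) {U : Set N}
    (hU : IsOpen U) {v : RawForm N} (hv : SmoothFormOn U v) :
    SmoothFormOn (f ⁻¹' U) (pullForm f v) := by
  have ho : IsOpen (f ⁻¹' U) := hU.preimage hf.continuous
  induction hv with
  | func g hg =>
    refine .congr _ _ (.func (fun x => g (f x)) (hg.pull hf.contMDiffOn fun y hy => hy)) ?_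
    intro x _
    simp [pullForm]
  | diff g hg =>
    refine .congr _ _ (.diff (fun x => g (f x)) (hg.pull hf.contMDiffOn fun y hy => hy)) ?_
    intro x hx
    rw [dfun_comp ho hU hf.contMDiffOn hg hx hx]
    simp only [pullForm, ExteriorAlgebra.map_apply_ι]
    rfl
  | add v w _ _ ihv ihw =>
    refine .congr _ _ (.add _ _ ihv ihw) fun x _ => ?_
    simp [pullForm]
  | mul v w _ _ ihv ihw =>
    refine .congr _ _ (.mul _ _ ihv ihw) fun x _ => ?_
    simp [pullForm]
  | congr v w _ e ih =>
    refine .congr _ _ ih fun x hx => ?_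
    simp [pullForm, e (f x) hx]

/-- The subspace of smooth differential forms. -/
def smoothForms (M : CornerMfd.{u}) : Submodule ℂ (RawForm M) where
  carrier := {v | SmoothForm v}
  zero_mem' := by
    intro x
    refine ⟨Set.univ, isOpen_univ, trivial, .congr _ _ (.func (fun _ => 0) contMDiffOn_const) ?_⟩
    intro y _
    simp
  add_mem' := by
    intro v w hv hw x
    obtain ⟨U, hU, hx, h⟩ := hv x
    obtain ⟨U', hU', hx', h'⟩ := hw x
    exact ⟨U ∩ U', hU.inter hU', ⟨hx, hx'⟩, .add _ _ (h.mono Set.inter_subset_left)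
      (h'.mono Set.inter_subset_right)⟩
  smul_mem' := by
    intro c v hv x
    obtain ⟨U, hU, hx, h⟩ := hv x
    refine ⟨U, hU, hx, .congr _ _ (.mul _ _ (.func (fun _ => c) contMDiffOn_const) h) ?_⟩
    intro y _
    simp [Algebra.smul_def]

/-- The space `C^∞(M; Λ^*)` of smooth differential forms. -/
def Forms (M : CornerMfd.{u}) : Type u := ↥(smoothForms M)

instance (M : CornerMfd.{u}) : AddCommGroup (Forms M) := inferInstanceAs (AddCommGroup (smoothForms M))

instance (M : CornerMfd.{u}) : Module ℂ (Forms M) := inferInstanceAs (Module ℂ (smoothForms M))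

/-- The section of `Λ^*` underlying a smooth form. -/
def Forms.raw {M : CornerMfd.{u}} (v : Forms M) : RawForm M := Subtype.val (p := SmoothForm) v

/-- Pull-back of smooth forms under a smooth map. -/
def Forms.pull {M N : CornerMfd.{u}} (f : M → N) (hf : SmoothMap f) : Forms N →ₗ[ℂ] Forms M where
  toFun v := (⟨pullForm f v.raw, fun x => by
    obtain ⟨U, hU, hx, h⟩ := Subtype.prop (p := SmoothForm) v (f x)
    exact ⟨f ⁻¹' U, hU.preimage hf.continuous, hx, h.pull hf hU⟩⟩ : smoothForms M)
  map_add' v w := by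
    refine Subtype.ext (p := SmoothForm) (funext fun x => ?_)
    exact map_add _ (v.raw (f x)) (w.raw (f x))
  map_smul' c v := by
    refine Subtype.ext (p := SmoothForm) (funext fun x => ?_)
    exact map_smul _ c (v.raw (f x))

/-! ### Vector bundles and connections -/

open Classical in
/-- Smooth complex vector bundles over `M`, possibly of varying rank over different components, given
by smoothly related local frames. -/
structure CBundle (M : CornerMfd.{u}) where
  fiber : M → Type u
  [acg : ∀ x, AddCommGroup (fiber x)]
  [mod : ∀ x, Module ℂ (fiber x)]
  /-- The set indexing the local frames. -/
  Idx : Type u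
  U : Idx → Set M
  isOpen_U : ∀ i, IsOpen (U i)
  cover : ∀ x, ∃ i, x ∈ U i
  R : Idx → Type u
  [fin : ∀ i, Fintype (R i)]
  frame : ∀ i x, x ∈ U i → Module.Basis (R i) ℂ (fiber x)
  smooth_trans : ∀ i j (a : R i) (b : R j), SmoothFunOn (U i ∩ U j) fun x =>
    if h : x ∈ U i ∧ x ∈ U j then (frame i x h.1).repr (frame j x h.2 b) a else 0

attribute [instance] CBundle.acg CBundle.mod CBundle.fin

section Bundles

variable {M N : CornerMfd.{u}}

/-- Families of linear maps between the fibres of two bundles. -/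
abbrev FiberMaps (E F : CBundle M) : Type u := ∀ x, E.fiber x →ₗ[ℂ] F.fiber x

open Classical in
/-- The matrix entries of a bundle map in local frames. -/
def FiberMaps.mat {E F : CBundle M} (T : FiberMaps E F) (i : F.Idx) (j : E.Idx) (a : F.R i) (b : E.R j)
    (x : M) : ℂ :=
  if h : x ∈ F.U i ∧ x ∈ E.U j then (F.frame i x h.1).repr (T x (E.frame j x h.2 b)) a else 0

/-- Smoothness of a bundle map. -/
def FiberMaps.Smooth {E F : CBundle M} (T : FiberMaps E F) : Prop :=
  ∀ i j a b, SmoothFunOn (F.U i ∩ E.U j) (T.mat i j a b)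

/-- The identity. -/
def FiberMaps.id (E : CBundle M) : FiberMaps E E := fun _ => LinearMap.id

/-- Smooth bundle maps. -/
structure BundleMap (E F : CBundle M) where
  map : FiberMaps E F
  smooth : map.Smooth

/-- Smooth bundle isomorphisms. -/
structure BundleIso (E F : CBundle M) extends BundleMap E F where
  bij : ∀ x, Function.Bijective (map x)

/-- `T ∘ ∇^E = ∇^F ∘ T`, for connections with matrices of connection forms `A^E`, `A^F` in the local
frames. In matrices, `dT + A^F T = T A^E`. -/
def Intertwines {E F : CBundle M} (T : FiberMaps E F)
    (AE : ∀ i, E.R i → E.R i → ∀ x : M, M.T x →L[ℝ] ℂ)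
    (AF : ∀ i, F.R i → F.R i → ∀ x : M, M.T x →L[ℝ] ℂ) : Prop :=
  ∀ i j a b, ∀ x ∈ F.U i ∩ E.U j,
    dfun (T.mat i j a b) x + ∑ c, T.mat i j c b x • AF i a c x = ∑ c, T.mat i j a c x • AE j c b x

/-- Connections: in the local frame `e` over `U i` the connection is `∇ e_b = ∑ A_ab ⊗ e_a`, where
`A` is the matrix `form i` of smooth 1-forms; over the intersections the matrices are related by the
transformation law, i.e. the local connections agree. -/
structure Connection (E : CBundle M) where
  form : ∀ i, E.R i → E.R i → ∀ x : M, M.T x →L[ℝ] ℂ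
  smooth : ∀ i a b, SmoothOneFormOn (E.U i) (form i a b)
  gauge : Intertwines (FiberMaps.id E) form form

/-- `T` intertwines two connections. -/
def FiberMaps.Parallel {E F : CBundle M} (T : FiberMaps E F) (C : Connection E) (C' : Connection F) :
    Prop :=
  Intertwines T C.form C'.form

open Classical in
/-- The curvature `∇² = dA + A ∧ A` in a local frame. -/
def Connection.curv {E : CBundle M} (C : Connection E) (i : E.Idx) (x : M) :
    Matrix (E.R i) (E.R i) (Lam M x) := fun a b =>
  extd (C.form i a b) x +
    ∑ c, ExteriorAlgebra.ι ℂ (C.form i a c x) * ExteriorAlgebra.ι ℂ (C.form i c b x)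

open Classical in
/-- The Chern character form `tr exp (i ∇² / 2π)`; the terms of the exponential series beyond the
dimension of `M` vanish. It does not depend on the frame used to compute it. -/
def Connection.chern {E : CBundle M} (C : Connection E) : RawForm M := fun x =>
  let i := Classical.choose (E.cover x)
  ∑ k ∈ Finset.range (M.dim + 1),
    ((k.factorial : ℂ)⁻¹ * (Complex.I / (2 * Real.pi)) ^ k) • Matrix.trace (C.curv i x ^ k)

/-- Pull-back of bundles. -/
def CBundle.pull (f : M → N) (hf : SmoothMap f) (E : CBundle N) : CBundle M where
  fiber x := E.fiber (f x)
  Idx := E.Idx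
  U i := f ⁻¹' E.U i
  isOpen_U i := (E.isOpen_U i).preimage hf.continuous
  cover x := E.cover (f x)
  R := E.R
  frame i x h := E.frame i (f x) h
  smooth_trans i j a b := (E.smooth_trans i j a b).pull hf.contMDiffOn fun _ h => h

/-- Pull-back of connections. -/
def Connection.pull (f : M → N) (hf : SmoothMap f) {E : CBundle N} (C : Connection E) :
    Connection (E.pull f hf) where
  form i a b x := (C.form i a b (f x)).comp (D f x)
  smooth i a b := (C.smooth i a b).pull ((E.isOpen_U i).preimage hf.continuous) hf.contMDiffOn
    fun _ h => h
  gauge := by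
    intro i j a b x hx
    have ho : IsOpen (E.U i ∩ E.U j) := (E.isOpen_U i).inter (E.isOpen_U j)
    have key := C.gauge i j a b (f x) hx
    have hd := dfun_comp (f := f) (ho.preimage hf.continuous) ho hf.contMDiffOn
      (E.smooth_trans i j a b) (x := x) hx hx
    have hd' : dfun ((FiberMaps.id (E.pull f hf)).mat i j a b) x
        = (dfun ((FiberMaps.id E).mat i j a b) (f x)).comp (D f x) := hd
    rw [hd']
    have := congrArg (fun l : N.T (f x) →L[ℝ] ℂ => l.comp (D f x)) key
    simp only [ContinuousLinearMap.add_comp, ContinuousLinearMap.finsetSum_comp,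
      ContinuousLinearMap.smul_comp] at this
    exact this

theorem FiberMaps.mat_of_mem {E F : CBundle M} (T : FiberMaps E F) {i : F.Idx} {j : E.Idx}
    (a : F.R i) (b : E.R j) {x : M} (hi : x ∈ F.U i) (hj : x ∈ E.U j) :
    T.mat i j a b x = (F.frame i x hi).repr (T x (E.frame j x hj b)) a :=
  dif_pos ⟨hi, hj⟩

theorem smooth_mat_id (E : CBundle M) (i j a b) :
    SmoothFunOn (E.U i ∩ E.U j) ((FiberMaps.id E).mat i j a b) := E.smooth_trans i j a b

theorem tensorProduct_repr_basis {V W I J I' J' : Type u} [AddCommGroup V] [Module ℂ V]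
    [AddCommGroup W] [Module ℂ W] (e : Module.Basis I ℂ V) (f : Module.Basis J ℂ W)
    (e' : Module.Basis I' ℂ V) (f' : Module.Basis J' ℂ W) (a : I × J) (b : I' × J') :
    (e.tensorProduct f).repr (e'.tensorProduct f' b) a =
      e.repr (e' b.1) a.1 * f.repr (f' b.2) a.2 := by
  rw [Module.Basis.tensorProduct_apply', Module.Basis.tensorProduct_repr_tmul_apply]
  simp [mul_comm]

/-- Tensor products of bundles. -/
def CBundle.tensor (E F : CBundle M) : CBundle M where
  fiber x := E.fiber x ⊗[ℂ] F.fiber x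
  Idx := E.Idx × F.Idx
  U i := E.U i.1 ∩ F.U i.2
  isOpen_U i := (E.isOpen_U i.1).inter (F.isOpen_U i.2)
  cover x := by
    obtain ⟨i, hi⟩ := E.cover x
    obtain ⟨j, hj⟩ := F.cover x
    exact ⟨(i, j), hi, hj⟩
  R i := E.R i.1 × F.R i.2
  frame i x h := (E.frame i.1 x h.1).tensorProduct (F.frame i.2 x h.2)
  smooth_trans i j a b := by
    have h1 := (smooth_mat_id E i.1 j.1 a.1 b.1).mono
      (show (E.U i.1 ∩ F.U i.2) ∩ (E.U j.1 ∩ F.U j.2) ⊆ E.U i.1 ∩ E.U j.1 from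
        fun x h => ⟨h.1.1, h.2.1⟩)
    have h2 := (smooth_mat_id F i.2 j.2 a.2 b.2).mono
      (show (E.U i.1 ∩ F.U i.2) ∩ (E.U j.1 ∩ F.U j.2) ⊆ F.U i.2 ∩ F.U j.2 from
        fun x h => ⟨h.1.2, h.2.2⟩)
    have h3 := (contDiff_mul (𝕜 := ℝ) (𝔸 := ℂ) (n := ∞)).contMDiff.comp_contMDiffOn
      (h1.prodMk_space h2)
    refine h3.congr fun x hx => ?_
    refine (dif_pos (show x ∈ E.U i.1 ∩ F.U i.2 ∧ x ∈ E.U j.1 ∩ F.U j.2 from hx)).trans ?_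
    simp only [Function.comp]
    rw [FiberMaps.mat_of_mem _ _ _ hx.1.1 hx.2.1, FiberMaps.mat_of_mem _ _ _ hx.1.2 hx.2.2]
    exact tensorProduct_repr_basis _ _ _ _ _ _

theorem tensor_mat {E F : CBundle M} (i j : E.Idx × F.Idx) (a : E.R i.1 × F.R i.2)
    (b : E.R j.1 × F.R j.2) {x : M} (hi : x ∈ (E.tensor F).U i) (hj : x ∈ (E.tensor F).U j) :
    (FiberMaps.id (E.tensor F)).mat i j a b x =
      (FiberMaps.id E).mat i.1 j.1 a.1 b.1 x * (FiberMaps.id F).mat i.2 j.2 a.2 b.2 x := by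
  refine (FiberMaps.mat_of_mem (FiberMaps.id (E.tensor F)) _ _ hi hj).trans ?_
  rw [FiberMaps.mat_of_mem _ _ _ hi.1 hj.1, FiberMaps.mat_of_mem _ _ _ hi.2 hj.2]
  exact tensorProduct_repr_basis _ _ _ _ _ _

theorem dfun_mul {f g : M → ℂ} {U : Set M} (hU : IsOpen U) (hf : SmoothFunOn U f)
    (hg : SmoothFunOn U g) {x : M} (hx : x ∈ U) :
    dfun (fun y => f y * g y) x = g x • dfun f x + f x • dfun g x := by
  have h1 : MDifferentiableAt M.I 𝓘(ℝ, ℂ) f x :=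
    (hf.contMDiffAt (hU.mem_nhds hx)).mdifferentiableAt (by simp)
  have h2 : MDifferentiableAt M.I 𝓘(ℝ, ℂ) g x :=
    (hg.contMDiffAt (hU.mem_nhds hx)).mdifferentiableAt (by simp)
  have := (h1.hasMFDerivAt.mul h2.hasMFDerivAt).mfderiv
  rw [add_comm]
  exact this

theorem dfun_congr {f g : M → ℂ} {U : Set M} (hU : IsOpen U) (h : ∀ y ∈ U, f y = g y) {x : M}
    (hx : x ∈ U) : dfun f x = dfun g x :=
  Filter.EventuallyEq.mfderiv_eq (Filter.eventually_of_mem (hU.mem_nhds hx) h)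

theorem SmoothOneFormOn.const_smul {U : Set M} {a : ∀ x : M, M.T x →L[ℝ] ℂ}
    (ha : SmoothOneFormOn U a) (c : ℂ) : SmoothOneFormOn U (fun x => c • a x) := by
  intro x hx
  obtain ⟨V, k, f, g, hV, hxV, hVU, hf, hg, e⟩ := ha x hx
  refine ⟨V, k, fun j y => c * f j y, g, hV, hxV, hVU, fun j => ?_, hg, fun y hy => ?_⟩
  · exact (contDiff_const.mul contDiff_id : ContDiff ℝ ∞ fun z : ℂ => c * z).contMDiff.comp_contMDiffOn
      (hf j)
  · have : c • a y = c • ∑ j, f j y • dfun (g j) y := by rw [e y hy]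
    refine this.trans ?_
    simp [Finset.smul_sum, mul_smul]

open Classical in
theorem sum_tensor_left {R R' V : Type*} [Fintype R] [Fintype R'] [AddCommGroup V] [Module ℂ V]
    (t : R → ℂ) (t' : R' → ℂ) (A : R → V) (A' : R' → V) (a : R) (a' : R') :
    (∑ c : R × R', (t c.1 * t' c.2) •
      ((if a' = c.2 then (1 : ℂ) else 0) • A c.1 + (if a = c.1 then (1 : ℂ) else 0) • A' c.2)) =
      t' a' • (∑ c, t c • A c) + t a • ∑ c, t' c • A' c := by
  simp only [smul_add, Finset.sum_add_distrib, Fintype.sum_prod_type, Finset.smul_sum]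
  congr 1
  · refine Finset.sum_congr rfl fun c _ => ?_
    rw [Finset.sum_eq_single a']
    · simp [smul_smul, mul_comm]
    · intro d _ hd
      simp [Ne.symm hd]
    · simp
  · rw [Finset.sum_eq_single a]
    · simp [smul_smul]
    · intro d _ hd
      simp [Ne.symm hd]
    · simp

open Classical in
theorem sum_tensor_right {R R' V : Type*} [Fintype R] [Fintype R'] [AddCommGroup V] [Module ℂ V]
    (t : R → ℂ) (t' : R' → ℂ) (A : R → V) (A' : R' → V) (a : R) (a' : R') :
    (∑ c : R × R', (t c.1 * t' c.2) •
      ((if c.2 = a' then (1 : ℂ) else 0) • A c.1 + (if c.1 = a then (1 : ℂ) else 0) • A' c.2)) =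
      t' a' • (∑ c, t c • A c) + t a • ∑ c, t' c • A' c := by
  rw [← sum_tensor_left]
  simp only [eq_comm]

open Classical in
/-- The tensor product connection `∇^E ⊗ 1 + 1 ⊗ ∇^F`. -/
def Connection.tensor {E F : CBundle M} (C : Connection E) (C' : Connection F) :
    Connection (E.tensor F) where
  form i a b x :=
    (if a.2 = b.2 then (1 : ℂ) else 0) • C.form i.1 a.1 b.1 x +
      (if a.1 = b.1 then (1 : ℂ) else 0) • C'.form i.2 a.2 b.2 x
  smooth i a b :=
    (((C.smooth i.1 a.1 b.1).mono ((E.tensor F).isOpen_U i) fun _ h => h.1).const_smul _).add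
      (((C'.smooth i.2 a.2 b.2).mono ((E.tensor F).isOpen_U i) fun _ h => h.2).const_smul _)
  gauge := by
    intro i j a b x hx
    have hi := (E.tensor F).isOpen_U i
    have hj := (E.tensor F).isOpen_U j
    have hUo := hi.inter hj
    have hm : ∀ a b, ∀ y ∈ (E.tensor F).U i ∩ (E.tensor F).U j,
        (FiberMaps.id (E.tensor F)).mat i j a b y =
          (FiberMaps.id E).mat i.1 j.1 a.1 b.1 y * (FiberMaps.id F).mat i.2 j.2 a.2 b.2 y :=
      fun a b y hy => tensor_mat i j a b hy.1 hy.2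
    have h1 := (smooth_mat_id E i.1 j.1 a.1 b.1).mono
      (show (E.tensor F).U i ∩ (E.tensor F).U j ⊆ E.U i.1 ∩ E.U j.1 from
        fun x h => ⟨h.1.1, h.2.1⟩)
    have h2 := (smooth_mat_id F i.2 j.2 a.2 b.2).mono
      (show (E.tensor F).U i ∩ (E.tensor F).U j ⊆ F.U i.2 ∩ F.U j.2 from
        fun x h => ⟨h.1.2, h.2.2⟩)
    rw [dfun_congr hUo (hm a b) hx, dfun_mul hUo h1 h2 hx]
    have e1 := C.gauge i.1 j.1 a.1 b.1 x ⟨hx.1.1, hx.2.1⟩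
    have e2 := C'.gauge i.2 j.2 a.2 b.2 x ⟨hx.1.2, hx.2.2⟩
    simp only [hm _ _ x hx]
    set t := fun p q => (FiberMaps.id E).mat i.1 j.1 p q x with ht
    set t' := fun p q => (FiberMaps.id F).mat i.2 j.2 p q x with ht'
    have s1 := sum_tensor_left (fun p => t p b.1) (fun p => t' p b.2)
      (fun c => C.form i.1 a.1 c x) (fun c => C'.form i.2 a.2 c x) a.1 a.2
    have s2 := sum_tensor_right (fun p => t a.1 p) (fun p => t' a.2 p)
      (fun c => C.form j.1 c b.1 x) (fun c => C'.form j.2 c b.2 x) b.1 b.2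
    refine Eq.trans (congrArg₂ (· + ·) rfl s1) (Eq.trans ?_ s2.symm)
    rw [← e1, ← e2]
    simp only [smul_add, ht, ht']
    abel

end Bundles

/-! ### The bundles obtained by descent of characters -/

section Shift

variable {G : AbLieGroup.{u}} {M N : CornerMfd.{u}} [MulAction G M]

/-- The fibre over `y` of the bundle on `M/G` obtained by descent of the equivariant trivial line
bundle `M × ℂ`, with action `g (x, z) = (g x, χ(g) z)`: its invariant sections over the orbit. -/
def shiftFiber (q : M → N) (χ : Dual G) (y : N) : Submodule ℂ ({x : M // q x = y} → ℂ) where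
  carrier := {f | ∀ (g : G) (x x' : {x : M // q x = y}), x'.1 = g • x.1 → f x' = χ.val g * f x}
  zero_mem' := by
    intro g x x' _
    simp
  add_mem' := by
    intro f f' h h' g x x' e
    simp [h g x x' e, h' g x x' e, mul_add]
  smul_mem' := by
    intro c f h g x x' e
    simp [h g x x' e, mul_left_comm]

theorem Dual.val_one {χ : Dual G} : χ.val 1 = 1 := by
  have : χ.1 1 = 1 := map_one χ.1
  simp [Dual.val, this]

theorem Dual.val_mul {χ : Dual G} (g h : G) : χ.val (g * h) = χ.val g * χ.val h := by
  have : χ.1 (g * h) = χ.1 g * χ.1 h := map_mul χ.1 g h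
  simp [Dual.val, this]

theorem Dual.val_ne_zero {χ : Dual G} (g : G) : χ.val g ≠ 0 := Circle.coe_ne_zero _

theorem Dual.val_of_mem {χ : Dual G} {B : Subgroup G} (h : χ ∈ ann B) {b : G} (hb : b ∈ B) :
    χ.val b = 1 := by
  have : χ.1 b = 1 := h b hb
  simp [Dual.val, this]

theorem Dual.smooth_val (χ : Dual G) : ContMDiff (𝓡 G.dim) 𝓘(ℝ, ℂ) ∞ χ.val := χ.2

/-- Evaluation at a point of the orbit. -/
def shiftEval {B : Subgroup G} {q : M → N} (hq : IsQuotient G B q) {χ : Dual G} (hχ : χ ∈ ann B)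
    {y : N} (x₀ : {x : M // q x = y}) : shiftFiber q χ y ≃ₗ[ℂ] ℂ :=
  LinearEquiv.ofBijective
    ({ toFun := fun f => f.1 x₀
       map_add' := fun _ _ => rfl
       map_smul' := fun _ _ => rfl } : shiftFiber q χ y →ₗ[ℂ] ℂ) <| by
    have horb : ∀ x : {x : M // q x = y}, ∃ g : G, x.1 = g • x₀.1 := fun x =>
      (hq.orbit x₀.1 x.1).1 (x₀.2.trans x.2.symm)
    constructor
    · rw [← LinearMap.ker_eq_bot, LinearMap.ker_eq_bot']
      intro f hf
      ext x
      obtain ⟨g, hg⟩ := horb x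
      have h0 : f.1 x₀ = 0 := hf
      rw [f.2 g x₀ x hg, h0]
      simp
    · intro z
      choose κ hκ using horb
      refine ⟨⟨fun x => χ.val (κ x) * z, ?_⟩, ?_⟩
      · intro g x x' e
        have h1 : (κ x')⁻¹ * (g * κ x) ∈ B := by
          rw [← hq.isotropy x₀.1, MulAction.mem_stabilizer_iff, mul_smul, mul_smul, ← hκ x, ← e,
            inv_smul_eq_iff, ← hκ x']
        have h2 := Dual.val_of_mem hχ h1
        have h3 : χ.val (κ x') = χ.val (g * κ x) := by
          have : g * κ x = κ x' * ((κ x')⁻¹ * (g * κ x)) := by group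
          rw [this, Dual.val_mul, h2, mul_one]
        change χ.val (κ x') * z = χ.val g * (χ.val (κ x) * z)
        rw [h3, Dual.val_mul, mul_assoc]
      · have h1 : κ x₀ ∈ B := by
          rw [← hq.isotropy x₀.1, MulAction.mem_stabilizer_iff, ← hκ x₀]
        change χ.val (κ x₀) * z = z
        rw [Dual.val_of_mem hχ h1, one_mul]

/-- Two local sections are related by a smooth map to the group. -/
theorem LocalTriv.transition {q : M → N} (t t' : LocalTriv G q) {y : N} (hy : y ∈ t.U ∩ t'.U) :
    ∃ (W : Set N) (κ : N → G), IsOpen W ∧ y ∈ W ∧ W ⊆ t.U ∩ t'.U ∧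
      ContMDiffOn N.I (𝓡 G.dim) ∞ κ W ∧ ∀ z ∈ W, t.s z = κ z • t'.s z := by
  obtain ⟨V, γ, hV, hyV, hγ, e⟩ := t'.translate (t.s y) (by rw [t.sec y hy.1]; exact hy.2)
  have hs : ContMDiffOn N.I M.I ∞ t.s (t.U ∩ t'.U) := t.smooth_s.mono Set.inter_subset_left
  refine ⟨(t.U ∩ t'.U) ∩ t.s ⁻¹' V, fun z => γ (t.s z),
    hs.continuousOn.isOpen_inter_preimage (t.isOpen_U.inter t'.isOpen_U) hV, ⟨hy, hyV⟩,
    Set.inter_subset_left, ?_, ?_⟩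
  · exact hγ.comp (hs.mono Set.inter_subset_left) fun z hz => hz.2
  · intro z hz
    have := e (t.s z) hz.2 (by rw [t.sec z hz.1.1]; exact hz.1.2)
    rwa [t.sec z hz.1.1] at this

open Classical in
/-- The line bundle over `N = M/G` obtained by descent of a character `χ` of `G/B`. The local frame
corresponding to a local section `s` of `q` is the invariant section which is `1` on `s`. -/
def shiftBundle {B : Subgroup G} {q : M → N} (hq : IsQuotient G B q) (χ : Dual G) (hχ : χ ∈ ann B) :
    CBundle N where
  fiber y := shiftFiber q χ y
  Idx := LocalTriv G q
  U t := t.U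
  isOpen_U t := t.isOpen_U
  cover y := hq.triv y
  R _ := PUnit
  frame t y hy := (Module.Basis.singleton PUnit ℂ).map (shiftEval hq hχ ⟨t.s y, t.sec y hy⟩).symm
  smooth_trans t t' a b := by
    intro y hy
    obtain ⟨W, κ, hW, hyW, hWU, hκ, e⟩ := t.transition t' hy
    have h1 : ContMDiffOn N.I 𝓘(ℝ, ℂ) ∞ (fun z => χ.val (κ z)) W :=
      χ.smooth_val.comp_contMDiffOn hκ
    have h2 := h1.congr (f₁ := fun x => if h : x ∈ t.U ∧ x ∈ t'.U then
      ((Module.Basis.singleton PUnit ℂ).map (shiftEval hq hχ ⟨t.s x, t.sec x h.1⟩).symm).repr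
      (((Module.Basis.singleton PUnit ℂ).map (shiftEval hq hχ ⟨t'.s x, t'.sec x h.2⟩).symm) b) a
      else 0) (fun z hz => by
        have hz' := hWU hz
        rw [dif_pos ⟨hz'.1, hz'.2⟩]
        simp only [Module.Basis.map_apply, Module.Basis.map_repr, Module.Basis.singleton_apply,
          LinearEquiv.trans_apply, LinearEquiv.symm_symm, Module.Basis.singleton_repr]
        set f := (shiftEval hq hχ ⟨t'.s z, t'.sec z hz'.2⟩).symm 1 with hf
        have h3 : f.1 ⟨t'.s z, t'.sec z hz'.2⟩ = 1 :=
          (shiftEval hq hχ ⟨t'.s z, t'.sec z hz'.2⟩).apply_symm_apply 1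
        have h4 := f.2 (κ z) ⟨t'.s z, t'.sec z hz'.2⟩ ⟨t.s z, t.sec z hz'.1⟩ (e z hz)
        rw [h3, mul_one] at h4
        exact h4)
    exact (h2.contMDiffAt (hW.mem_nhds hyW)).contMDiffWithinAt

theorem shift_mat {B : Subgroup G} {q : M → N} (hq : IsQuotient G B q) (χ : Dual G) (hχ : χ ∈ ann B)
    (t t' : LocalTriv G q) (a b : PUnit) {z : N} (hz : z ∈ t.U ∩ t'.U) {k : G}
    (e : t.s z = k • t'.s z) :
    (FiberMaps.id (shiftBundle hq χ hχ)).mat t t' a b z = χ.val k := by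
  refine (FiberMaps.mat_of_mem (FiberMaps.id (shiftBundle hq χ hχ)) _ _ hz.1 hz.2).trans ?_
  change ((Module.Basis.singleton PUnit ℂ).map (shiftEval hq hχ ⟨t.s z, t.sec z hz.1⟩).symm).repr
      (((Module.Basis.singleton PUnit ℂ).map (shiftEval hq hχ ⟨t'.s z, t'.sec z hz.2⟩).symm) b) a = _
  simp only [Module.Basis.map_apply, Module.Basis.map_repr, Module.Basis.singleton_apply,
    LinearEquiv.trans_apply, LinearEquiv.symm_symm, Module.Basis.singleton_repr]
  set f := (shiftEval hq hχ ⟨t'.s z, t'.sec z hz.2⟩).symm 1 with hf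
  have h3 : f.1 ⟨t'.s z, t'.sec z hz.2⟩ = 1 :=
    (shiftEval hq hχ ⟨t'.s z, t'.sec z hz.2⟩).apply_symm_apply 1
  have h4 := f.2 k ⟨t'.s z, t'.sec z hz.2⟩ ⟨t.s z, t.sec z hz.1⟩ e
  rw [h3, mul_one] at h4
  exact h4

/-- Principal connections on the principal `G/B`-bundle `M → M/G`, given by a `𝔤`-valued 1-form `θ`
whose reduction modulo the Lie algebra of `B` is the connection form. The reduction is seen through
the characters of `G/B`; the condition is that the pull-back of `θ` under the action `G × M → M` is
the sum of `θ` and the Maurer-Cartan form of `G`. -/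
structure PrincipalConn (M : CornerMfd.{u}) [MulAction G M] (B : Subgroup G) where
  form : ∀ x : M, M.T x →L[ℝ] G.lieAlg
  smooth : ∀ l : G.lieAlg →L[ℝ] ℂ, SmoothOneFormOn Set.univ fun x => l.comp (form x)
  action : ∀ χ ∈ ann B, ∀ (g : G) (x : M) (w : TangentSpace ((𝓡 G.dim).prod M.I) (g, x)),
    χ.d 1 (form (g • x)
        (mfderiv ((𝓡 G.dim).prod M.I) M.I (fun p : G × M => p.1 • p.2) (g, x) w)) =
      χ.d 1 (form x w.2) + (χ.val g)⁻¹ * χ.d g w.1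

/-- The connection on the descended line bundle induced by a principal connection `θ`: it is given by
the invariant connection `d - dχ(θ)` on the trivial bundle `M × ℂ`, so in the frame corresponding to
a local section `s` the connection form is `- s^* dχ(θ)`. -/
def shiftConnection {B : Subgroup G} {q : M → N} (hq : IsQuotient G B q) (hM : IsSmoothAction G M)
    (θ : PrincipalConn (G := G) M B) (χ : Dual G) (hχ : χ ∈ ann B) :
    Connection (shiftBundle hq χ hχ) where
  form t _ _ y := -(((χ.d 1).comp (θ.form (t.s y))).comp (D t.s y))
  smooth t a b := by
    have h := ((θ.smooth (χ.d 1)).pull t.isOpen_U t.smooth_s (Set.mapsTo_univ _ _)).const_smul (-1)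
    have e : (fun y => -(((χ.d 1).comp (θ.form (t.s y))).comp (D t.s y))) =
        fun y => (-1 : ℂ) • ((χ.d 1).comp (θ.form (t.s y))).comp (D t.s y) := by
      funext y
      ext v
      exact (neg_one_mul _).symm
    exact e ▸ h
  gauge := by
    intro t t' a b y hy
    obtain ⟨W, κ, hW, hyW, hWU, hκ, e⟩ := LocalTriv.transition t t' hy
    have hm : ∀ z ∈ W, (FiberMaps.id (shiftBundle hq χ hχ)).mat t t' a b z = χ.val (κ z) :=
      fun z hz => shift_mat hq χ hχ t t' a b (hWU hz) (e z hz)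
    have hκ1 : MDifferentiableAt N.I (𝓡 G.dim) κ y :=
      (hκ.contMDiffAt (hW.mem_nhds hyW)).mdifferentiableAt (by simp)
    have hs1 : MDifferentiableAt N.I M.I t'.s y :=
      (t'.smooth_s.contMDiffAt (t'.isOpen_U.mem_nhds hy.2)).mdifferentiableAt (by simp)
    have ha1 : MDifferentiableAt ((𝓡 G.dim).prod M.I) M.I (fun p : G × M => p.1 • p.2)
        (κ y, t'.s y) := hM.smooth.mdifferentiableAt (by simp)
    have hχ1 : MDifferentiableAt (𝓡 G.dim) 𝓘(ℝ, ℂ) χ.val (κ y) :=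
      χ.smooth_val.mdifferentiableAt (by simp)
    have hd : dfun ((FiberMaps.id (shiftBundle hq χ hχ)).mat t t' a b) y =
        (χ.d (κ y)).comp (mfderiv N.I (𝓡 G.dim) κ y) := by
      rw [dfun_congr hW hm hyW]
      exact mfderiv_comp y hχ1 hκ1
    have hmy := hm y hyW
    have hds : ∀ v : N.T y, D t.s y v =
        mfderiv ((𝓡 G.dim).prod M.I) M.I (fun p : G × M => p.1 • p.2) (κ y, t'.s y)
          (mfderiv N.I (𝓡 G.dim) κ y v, D t'.s y v) := by
      intro v
      have h1 : D t.s y = mfderiv N.I M.I (fun z => κ z • t'.s z) y :=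
        Filter.EventuallyEq.mfderiv_eq (Filter.eventually_of_mem (hW.mem_nhds hyW) e)
      have h2 : mfderiv N.I M.I (fun z => κ z • t'.s z) y =
          (mfderiv ((𝓡 G.dim).prod M.I) M.I (fun p : G × M => p.1 • p.2) (κ y, t'.s y)).comp
            ((mfderiv N.I (𝓡 G.dim) κ y).prod (mfderiv N.I M.I t'.s y)) := by
        have h3 := (hκ1.hasMFDerivAt.prodMk hs1.hasMFDerivAt)
        exact (HasMFDerivAt.comp y ha1.hasMFDerivAt h3).mfderiv
      rw [h1, h2]
      rfl
    have hθ : ∀ (m m' : M) (_ : m = m') (v : EuclideanSpace ℝ (Fin M.dim)),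
        (θ.form m (v : M.T m) : G.lieAlg) = θ.form m' (v : M.T m') := by
      rintro m _ rfl v
      rfl
    have key : ∀ v : N.T y, χ.d 1 (θ.form (t.s y) (D t.s y v)) =
        χ.d 1 (θ.form (t'.s y) (D t'.s y v)) +
          (χ.val (κ y))⁻¹ * χ.d (κ y) (mfderiv N.I (𝓡 G.dim) κ y v) := by
      intro v
      rw [hds v]
      refine Eq.trans (congrArg (χ.d 1) (hθ _ _ (e y hyW) _)) ?_
      exact θ.action χ hχ (κ y) (t'.s y) (mfderiv N.I (𝓡 G.dim) κ y v, D t'.s y v)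
    have hne : χ.val (κ y) ≠ 0 := Dual.val_ne_zero _
    ext v
    have hall : ∀ c d, (FiberMaps.id (shiftBundle hq χ hχ)).mat t t' c d y = χ.val (κ y) :=
      fun c d => shift_mat hq χ hχ t t' c d hy (e y hyW)
    rw [hd]
    have goal : χ.d (κ y) (mfderiv N.I (𝓡 G.dim) κ y v) +
        χ.val (κ y) * -χ.d 1 (θ.form (t.s y) (D t.s y v)) =
        χ.val (κ y) * -χ.d 1 (θ.form (t'.s y) (D t'.s y v)) := by
      rw [key v]
      field_simp
      ring
    simp only [hall]
    have hs : ∀ l : N.T y →L[ℝ] ℂ, (∑ _c : PUnit.{u+1}, χ.val (κ y) • l) = χ.val (κ y) • l :=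
      fun l => by simp
    refine Eq.trans ?_ (goal.trans ?_)
    · exact congrArg (fun l : N.T y →L[ℝ] ℂ => χ.d (κ y) (mfderiv N.I (𝓡 G.dim) κ y v) + l v) (hs _)
    · exact (congrArg (fun l : N.T y →L[ℝ] ℂ => l v)
        (hs (-(((χ.d 1).comp (θ.form (t'.s y))).comp (D t'.s y))))).symm

end Shift

/-- The value at a point of the orbit of an element of the fibre of a descended line bundle. -/
def shiftVal {G : AbLieGroup.{u}} {M N : CornerMfd.{u}} [MulAction G M] {B : Subgroup G} {q : M → N}
    {hq : IsQuotient G B q} {χ : Dual G} {hχ : χ ∈ ann B} {y : N}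
    (l : (shiftBundle hq χ hχ).fiber y) (x : M) (hx : q x = y) : ℂ :=
  (show shiftFiber q χ y from l).1 ⟨x, hx⟩

/-- Pure tensors in the fibres of a tensor product of bundles. -/
def CBundle.tmul {M : CornerMfd.{u}} {E F : CBundle M} {x : M} (v : E.fiber x) (w : F.fiber x) :
    (E.tensor F).fiber x :=
  (v ⊗ₜ[ℂ] w : E.fiber x ⊗[ℂ] F.fiber x)

/-- The identification of the fibres of a bundle over equal points. -/
def CBundle.cast {M : CornerMfd.{u}} (E : CBundle M) {x y : M} (h : x = y) (v : E.fiber x) :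
    E.fiber y :=
  h ▸ v

/-! ### Reduced bundles -/

namespace IteratedAction

variable {G : AbLieGroup.{u}} {A : Type u} [PartialOrder A] [OrderBot A] (R : IteratedAction G A)

/-- The line bundle over `Y_α` obtained by descent of a character of `G/B_α`. -/
abbrev shift (α : A) (χ : Dual G) (hχ : χ ∈ ann (R.B α)) : CBundle (R.base.X α) :=
  shiftBundle (R.quot α) χ hχ

theorem smooth_incl {α β : A} (h : α < β) : SmoothMap (R.base.incl h) := (R.base.isIncl h).smooth

theorem smooth_fib {α β : A} (h : α < β) : SmoothMap (R.base.fib h) := (R.base.isFib h).bmap.smooth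

/-- Restriction to `H_β(Y_α)` of a bundle over `Y_α`. -/
abbrev res {α β : A} (h : α < β) (E : CBundle (R.base.X α)) : CBundle (R.base.H h) :=
  E.pull (R.base.incl h) (R.smooth_incl h)

/-- Pull-back to `H_β(Y_α)` of a bundle over `Y_β`. -/
abbrev lift {α β : A} (h : α < β) (E : CBundle (R.base.X β)) : CBundle (R.base.H h) :=
  E.pull (R.base.fib h) (R.smooth_fib h)

/-- The data of a reduced bundle: bundles `W α g` over `Y_α`, for `g ∈ Ĝ`, the isomorphisms
`shift(χ) ⊗ W_{χ g} ≅ W_g` for `χ ∈ (G/B_α)^`, which are consistent for products of characters, and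
the components over `H_β(Y_α)` of the connecting isomorphisms. -/
structure ReducedData where
  W : ∀ α, Dual G → CBundle (R.base.X α)
  /-- The support is finite when projected to the dual of `B_α`. -/
  finite : ∀ α, ((QuotientGroup.mk : Dual G → Dual G ⧸ ann (R.B α)) ''
    {g | ∃ y, Nontrivial ((W α g).fiber y)}).Finite
  twist : ∀ (α : A) {χ : Dual G} (hχ : χ ∈ ann (R.B α)) {g g' : Dual G} (_ : g' = χ * g),
    BundleIso ((R.shift α χ hχ).tensor (W α g')) (W α g)
  twist_one : ∀ (α : A) (h1 : (1 : Dual G) ∈ ann (R.B α)) (g : Dual G) (e : g = 1 * g)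
    (y : R.base.X α) (l : (R.shift α 1 h1).fiber y) (w : (W α g).fiber y),
    (∀ x hx, shiftVal l x hx = 1) → (twist α h1 e).map y (CBundle.tmul l w) = w
  twist_mul : ∀ (α : A) {χ χ' χ'' : Dual G} (hχ : χ ∈ ann (R.B α)) (hχ' : χ' ∈ ann (R.B α))
    (hχ'' : χ'' ∈ ann (R.B α)) {g g' g'' : Dual G} (e : g' = χ * g) (e' : g'' = χ' * g')
    (e'' : g'' = χ'' * g) (y : R.base.X α) (l : (R.shift α χ hχ).fiber y)
    (l' : (R.shift α χ' hχ').fiber y) (l'' : (R.shift α χ'' hχ'').fiber y) (w : (W α g'').fiber y),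
    (∀ x hx, shiftVal l'' x hx = shiftVal l x hx * shiftVal l' x hx) →
    (twist α hχ e).map y (CBundle.tmul l ((twist α hχ' e').map y (CBundle.tmul l' w))) =
      (twist α hχ'' e'').map y (CBundle.tmul l'' w)
  part : ∀ {α β : A} (h : α < β) (g : Dual G), BundleMap (R.lift h (W β g)) (R.res h (W α g))

variable {R}

/-- The component
`shift(χ) ⊗ φ_{βα}^* W_{β, χ g} → W_{α, g}` over `H_β(Y_α)`, for `χ ∈ (G/B_α)^`, of the connecting map
`T_{αβ}`: by naturality with respect to the twisting isomorphisms it is the composite of the component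
`φ_{βα}^* W_{β, χ g} → W_{α, χ g}` and of `shift(χ) ⊗ W_{α, χ g} ≅ W_{α, g}`. -/
def ReducedData.comp (W : R.ReducedData) {α β : A} (h : α < β) {χ : Dual G} (hχ : χ ∈ ann (R.B α))
    {g g' : Dual G} (e : g' = χ * g) :
    FiberMaps ((R.res h (R.shift α χ hχ)).tensor (R.lift h (W.W β g'))) (R.res h (W.W α g)) :=
  fun p => ((W.twist α hχ e).map (R.base.incl h p)).comp
    (LinearMap.lTensor ((R.shift α χ hχ).fiber (R.base.incl h p)) ((W.part h g').map p))

/-- The index set of the sum defining the augmented pull-back at `g ∈ Ĝ`: the elements of the dual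
of `B_β` with the same restriction to `B_α` as `g`. -/
def AugIdx (R : IteratedAction G A) (α β : A) (g : Dual G) : Type u :=
  {c : Dual G ⧸ ann (R.B β) // c.out * g⁻¹ ∈ ann (R.B α)}

open Classical in
/-- The connecting map `T_{αβ}` at `g ∈ Ĝ`, from the augmented pull-back
`(π^# W_β)_g = ⨁ shift(χ) ⊗ φ_{βα}^* W_{β, χ g}` to the restriction of `W_{α, g}` to `H_β(Y_α)`. The
sum is over the dual of `B_β` restricted to `B_α`, with `χ g` the chosen representatives. -/
def ReducedData.aug (W : R.ReducedData) {α β : A} (h : α < β) (g : Dual G) (p : R.base.H h) :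
    (DirectSum (AugIdx R α β g) fun c =>
      ((R.res h (R.shift α _ c.2)).tensor (R.lift h (W.W β c.1.out))).fiber p) →ₗ[ℂ]
      (R.res h (W.W α g)).fiber p :=
  DirectSum.toModule ℂ _ _ fun c => W.comp h c.2 (by group) p

variable (R)

/-- Reduced bundles `W_*` over `Y_*`. -/
structure ReducedBundle extends R.ReducedData where
  /-- The connecting maps are isomorphisms. -/
  iso : ∀ {α β : A} (h : α < β) (g : Dual G) (p : R.base.H h),
    Function.Bijective (toReducedData.aug h g p)
  /-- The connecting maps commute with the twisting isomorphisms for `χ ∈ (G/B_β)^`, where the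
  invariant functions on orbits in `X_β` are pulled back to orbits in `H_β(X_α)`. -/
  natural : ∀ {α β : A} (h : α < β) {χ : Dual G} (hα : χ ∈ ann (R.B α)) (hβ : χ ∈ ann (R.B β))
    {g g' : Dual G} (e : g' = χ * g) (p : R.base.H h) (l : (R.shift β χ hβ).fiber (R.base.fib h p))
    (l' : (R.shift α χ hα).fiber (R.base.incl h p)) (w : (W β g').fiber (R.base.fib h p)),
    (∀ (x : R.total.H h) (hx : R.qH h x = p),
      shiftVal l' (R.total.incl h x) (by rw [← R.incl_q, hx]) =
        shiftVal l (R.total.fib h x) (by rw [← R.fib_q, hx])) →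
    (part h g).map p ((twist β hβ e).map (R.base.fib h p) (CBundle.tmul l w)) =
      (twist α hα e).map (R.base.incl h p) (CBundle.tmul l' ((part h g').map p w))
  /-- Over `H_β(Y_α) ∩ H_γ(Y_α)` the connecting map from `Y_γ` to `Y_α` is the composite of the
  connecting maps from `Y_γ` to `Y_β` and from `Y_β` to `Y_α`. -/
  chain : ∀ {α β γ : A} (h : α < β) (k : β < γ) (g : Dual G) (p : R.base.H h)
    (p' : R.base.H (h.trans k)) (r : R.base.H k) (e1 : R.base.incl h p = R.base.incl (h.trans k) p')
    (e2 : R.base.incl k r = R.base.fib h p) (w : (W γ g).fiber (R.base.fib k r)),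
    (part (h.trans k) g).map p' ((W γ g).cast (R.base.factor h k p p' r e1 e2) w) =
      (W α g).cast e1 ((part h g).map p ((W β g).cast e2 ((part k g).map r w)))

/-- Compatible principal connections on the principal `G/B_α`-bundles `X_α → Y_α`: over `H_β(X_α)`
the connection on `X_α` reduces modulo the Lie algebra of `B_β` to the pull-back of the connection on
`X_β`. -/
structure IteratedPrincipalConn where
  conn : ∀ α, PrincipalConn (R.total.X α) (R.B α)
  compat : ∀ {α β : A} (h : α < β), ∀ χ ∈ ann (R.B β), ∀ (p : R.total.H h) (v : (R.total.H h).T p),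
    χ.d 1 ((conn β).form (R.total.fib h p) (D (R.total.fib h) p v)) =
      χ.d 1 ((conn α).form (R.total.incl h p) (D (R.total.incl h) p v))

variable {R}

/-- The connection on the line bundle over `Y_α` given by a character of `G/B_α`. -/
def IteratedPrincipalConn.shift (θ : R.IteratedPrincipalConn) (α : A) (χ : Dual G)
    (hχ : χ ∈ ann (R.B α)) : Connection (R.shift α χ hχ) :=
  shiftConnection (R.quot α) (R.smoothX α) (θ.conn α) χ hχ

/-- The Chern character `Ch(χ)` of a character of `G/B_α`, as a form on `Y_α`. -/
def IteratedPrincipalConn.chern (θ : R.IteratedPrincipalConn) (α : A) (χ : ann (R.B α)) :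
    RawForm (R.base.X α) :=
  (θ.shift α χ.1 χ.2).chern

/-- Iterated connections on a reduced bundle: connections on the bundles `W_{α, g}` which are
compatible with the twisting isomorphisms and with the augmented pull-back isomorphisms. -/
structure IteratedConnection (θ : R.IteratedPrincipalConn) (W : R.ReducedBundle) where
  conn : ∀ (α : A) (g : Dual G), Connection (W.W α g)
  twist : ∀ (α : A) {χ : Dual G} (hχ : χ ∈ ann (R.B α)) {g g' : Dual G} (e : g' = χ * g),
    (W.twist α hχ e).map.Parallel ((θ.shift α χ hχ).tensor (conn α g')) (conn α g)
  aug : ∀ {α β : A} (h : α < β) {χ : Dual G} (hχ : χ ∈ ann (R.B α)) {g g' : Dual G} (e : g' = χ * g),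
    (W.comp h hχ e).Parallel
      (((θ.shift α χ hχ).pull (R.base.incl h) (R.smooth_incl h)).tensor
        ((conn β g').pull (R.base.fib h) (R.smooth_fib h)))
      ((conn α g).pull (R.base.incl h) (R.smooth_incl h))

end IteratedAction

/-! ### Twisted forms and the delocalized de Rham complex -/

section Twisted

variable {G : AbLieGroup.{u}} {M M' : CornerMfd.{u}} {S : Subgroup (Dual G)}

/-- The relations `(Ch(χ) ∧ u) ⊗ g = u ⊗ χ g`, for `χ ∈ S`, in `C^∞(M; Λ^*) ⊗ R(G)`. -/
def twistRel (c : S → RawForm M) : Submodule ℂ (Dual G →₀ Forms M) :=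
  Submodule.span ℂ {z | ∃ (χ : S) (g : Dual G) (v w : Forms M), w.raw = c χ * v.raw ∧
    z = Finsupp.single g w - Finsupp.single (χ.1 * g) v}

/-- The space `C^∞(M; Λ^*_dl) = C^∞(M; Λ^*) ⊗_Ch R(G)` of twisted forms. -/
abbrev TwistedForms (c : S → RawForm M) : Type u := (Dual G →₀ Forms M) ⧸ twistRel c

/-- The class of the formal product `u ⊗ g`. -/
def twisted (c : S → RawForm M) (v : Forms M) (g : Dual G) : TwistedForms c :=
  Submodule.Quotient.mk (Finsupp.single g v)

/-- Pull-back of formal sums `∑ u_i ⊗ g_i`, acting on the forms `u_i`. -/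
def pullSum (G : AbLieGroup.{u}) (f : M → M') (hf : SmoothMap f) :
    (Dual G →₀ Forms M') →ₗ[ℂ] (Dual G →₀ Forms M) :=
  Finsupp.mapRange.linearMap (Forms.pull f hf)

/-- Restriction of twisted forms; the twisting is by the restricted forms. -/
def TwistedForms.restrict {c : S → RawForm M'} (f : M → M') (hf : SmoothMap f) :
    TwistedForms c →ₗ[ℂ] TwistedForms (fun χ => pullForm f (c χ)) :=
  Submodule.mapQ _ _ (pullSum G f hf) <| by
    refine Submodule.span_le.2 ?_
    rintro z ⟨χ, g, v, w, e, rfl⟩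
    refine Submodule.subset_span ⟨χ, g, Forms.pull f hf v, Forms.pull f hf w, ?_, ?_⟩
    · funext x
      change pullForm f w.raw x = pullForm f (c χ) x * pullForm f v.raw x
      rw [e]
      simp [pullForm]
    · rw [map_sub]
      simp [pullSum]

/-- `v` is the augmented pull-back `f^# z` of the twisted form `z`: the map given on formal sums by
`∑ u_i ⊗ g_i ↦ ∑ f^* u_i ⊗ g_i` takes every representative of `z` to a representative of `v`. -/
def IsAugPullback {S S' : Subgroup (Dual G)} {c : S → RawForm M} {c' : S' → RawForm M'} (f : M → M')
    (hf : SmoothMap f) (z : TwistedForms c') (v : TwistedForms c) : Prop :=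
  ∀ s : Dual G →₀ Forms M', (Submodule.Quotient.mk s : TwistedForms c') = z →
    (Submodule.Quotient.mk (pullSum G f hf s) : TwistedForms c) = v

end Twisted

/-- Elements of the delocalized de Rham complex `C^∞(Y_*; Λ^*_dl)`. -/
structure DelocalizedForm {G : AbLieGroup.{u}} {A : Type u} [PartialOrder A] [OrderBot A]
    {R : IteratedAction G A} (θ : R.IteratedPrincipalConn) where
  form : ∀ α, TwistedForms (θ.chern α)
  compat : ∀ {α β : A} (h : α < β),
    IsAugPullback (R.base.fib h) (R.smooth_fib h) (form β)
      (TwistedForms.restrict (R.base.incl h) (R.smooth_incl h) (form α))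

end EqK
end

/-! This is Chern-Weil theory in local frames. Near each point a smooth 1-form is `∑ fⱼ dgⱼ`, and
`extd_of_eq_sum` evaluates its derivative as `∑ dfⱼ ∧ dgⱼ`. The Leibniz rule, `d dg = 0` and
naturality under pull-back are read off from this.

Three properties of the Chern character form carry the proof. Additivity: differentiating `dT + A'T
= TA` gives `F'T = TF` for the curvatures (`curv_intertwine`), so if parallel maps decompose a fibre
as a direct sum, the traces of the powers of the curvature add up (`chern_eq_sum`). With a single
summand this gives independence of the frame and invariance under parallel isomorphisms.
Multiplicativity: tensoring with a line bundle adds its curvature `w` times the identity; since `w`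
has degree two it is central, and the exponential factors (`chern_tensor_line`). Naturality:
`chern_pull`. Forms of degree above the dimension vanish, so the truncation of the series is
harmless throughout.

The twisting relation is invariance under the twisting isomorphism together with multiplicativity.
It shows that the class of `Ch(W_{α,g}) ⊗ g` depends only on the restriction of `g` to `B_α`, hence
that the section is immaterial.

For compatibility over `H_β(Y_α)`, the isomorphism `T_{αβ}` writes the restriction of `Ch(W_{α,g})`
as a sum of terms `ι^*Ch(χ) ∧ φ^*Ch(W_{β,χg})`. In the twisted forms, such a term tensored with `g`
equals `φ^*Ch(W_{β,χg}) ⊗ χg`, which is a term of the augmented pull-back. Summing over the dual of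
`B_α` collects the fibres of the restriction from the dual of `B_β` to the dual of `B_α`.

That every representative has the same augmented pull-back requires `φ^*Ch(χ) = ι^*Ch(χ)` for
characters of `G/B_β` (`chern_compat`). Both sides can be computed from a local section of `H_β(X_α)
→ H_β(Y_α)`, along which the two principal connections agree. This rests on
`pullForm_extd_shiftForm`: two local lifts of the same map change the connection form by a
logarithmic differential, which is closed. -/

noncomputable section

namespace EqK

/-! ### The exterior derivative of 1-forms -/

section ExteriorDerivative

open Set Filter Topology

variable {M N : CornerMfd.{u}}

/-- A complex linear combination of coordinate differentials represents any covector. -/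
theorem sum_smul_proj {n : ℕ} (l : EuclideanSpace ℝ (Fin n) →L[ℝ] ℂ) :
    l = ∑ i, l (EuclideanSpace.single i (1 : ℝ)) •
      (Complex.ofRealCLM.comp (EuclideanSpace.proj (𝕜 := ℝ) i) :
        EuclideanSpace ℝ (Fin n) →L[ℝ] ℂ) := by
  ext v
  have hv : v = ∑ i, v i • EuclideanSpace.single i (1 : ℝ) := by
    ext j
    simp [Finset.sum_apply, Pi.single_apply]
  conv_lhs => rw [hv]
  simp [mul_comm]

/-- The wedge product of a symmetric bilinear form vanishes. -/
theorem sum_wedge_symm {n : ℕ}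
    (H : EuclideanSpace ℝ (Fin n) →L[ℝ] EuclideanSpace ℝ (Fin n) →L[ℝ] ℂ)
    (hH : ∀ v w, H v w = H w v) :
    ∑ i : Fin n, ExteriorAlgebra.ι ℂ (Complex.ofRealCLM.comp (EuclideanSpace.proj (𝕜 := ℝ) i) :
        EuclideanSpace ℝ (Fin n) →L[ℝ] ℂ) *
      ExteriorAlgebra.ι ℂ (H (EuclideanSpace.single i (1 : ℝ))) = 0 := by
  set d : Fin n → (EuclideanSpace ℝ (Fin n) →L[ℝ] ℂ) := fun i =>
    Complex.ofRealCLM.comp (EuclideanSpace.proj (𝕜 := ℝ) i) with hd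
  set e : Fin n → EuclideanSpace ℝ (Fin n) := fun i => EuclideanSpace.single i (1 : ℝ) with he
  set S := ∑ i : Fin n, ExteriorAlgebra.ι ℂ (d i) * ExteriorAlgebra.ι ℂ (H (e i)) with hS
  have h1 : S = ∑ i, ∑ j, H (e i) (e j) • (ExteriorAlgebra.ι ℂ (d i) * ExteriorAlgebra.ι ℂ (d j)) := by
    refine Finset.sum_congr rfl fun i _ => ?_
    conv_lhs => rw [sum_smul_proj (H (e i)), map_sum, Finset.mul_sum]
    simp only [map_smul, mul_smul_comm]
    rfl
  -- Exchanging the two indices preserves the symmetric coefficients and reverses the sign of every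
  -- product of covectors.
  have h2 : S = -S := by
    conv_rhs => rw [h1]
    conv_lhs => rw [h1, Finset.sum_comm]
    rw [← Finset.sum_neg_distrib]
    refine Finset.sum_congr rfl fun i _ => ?_
    rw [← Finset.sum_neg_distrib]
    refine Finset.sum_congr rfl fun j _ => ?_
    rw [hH (e j) (e i), ← smul_neg]
    congr 1
    exact eq_neg_of_add_eq_zero_left (ExteriorAlgebra.ι_add_mul_swap _ _)
  have h3 : (2 : ℂ) • S = 0 := by
    rw [two_smul]
    nth_rewrite 1 [h2]
    simp
  exact (smul_eq_zero.1 h3).resolve_left two_ne_zero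

/-- A function in the preferred chart at `x`. -/
def inChart (x : M) (f : M → ℂ) (z : EuclideanSpace ℝ (Fin M.dim)) : ℂ :=
  f ((extChartAt M.I x).symm z)

theorem contDiffWithinAt_inChart {x : M} {f : M → ℂ} {U : Set M} (hU : IsOpen U)
    (hf : SmoothFunOn U f) (hx : x ∈ U) :
    ContDiffWithinAt ℝ ∞ (inChart x f) (range M.I) (extChartAt M.I x x) := by
  have h : ContMDiffAt M.I 𝓘(ℝ, ℂ) ∞ f x := hf.contMDiffAt (hU.mem_nhds hx)
  have := (contMDiffAt_iff.1 h).2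
  simp only [extChartAt_model_space_eq_id, PartialEquiv.refl_coe, Function.id_comp] at this
  exact this

theorem dfun_eq_inChart {x : M} {f : M → ℂ} {U : Set M} (hU : IsOpen U)
    (hf : SmoothFunOn U f) (hx : x ∈ U) :
    dfun f x = fderivWithin ℝ (inChart x f) (range M.I) (extChartAt M.I x x) := by
  have h : MDifferentiableAt M.I 𝓘(ℝ, ℂ) f x :=
    (hf.contMDiffAt (hU.mem_nhds hx)).mdifferentiableAt (by simp)
  have := h.mfderiv
  unfold dfun
  rw [this]
  rfl

/-- The differential of a function, in the coordinates of the preferred chart at `x`. -/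
theorem dfun_comp_symm {x : M} {g : M → ℂ} {U : Set M} (hU : IsOpen U) (hg : SmoothFunOn U g)
    {z : EuclideanSpace ℝ (Fin M.dim)} (hz : z ∈ (extChartAt M.I x).target)
    (hzU : (extChartAt M.I x).symm z ∈ U) :
    (dfun g ((extChartAt M.I x).symm z)).comp
      (mfderivWithin 𝓘(ℝ, EuclideanSpace ℝ (Fin M.dim)) M.I (extChartAt M.I x).symm
        (range M.I) z) = fderivWithin ℝ (inChart x g) (range M.I) z := by
  have h1 : MDifferentiableAt M.I 𝓘(ℝ, ℂ) g ((extChartAt M.I x).symm z) :=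
    (hg.contMDiffAt (hU.mem_nhds hzU)).mdifferentiableAt (by simp)
  have h2 := mdifferentiableWithinAt_extChartAt_symm (I := M.I) (x := x) hz
  have h3 : UniqueMDiffWithinAt 𝓘(ℝ, EuclideanSpace ℝ (Fin M.dim)) (range M.I) z :=
    (M.I.uniqueDiffOn z (extChartAt_target_subset_range x hz)).uniqueMDiffWithinAt
  have := mfderiv_comp_mfderivWithin z h1 h2 h3
  rw [mfderivWithin_eq_fderivWithin] at this
  exact this.symm

/-- `d (∑ fⱼ dgⱼ) = ∑ dfⱼ ∧ dgⱼ`. -/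
theorem extd_of_eq_sum {x : M} {V : Set M} (hV : IsOpen V) (hx : x ∈ V) {k : Type*} [Fintype k]
    {f g : k → M → ℂ} (hf : ∀ j, SmoothFunOn V (f j)) (hg : ∀ j, SmoothFunOn V (g j))
    {a : ∀ x : M, M.T x →L[ℝ] ℂ} (ha : ∀ y ∈ V, a y = ∑ j, f j y • dfun (g j) y) :
    extd a x = ∑ j, ExteriorAlgebra.ι ℂ (dfun (f j) x) * ExteriorAlgebra.ι ℂ (dfun (g j) x) := by
  set s := range M.I with hs
  set z₀ := extChartAt M.I x x with hz₀
  have hz₀s : z₀ ∈ s := extChartAt_target_subset_range x (mem_extChartAt_target x)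
  -- At a boundary point all derivatives are taken within the quadrant `s`, where they are still
  -- uniquely determined.
  have huniq : UniqueDiffOn ℝ s := M.I.uniqueDiffOn
  have hF := fun j => contDiffWithinAt_inChart hV (hf j) hx
  have hG := fun j => contDiffWithinAt_inChart hV (hg j) hx
  have hG' : ∀ j, ContDiffWithinAt ℝ ∞ (fderivWithin ℝ (inChart x (g j)) s) s z₀ := fun j =>
    (hG j).fderivWithin_right huniq (by simp) hz₀s
  set ã : EuclideanSpace ℝ (Fin M.dim) → (EuclideanSpace ℝ (Fin M.dim) →L[ℝ] ℂ) := fun z =>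
    (a ((extChartAt M.I x).symm z)).comp
      (mfderivWithin 𝓘(ℝ, EuclideanSpace ℝ (Fin M.dim)) M.I (extChartAt M.I x).symm s z) with hã
  have hloc : ∀ z ∈ (extChartAt M.I x).target, (extChartAt M.I x).symm z ∈ V →
      ã z = ∑ j, inChart x (f j) z • fderivWithin ℝ (inChart x (g j)) s z := by
    intro z hz hzV
    rw [hã]
    simp only
    rw [ha _ hzV]
    refine Eq.trans (ContinuousLinearMap.finsetSum_comp _ _) (Finset.sum_congr rfl fun j _ => ?_)
    rw [← dfun_comp_symm hV (hg j) hz hzV]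
    rfl
  -- The coordinate formula is valid only inside the chart and over `V`; the derivative at `z₀` sees
  -- no more than that.
  have hev : ã =ᶠ[𝓝[s] z₀] fun z =>
      ∑ j, inChart x (f j) z • fderivWithin ℝ (inChart x (g j)) s z := by
    have h1 : (extChartAt M.I x).target ∈ 𝓝[s] z₀ := extChartAt_target_mem_nhdsWithin x
    have h2 : (extChartAt M.I x).symm ⁻¹' V ∈ 𝓝[s] z₀ := by
      have hc := (continuousAt_extChartAt_symm (I := M.I) x)
      have : (extChartAt M.I x).symm z₀ ∈ V := by rwa [hz₀, extChartAt_to_inv]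
      exact mem_nhdsWithin_of_mem_nhds (hc.preimage_mem_nhds (hV.mem_nhds this))
    filter_upwards [h1, h2] with z hz hz'
    exact hloc z hz hz'
  have hd1 : ∀ j, HasFDerivWithinAt (inChart x (f j))
      (fderivWithin ℝ (inChart x (f j)) s z₀) s z₀ := fun j =>
    ((hF j).differentiableWithinAt (by simp)).hasFDerivWithinAt
  have hd2 : ∀ j, HasFDerivWithinAt (fderivWithin ℝ (inChart x (g j)) s)
      (fderivWithin ℝ (fderivWithin ℝ (inChart x (g j)) s) s z₀) s z₀ := fun j =>
    ((hG' j).differentiableWithinAt (by simp)).hasFDerivWithinAt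
  have hD : fderivWithin ℝ ã s z₀ = ∑ j, (inChart x (f j) z₀ •
      fderivWithin ℝ (fderivWithin ℝ (inChart x (g j)) s) s z₀ +
      (fderivWithin ℝ (inChart x (f j)) s z₀).smulRight
        (fderivWithin ℝ (inChart x (g j)) s z₀)) := by
    rw [hev.fderivWithin_eq_of_mem hz₀s]
    exact (HasFDerivWithinAt.fun_sum fun j _ => (hd1 j).smul (hd2 j)).fderivWithin
      (huniq z₀ hz₀s)
  have two_le : minSmoothness ℝ 2 ≤ (∞ : WithTop ℕ∞) := by
    rw [minSmoothness_of_isRCLikeNormedField]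
    exact WithTop.coe_le_coe.2 (le_top : (2 : ℕ∞) ≤ ⊤)
  -- Second derivatives commute at boundary points as well, since the quadrant is contained in the
  -- closure of its interior.
  have hsymm : ∀ j (v w), fderivWithin ℝ (fderivWithin ℝ (inChart x (g j)) s) s z₀ v w =
      fderivWithin ℝ (fderivWithin ℝ (inChart x (g j)) s) s z₀ w v := fun j v w =>
    (hG j).isSymmSndFDerivWithinAt two_le huniq
      (M.I.range_subset_closure_interior hz₀s) hz₀s v w
  have hext : extd a x = ∑ i : Fin M.dim,
      ExteriorAlgebra.ι ℂ (Complex.ofRealCLM.comp (EuclideanSpace.proj (𝕜 := ℝ) i) :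
        EuclideanSpace ℝ (Fin M.dim) →L[ℝ] ℂ) *
      ExteriorAlgebra.ι ℂ (fderivWithin ℝ ã s z₀ (EuclideanSpace.single i (1 : ℝ))) := rfl
  have key : extd a x = ∑ j, ExteriorAlgebra.ι ℂ (fderivWithin ℝ (inChart x (f j)) s z₀) *
      ExteriorAlgebra.ι ℂ (fderivWithin ℝ (inChart x (g j)) s z₀) := by
    rw [hext, hD]
    simp only [_root_.sum_apply, map_sum, Finset.mul_sum]
    rw [Finset.sum_comm]
    refine Finset.sum_congr rfl fun j _ => ?_
    simp only [_root_.add_apply, _root_.smul_apply, map_add, mul_add, Finset.sum_add_distrib,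
      ContinuousLinearMap.smulRight_apply, map_smul, mul_smul_comm, ← Finset.smul_sum]
    -- The Hessian of `g j` drops out by symmetry, which is `d dgⱼ = 0`; only the derivative of the
    -- coefficient remains.
    rw [sum_wedge_symm _ (hsymm j), smul_zero, zero_add]
    conv_rhs => rw [sum_smul_proj (fderivWithin ℝ (inChart x (f j)) s z₀)]
    simp only [map_sum, map_smul, Finset.sum_mul, smul_mul_assoc]
    rfl
  rw [key]
  refine Finset.sum_congr rfl fun j _ => ?_
  rw [dfun_eq_inChart hV (hf j) hx, dfun_eq_inChart hV (hg j) hx]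
  rfl

end ExteriorDerivative

/-! ### Calculus of 1-forms and local smoothness of forms. -/

section OneForms

variable {M N : CornerMfd.{u}}

theorem SmoothOneFormOn.fun_smul {U : Set M} {a : ∀ x : M, M.T x →L[ℝ] ℂ}
    (ha : SmoothOneFormOn U a) {f : M → ℂ} (hf : SmoothFunOn U f) :
    SmoothOneFormOn U (fun x => f x • a x) := by
  intro x hx
  obtain ⟨V, k, F, g, hV, hxV, hVU, hF, hg, e⟩ := ha x hx
  refine ⟨V, k, fun j y => f y * F j y, g, hV, hxV, hVU, fun j => ?_, hg, fun y hy => ?_⟩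
  · exact (contDiff_mul (𝕜 := ℝ) (𝔸 := ℂ) (n := ∞)).contMDiff.comp_contMDiffOn
      ((hf.mono hVU).prodMk_space (hF j))
  · have : f y • a y = f y • ∑ j, F j y • dfun (g j) y := by rw [e y hy]
    refine this.trans ?_
    simp [Finset.smul_sum, mul_smul]

theorem smoothOneFormOn_dfun {U : Set M} (hU : IsOpen U) {g : M → ℂ} (hg : SmoothFunOn U g) :
    SmoothOneFormOn U (dfun g) := fun x hx =>
  ⟨U, 1, fun _ _ => 1, fun _ => g, hU, hx, subset_rfl, fun _ => contMDiffOn_const, fun _ => hg,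
    fun y _ => by simp⟩

theorem SmoothOneFormOn.sum {U : Set M} (hU : IsOpen U) {k : Type*} (s : Finset k)
    {a : k → ∀ x : M, M.T x →L[ℝ] ℂ} (ha : ∀ j ∈ s, SmoothOneFormOn U (a j)) :
    SmoothOneFormOn U (fun x => ∑ j ∈ s, a j x) := by
  classical
  induction s using Finset.induction_on with
  | empty => simpa using SmoothOneFormOn.zero hU
  | insert j s hj ih =>
    simp only [Finset.sum_insert hj]
    exact (ha j (Finset.mem_insert_self _ _)).add
      (ih fun i hi => ha i (Finset.mem_insert_of_mem hi))

theorem SmoothOneFormOn.neg {U : Set M} {a : ∀ x : M, M.T x →L[ℝ] ℂ}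
    (ha : SmoothOneFormOn U a) : SmoothOneFormOn U (fun x => -a x) := by
  have e : (fun x => -a x) = fun x => (-1 : ℂ) • a x := by
    funext x
    ext v
    exact (neg_one_mul _).symm
  exact e ▸ ha.const_smul (-1)

/-- A local presentation `∑ fⱼ dgⱼ` of `a` also presents `b`, and the presentation determines the
derivative. -/
theorem extd_congr {U : Set M} {a b : ∀ x : M, M.T x →L[ℝ] ℂ} (ha : SmoothOneFormOn U a)
    (h : ∀ y ∈ U, b y = a y) {x : M} (hx : x ∈ U) : extd b x = extd a x := by
  obtain ⟨V, k, f, g, hV, hxV, hVU, hf, hg, e⟩ := ha x hx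
  rw [extd_of_eq_sum hV hxV hf hg e,
    extd_of_eq_sum hV hxV hf hg fun y hy => (h y (hVU hy)).trans (e y hy)]

theorem dfun_const (c : ℂ) (x : M) : dfun (fun _ : M => c) x = 0 := mfderiv_const

/-- The presentation `dg = 1 · dg` has a constant coefficient. -/
theorem extd_dfun {U : Set M} (hU : IsOpen U) {g : M → ℂ} (hg : SmoothFunOn U g) {x : M}
    (hx : x ∈ U) : extd (dfun g) x = 0 := by
  rw [extd_of_eq_sum (k := Unit) (f := fun _ _ => 1) (g := fun _ => g) hU hx
    (fun _ => contMDiffOn_const) (fun _ => hg) fun y _ => by simp]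
  simp [dfun_const]

theorem extd_fun_smul {U : Set M} {a : ∀ x : M, M.T x →L[ℝ] ℂ}
    (ha : SmoothOneFormOn U a) {f : M → ℂ} (hf : SmoothFunOn U f) {x : M} (hx : x ∈ U) :
    extd (fun y => f y • a y) x =
      ExteriorAlgebra.ι ℂ (dfun f x) * ExteriorAlgebra.ι ℂ (a x) + f x • extd a x := by
  obtain ⟨V, k, F, g, hV, hxV, hVU, hF, hg, e⟩ := ha x hx
  have hf' : SmoothFunOn V f := hf.mono hVU
  have hm : ∀ j, SmoothFunOn V (fun y => f y * F j y) := fun j =>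
    (contDiff_mul (𝕜 := ℝ) (𝔸 := ℂ) (n := ∞)).contMDiff.comp_contMDiffOn
      (hf'.prodMk_space (hF j))
  rw [extd_of_eq_sum hV hxV hF hg e, extd_of_eq_sum hV hxV hm hg fun y hy => by
    rw [e y hy, Finset.smul_sum]; simp [mul_smul], e x hxV]
  simp only [map_sum, Finset.mul_sum, Finset.smul_sum, ← Finset.sum_add_distrib]
  refine Finset.sum_congr rfl fun j _ => ?_
  rw [dfun_mul hV hf' (hF j) hxV]
  simp [add_mul]

theorem extd_add {U : Set M} {a b : ∀ x : M, M.T x →L[ℝ] ℂ}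
    (ha : SmoothOneFormOn U a) (hb : SmoothOneFormOn U b) {x : M} (hx : x ∈ U) :
    extd (fun y => a y + b y) x = extd a x + extd b x := by
  obtain ⟨V, k, f, g, hV, hxV, hVU, hf, hg, e⟩ := ha x hx
  obtain ⟨V', k', f', g', hV', hxV', hVU', hf', hg', e'⟩ := hb x hx
  have hF : ∀ j : Fin k ⊕ Fin k', SmoothFunOn (V ∩ V') (Sum.elim f f' j) := by
    rintro (j | j)
    · exact (hf j).mono Set.inter_subset_left
    · exact (hf' j).mono Set.inter_subset_right
  have hG : ∀ j : Fin k ⊕ Fin k', SmoothFunOn (V ∩ V') (Sum.elim g g' j) := by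
    rintro (j | j)
    · exact (hg j).mono Set.inter_subset_left
    · exact (hg' j).mono Set.inter_subset_right
  rw [extd_of_eq_sum hV hxV hf hg e, extd_of_eq_sum hV' hxV' hf' hg' e',
    extd_of_eq_sum (hV.inter hV') ⟨hxV, hxV'⟩ hF hG fun y hy => by
      rw [e y hy.1, e' y hy.2]; simp]
  simp

theorem extd_zero (x : M) : extd (fun _ : M => 0) x = 0 := by
  rw [extd_of_eq_sum (k := Empty) (f := fun _ _ => 0) (g := fun _ _ => 0) isOpen_univ
    (Set.mem_univ x) (fun _ => contMDiffOn_const) (fun _ => contMDiffOn_const) fun y _ => by simp]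
  simp

theorem extd_sum {U : Set M} (hU : IsOpen U) {k : Type*} (s : Finset k)
    {a : k → ∀ x : M, M.T x →L[ℝ] ℂ} (ha : ∀ j ∈ s, SmoothOneFormOn U (a j)) {x : M} (hx : x ∈ U) :
    extd (fun y => ∑ j ∈ s, a j y) x = ∑ j ∈ s, extd (a j) x := by
  classical
  induction s using Finset.induction_on with
  | empty => simpa using extd_zero x
  | insert j s hj ih =>
    simp only [Finset.sum_insert hj]
    rw [extd_add (ha j (Finset.mem_insert_self _ _))
      (SmoothOneFormOn.sum hU s fun i hi => ha i (Finset.mem_insert_of_mem hi)) hx,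
      ih fun i hi => ha i (Finset.mem_insert_of_mem hi)]

theorem pullForm_mul (f : M → N) (v w : RawForm N) :
    pullForm f (v * w) = pullForm f v * pullForm f w := by
  funext x
  simp [pullForm]

/-- By the chain rule a presentation near `f x` pulls back to a presentation near `x`, so the
preferred charts of the two manifolds need not be compared. -/
theorem extd_pull {f : M → N} {U : Set M} {V : Set N} {a : ∀ x : N, N.T x →L[ℝ] ℂ}
    (hU : IsOpen U) (hf : ContMDiffOn M.I N.I ∞ f U) (ha : SmoothOneFormOn V a)
    (h : Set.MapsTo f U V) {x : M} (hx : x ∈ U) :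
    extd (fun x => (a (f x)).comp (D f x)) x = pullForm f (extd a) x := by
  obtain ⟨W, k, F, g, hW, hxW, hWV, hF, hg, e⟩ := ha (f x) (h hx)
  have ho : IsOpen (U ∩ f ⁻¹' W) := hf.continuousOn.isOpen_inter_preimage hU hW
  have hfo : ContMDiffOn M.I N.I ∞ f (U ∩ f ⁻¹' W) := hf.mono Set.inter_subset_left
  have hm : Set.MapsTo f (U ∩ f ⁻¹' W) W := fun y hy => hy.2
  have e' : ∀ y ∈ U ∩ f ⁻¹' W, (a (f y)).comp (D f y) =
      ∑ j, F j (f y) • dfun (fun z => g j (f z)) y := by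
    intro y hy
    have : (a (f y)).comp (D f y) = (∑ j, F j (f y) • dfun (g j) (f y)).comp (D f y) := by
      rw [e (f y) hy.2]
    refine this.trans ?_
    ext v
    simp only [ContinuousLinearMap.comp_apply, _root_.sum_apply, _root_.smul_apply]
    refine Finset.sum_congr rfl fun j _ => ?_
    rw [dfun_comp ho hW hfo (hg j) hy hy.2]
    rfl
  rw [extd_of_eq_sum (f := fun j z => F j (f z)) (g := fun j z => g j (f z)) ho ⟨hx, hxW⟩
    (fun j => (hF j).pull hfo hm) (fun j => (hg j).pull hfo hm) e']
  unfold pullForm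
  rw [extd_of_eq_sum hW hxW hF hg e]
  simp only [map_sum, map_mul, ExteriorAlgebra.map_apply_ι]
  refine Finset.sum_congr rfl fun j _ => ?_
  rw [dfun_comp ho hW hfo (hg j) ⟨hx, hxW⟩ hxW, dfun_comp ho hW hfo (hF j) ⟨hx, hxW⟩ hxW]
  rfl

/-- Smoothness of a form near a point. -/
def SmoothFormAt (v : RawForm M) (x : M) : Prop :=
  ∃ U : Set M, IsOpen U ∧ x ∈ U ∧ SmoothFormOn U v

namespace SmoothFormAt

variable {v w : RawForm M} {x : M}

theorem add (hv : SmoothFormAt v x) (hw : SmoothFormAt w x) : SmoothFormAt (v + w) x := by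
  obtain ⟨U, hU, hx, h⟩ := hv
  obtain ⟨U', hU', hx', h'⟩ := hw
  exact ⟨U ∩ U', hU.inter hU', ⟨hx, hx'⟩, .add _ _ (h.mono Set.inter_subset_left)
    (h'.mono Set.inter_subset_right)⟩

theorem mul (hv : SmoothFormAt v x) (hw : SmoothFormAt w x) : SmoothFormAt (v * w) x := by
  obtain ⟨U, hU, hx, h⟩ := hv
  obtain ⟨U', hU', hx', h'⟩ := hw
  exact ⟨U ∩ U', hU.inter hU', ⟨hx, hx'⟩, .mul _ _ (h.mono Set.inter_subset_left)
    (h'.mono Set.inter_subset_right)⟩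

theorem congr (hv : SmoothFormAt v x) {V : Set M} (hV : IsOpen V) (hx : x ∈ V)
    (h : ∀ y ∈ V, w y = v y) : SmoothFormAt w x := by
  obtain ⟨U, hU, hxU, h'⟩ := hv
  exact ⟨U ∩ V, hU.inter hV, ⟨hxU, hx⟩, .congr _ _ (h'.mono Set.inter_subset_left)
    fun y hy => (h y hy.2).symm⟩

theorem const (c : ℂ) (x : M) : SmoothFormAt (fun y => algebraMap ℂ (Lam M y) c) x :=
  ⟨Set.univ, isOpen_univ, trivial, .func (fun _ => c) contMDiffOn_const⟩

theorem const_smul (c : ℂ) (hv : SmoothFormAt v x) : SmoothFormAt (fun y => c • v y) x :=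
  ((const c x).mul hv).congr isOpen_univ trivial fun y _ => by simp [Algebra.smul_def]

theorem sum {k : Type*} (s : Finset k) {v : k → RawForm M}
    (h : ∀ j ∈ s, SmoothFormAt (v j) x) : SmoothFormAt (fun y => ∑ j ∈ s, v j y) x := by
  classical
  induction s using Finset.induction_on with
  | empty => simpa using const (0 : ℂ) x
  | insert j s hj ih =>
    simp only [Finset.sum_insert hj]
    exact (h j (Finset.mem_insert_self _ _)).add
      (ih fun i hi => h i (Finset.mem_insert_of_mem hi))

end SmoothFormAt

theorem SmoothOneFormOn.smoothFormAt {U : Set M} {a : ∀ x : M, M.T x →L[ℝ] ℂ}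
    (ha : SmoothOneFormOn U a) {x : M} (hx : x ∈ U) :
    SmoothFormAt (fun y => ExteriorAlgebra.ι ℂ (a y)) x := by
  obtain ⟨V, k, f, g, hV, hxV, -, hf, hg, e⟩ := ha x hx
  have h : SmoothFormAt (fun y => ∑ j, algebraMap ℂ (Lam M y) (f j y) *
      ExteriorAlgebra.ι ℂ (dfun (g j) y)) x :=
    SmoothFormAt.sum _ fun j _ => SmoothFormAt.mul ⟨V, hV, hxV, .func _ (hf j)⟩
      ⟨V, hV, hxV, .diff _ (hg j)⟩
  refine h.congr hV hxV fun y hy => ?_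
  rw [e y hy]
  simp [Algebra.smul_def]

theorem SmoothOneFormOn.smoothFormAt_extd {U : Set M} {a : ∀ x : M, M.T x →L[ℝ] ℂ}
    (ha : SmoothOneFormOn U a) {x : M} (hx : x ∈ U) : SmoothFormAt (extd a) x := by
  obtain ⟨V, k, f, g, hV, hxV, -, hf, hg, e⟩ := ha x hx
  have h : SmoothFormAt (fun y => ∑ j, ExteriorAlgebra.ι ℂ (dfun (f j) y) *
      ExteriorAlgebra.ι ℂ (dfun (g j) y)) x :=
    SmoothFormAt.sum _ fun j _ => SmoothFormAt.mul ⟨V, hV, hxV, .diff _ (hf j)⟩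
      ⟨V, hV, hxV, .diff _ (hg j)⟩
  exact h.congr hV hxV fun y hy => extd_of_eq_sum hV hy hf hg e

end OneForms

/-! ### Matrices over exterior algebras -/

section Algebra

open Matrix

variable {V : Type*} [AddCommGroup V] [Module ℂ V]

/-- The elements of degree two commute with everything. -/
theorem commute_of_mem_two {w : ExteriorAlgebra ℂ V} (hw : w ∈ ⋀[ℂ]^2 V)
    (v : ExteriorAlgebra ℂ V) : Commute w v := by
  have h1 : ∀ a b c : V, Commute (ExteriorAlgebra.ι ℂ a * ExteriorAlgebra.ι ℂ b)
      (ExteriorAlgebra.ι ℂ c) := by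
    intro a b c
    have e : ∀ p q : V, ExteriorAlgebra.ι ℂ p * ExteriorAlgebra.ι ℂ q =
        -(ExteriorAlgebra.ι ℂ q * ExteriorAlgebra.ι ℂ p) := fun p q =>
      eq_neg_of_add_eq_zero_left (ExteriorAlgebra.ι_add_mul_swap _ _)
    -- Moving a covector past two others changes the sign twice.
    rw [commute_iff_eq, mul_assoc, e b c, mul_neg, ← mul_assoc, e a c, neg_mul, neg_neg, mul_assoc]
  have h2 : ∀ c : V, Commute w (ExteriorAlgebra.ι ℂ c) := by
    intro c
    replace hw : w ∈ LinearMap.range (ExteriorAlgebra.ι ℂ (M := V)) ^ 2 := hw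
    rw [pow_two] at hw
    induction hw using Submodule.mul_induction_on' with
    | mem_mul_mem m hm n hn =>
      obtain ⟨a, rfl⟩ := hm
      obtain ⟨b, rfl⟩ := hn
      exact h1 a b c
    | add x _ y _ hx hy => exact hx.add_left hy
  induction v using ExteriorAlgebra.induction with
  | algebraMap r => exact Algebra.commute_algebraMap_right r w
  | ι x => exact h2 x
  | mul a b ha hb => exact ha.mul_right hb
  | add a b ha hb => exact ha.add_right hb

theorem ι_mul_ι_mem (a b : V) :
    ExteriorAlgebra.ι ℂ a * ExteriorAlgebra.ι ℂ b ∈ ⋀[ℂ]^2 V := by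
  change _ ∈ LinearMap.range (ExteriorAlgebra.ι ℂ (M := V)) ^ 2
  rw [pow_two]
  exact Submodule.mul_mem_mul ⟨a, rfl⟩ ⟨b, rfl⟩

theorem exteriorPower_eq_bot [Module.Finite ℂ V] {m : ℕ} (h : Module.finrank ℂ V < m) :
    (⋀[ℂ]^m V) = ⊥ := by
  have h1 : Module.finrank ℂ (⋀[ℂ]^m V) = 0 := by
    rw [exteriorPower.finrank_eq, Nat.choose_eq_zero_of_lt h]
  exact Submodule.finrank_eq_zero.1 h1

/-- The entries of the powers of a matrix with entries in a subspace of an algebra. -/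
theorem matrix_pow_mem {Λ R : Type*} [Ring Λ] [Algebra ℂ Λ] [Fintype R] [DecidableEq R]
    {I : Submodule ℂ Λ} {X : Matrix R R Λ} (hX : ∀ a b, X a b ∈ I) (k : ℕ) (a b : R) :
    (X ^ k) a b ∈ I ^ k := by
  induction k generalizing a b with
  | zero =>
    rw [pow_zero, pow_zero, Matrix.one_apply]
    split_ifs
    · exact Submodule.one_le.1 le_rfl
    · exact zero_mem _
  | succ k ih =>
    rw [pow_succ, pow_succ, Matrix.mul_apply]
    exact Submodule.sum_mem _ fun c _ => Submodule.mul_mem_mul (ih a c) (hX c b)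

/-- The exterior power of order `m` is by definition the `m`-th power of the submodule of covectors
in the algebra, so degrees are counted by multiplying submodules. -/
theorem trace_pow_mem {R : Type*} [Fintype R] [DecidableEq R]
    {X : Matrix R R (ExteriorAlgebra ℂ V)} (hX : ∀ a b, X a b ∈ ⋀[ℂ]^2 V) (k : ℕ) :
    (X ^ k).trace ∈ ⋀[ℂ]^(2 * k) V := by
  change _ ∈ LinearMap.range (ExteriorAlgebra.ι ℂ (M := V)) ^ (2 * k)
  rw [pow_mul]
  exact Submodule.sum_mem _ fun a _ => matrix_pow_mem hX k a a

/-- This degree count disposes of the products of high order when two truncated exponentials are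
multiplied. -/
theorem pow_mul_trace_mem {R : Type*} [Fintype R] [DecidableEq R] {w : ExteriorAlgebra ℂ V}
    (hw : w ∈ ⋀[ℂ]^2 V) {X : Matrix R R (ExteriorAlgebra ℂ V)} (hX : ∀ a b, X a b ∈ ⋀[ℂ]^2 V)
    (p q : ℕ) : w ^ p * (X ^ q).trace ∈ ⋀[ℂ]^(2 * p + 2 * q) V := by
  change _ ∈ LinearMap.range (ExteriorAlgebra.ι ℂ (M := V)) ^ (2 * p + 2 * q)
  rw [pow_add]
  refine Submodule.mul_mem_mul ?_ (trace_pow_mem hX q)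
  rw [pow_mul]
  exact Submodule.pow_mem_pow _ hw p

/-- The coefficients of `exp (i z / 2π)`. -/
def chCoef (k : ℕ) : ℂ := (k.factorial : ℂ)⁻¹ * (Complex.I / (2 * Real.pi)) ^ k

theorem chCoef_mul_choose (i j : ℕ) :
    chCoef (i + j) * ((i + j).choose i : ℂ) = chCoef i * chCoef j := by
  have h : (i + j).choose i * i.factorial * j.factorial = (i + j).factorial := by
    rw [Nat.choose_symm_add]
    exact Nat.add_choose_mul_factorial_mul_factorial i j
  have h' : ((i + j).choose i : ℂ) * (i.factorial : ℂ) * (j.factorial : ℂ) =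
      ((i + j).factorial : ℂ) := by exact_mod_cast h
  have hi : (i.factorial : ℂ) ≠ 0 := by exact_mod_cast i.factorial_ne_zero
  have hj : (j.factorial : ℂ) ≠ 0 := by exact_mod_cast j.factorial_ne_zero
  have hij : ((i + j).factorial : ℂ) ≠ 0 := by exact_mod_cast (i + j).factorial_ne_zero
  have hc : ((i + j).choose i : ℂ) ≠ 0 := left_ne_zero_of_mul (left_ne_zero_of_mul (h' ▸ hij))
  unfold chCoef
  rw [pow_add, ← h']
  field_simp

/-- The trace of the exponential series of a matrix, up to the order `n`. -/
def traceExp {Λ R : Type*} [Ring Λ] [Algebra ℂ Λ] [Fintype R] [DecidableEq R] (n : ℕ)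
    (X : Matrix R R Λ) : Λ :=
  ∑ k ∈ Finset.range n, chCoef k • (X ^ k).trace

/-- One side runs over the triangle `i + j < n`, the other over the square; the pairs of the square
outside the triangle contribute zero. -/
theorem sum_range_antidiagonal {Λ : Type*} [AddCommMonoid Λ] (n : ℕ) (f : ℕ → ℕ → Λ)
    (hf : ∀ i j, n ≤ i + j → f i j = 0) :
    ∑ k ∈ Finset.range n, ∑ p ∈ Finset.HasAntidiagonal.antidiagonal k, f p.1 p.2 =
      ∑ i ∈ Finset.range n, ∑ j ∈ Finset.range n, f i j := by
  rw [← Finset.sum_product' (f := f)]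
  have h1 : ∑ p ∈ Finset.range n ×ˢ Finset.range n, f p.1 p.2 =
      ∑ p ∈ (Finset.range n ×ˢ Finset.range n).filter (fun p : ℕ × ℕ => p.1 + p.2 < n), f p.1 p.2 := by
    refine (Finset.sum_filter_of_ne fun p _ hp => ?_).symm
    by_contra h
    exact hp (hf _ _ (not_lt.1 h))
  rw [h1, ← Finset.sum_fiberwise_of_maps_to (t := Finset.range n) (g := fun p : ℕ × ℕ => p.1 + p.2)
    (fun p hp => by simpa using (Finset.mem_filter.1 hp).2)]
  refine Finset.sum_congr rfl fun k hk => Finset.sum_congr ?_ fun _ _ => rfl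
  ext p
  simp only [Finset.HasAntidiagonal.mem_antidiagonal, Finset.mem_filter, Finset.mem_product, Finset.mem_range] at *
  omega

/-- Multiplicativity of the exponential: `tr exp (w + X) = exp w tr exp X` if `w` commutes with the
entries of `X` and the series terminate. -/
theorem traceExp_add {Λ R : Type*} [Ring Λ] [Algebra ℂ Λ] [Fintype R] [DecidableEq R] (n : ℕ)
    (w : Λ) (X : Matrix R R Λ) (hw : ∀ v, Commute w v)
    (h0 : ∀ i j, n ≤ i + j → w ^ i * (X ^ j).trace = 0) :
    traceExp n (Matrix.scalar R w + X) =
      (∑ k ∈ Finset.range n, chCoef k • w ^ k) * traceExp n X := by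
  -- This is what permits the binomial theorem although `Λ` is not commutative.
  have hc : Commute (Matrix.scalar R w) X := Matrix.scalar_commute w (fun v => hw v) X
  have h1 : ∀ k, chCoef k • ((Matrix.scalar R w + X) ^ k).trace =
      ∑ p ∈ Finset.HasAntidiagonal.antidiagonal k,
        (chCoef p.1 • w ^ p.1) * (chCoef p.2 • (X ^ p.2).trace) := by
    intro k
    rw [hc.add_pow', Matrix.trace_sum, Finset.smul_sum]
    refine Finset.sum_congr rfl fun p hp => ?_
    obtain rfl := Finset.HasAntidiagonal.mem_antidiagonal.1 hp
    rw [Matrix.trace_smul, ← Nat.cast_smul_eq_nsmul ℂ, smul_smul, chCoef_mul_choose,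
      smul_mul_smul_comm]
    congr 1
    rw [← map_pow]
    simp [Matrix.trace, Finset.mul_sum, Matrix.scalar_apply, Matrix.diagonal_mul]
  unfold traceExp
  rw [Finset.sum_congr rfl fun k _ => h1 k,
    sum_range_antidiagonal n (fun i j => (chCoef i • w ^ i) * (chCoef j • (X ^ j).trace)),
    Finset.sum_mul_sum]
  intro i j hij
  rw [smul_mul_smul_comm, h0 i j hij, smul_zero]

/-- Cyclicity of the trace can fail over a non-commutative ring, but it survives when one of the
factors has scalar entries. -/
theorem trace_scalar_mul_comm {Λ m n : Type*} [Ring Λ] [Algebra ℂ Λ] [Fintype m] [Fintype n]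
    (t : Matrix m n ℂ) (X : Matrix n m Λ) :
    (t.map (algebraMap ℂ Λ) * X).trace = (X * t.map (algebraMap ℂ Λ)).trace := by
  simp only [Matrix.trace, Matrix.diag, Matrix.mul_apply, Matrix.map_apply]
  rw [Finset.sum_comm]
  exact Finset.sum_congr rfl fun i _ => Finset.sum_congr rfl fun j _ => Algebra.commutes _ _

/-- The traces of the powers of a matrix equivalent to a direct sum. -/
theorem trace_pow_of_intertwine {Λ K F : Type*} [Ring Λ] [Algebra ℂ Λ] [Fintype F] [DecidableEq F]
    {R : K → Type*} [∀ c, Fintype (R c)] [∀ c, DecidableEq (R c)] (S : Finset K)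
    (t : ∀ c, Matrix F (R c) ℂ) (s : ∀ c, Matrix (R c) F ℂ)
    (X : ∀ c, Matrix (R c) (R c) Λ) (Y : Matrix F F Λ)
    (h : ∀ c, Y * (t c).map (algebraMap ℂ Λ) = (t c).map (algebraMap ℂ Λ) * X c)
    (hts : ∑ c ∈ S, t c * s c = 1) (hst : ∀ c, s c * t c = 1) (k : ℕ) :
    (Y ^ k).trace = ∑ c ∈ S, (X c ^ k).trace := by
  have hk : ∀ c, Y ^ k * (t c).map (algebraMap ℂ Λ) = (t c).map (algebraMap ℂ Λ) * X c ^ k := by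
    intro c
    induction k with
    | zero => simp
    | succ k ih => rw [pow_succ, Matrix.mul_assoc, h c, ← Matrix.mul_assoc, ih, Matrix.mul_assoc,
        ← pow_succ]
  -- Inserting this resolution of the identity gives `tr Yᵏ = ∑ tr (Yᵏ t s) = ∑ tr (t Xᵏ s) = ∑ tr
  -- (Xᵏ s t) = ∑ tr Xᵏ`; only scalar matrices are moved around the trace.
  have h1 : (1 : Matrix F F Λ) =
      ∑ c ∈ S, (t c).map (algebraMap ℂ Λ) * (s c).map (algebraMap ℂ Λ) := by
    have := congrArg (fun m : Matrix F F ℂ => (algebraMap ℂ Λ).mapMatrix m) hts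
    simp only [map_sum, map_one] at this
    rw [← this]
    exact Finset.sum_congr rfl fun c _ => Matrix.map_mul
  calc (Y ^ k).trace = (Y ^ k * 1).trace := by rw [mul_one]
    _ = ∑ c ∈ S, (X c ^ k).trace := by
      rw [h1, Finset.mul_sum, Matrix.trace_sum]
      refine Finset.sum_congr rfl fun c _ => ?_
      rw [← Matrix.mul_assoc, hk, Matrix.mul_assoc, trace_scalar_mul_comm, Matrix.mul_assoc,
        ← Matrix.map_mul, hst c, Matrix.map_one _ (map_zero _) (map_one _), mul_one]

/-- The same in terms of linear maps. -/
theorem traceExp_of_intertwine {Λ K F W : Type*} [Ring Λ] [Algebra ℂ Λ] [Fintype F] [DecidableEq F]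
    {R : K → Type*} [∀ c, Fintype (R c)] [∀ c, DecidableEq (R c)] (S : Finset K)
    [AddCommGroup W] [Module ℂ W] {Z : K → Type*} [∀ c, AddCommGroup (Z c)] [∀ c, Module ℂ (Z c)]
    (bW : Module.Basis F ℂ W) (bZ : ∀ c, Module.Basis (R c) ℂ (Z c))
    (T : ∀ c, Z c →ₗ[ℂ] W) (T' : ∀ c, W →ₗ[ℂ] Z c)
    (X : ∀ c, Matrix (R c) (R c) Λ) (Y : Matrix F F Λ)
    (h : ∀ c a b, ∑ d, bW.repr (T c (bZ c b)) d • Y a d =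
      ∑ d, bW.repr (T c (bZ c d)) a • X c d b)
    (hts : ∑ c ∈ S, T c ∘ₗ T' c = LinearMap.id) (hst : ∀ c, T' c ∘ₗ T c = LinearMap.id) (n : ℕ) :
    traceExp n Y = ∑ c ∈ S, traceExp n (X c) := by
  unfold traceExp
  rw [Finset.sum_comm]
  refine Finset.sum_congr rfl fun k _ => ?_
  rw [← Finset.smul_sum]
  congr 1
  refine trace_pow_of_intertwine S (fun c => LinearMap.toMatrix (bZ c) bW (T c))
    (fun c => LinearMap.toMatrix bW (bZ c) (T' c)) X Y (fun c => ?_) ?_ (fun c => ?_) k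
  · ext a b
    simp only [Matrix.mul_apply, Matrix.map_apply, LinearMap.toMatrix_apply]
    simp only [← Algebra.smul_def, ← h c a b]
    refine Finset.sum_congr rfl fun d _ => ?_
    rw [← Algebra.commutes, Algebra.smul_def]
  · rw [← LinearMap.toMatrix_id bW, ← hts, map_sum]
    exact Finset.sum_congr rfl fun c _ => (LinearMap.toMatrix_comp _ _ _ _ _).symm
  · rw [← LinearMap.toMatrix_id (bZ c), ← hst c]
    exact (LinearMap.toMatrix_comp _ _ _ _ _).symm

theorem map_traceExp {Λ Λ' R : Type*} [Ring Λ] [Algebra ℂ Λ] [Ring Λ'] [Algebra ℂ Λ'] [Fintype R]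
    [DecidableEq R] (P : Λ →ₐ[ℂ] Λ') (n : ℕ) (X : Matrix R R Λ) :
    P (traceExp n X) = traceExp n (X.map P) := by
  have h : ∀ k, (X.map P) ^ k = (X ^ k).map P := fun k => (map_pow P.mapMatrix X k).symm
  simp [traceExp, map_sum, h, Matrix.trace]

/-- The equality tests are implicit arguments found by unification, so that the two sides may carry
unrelated, for instance classical, ones. -/
theorem traceExp_reindex {Λ R R' : Type*} [Ring Λ] [Algebra ℂ Λ] [Fintype R]
    {_ : DecidableEq R} [Fintype R'] {_ : DecidableEq R'} (e : R' ≃ R) (n : ℕ) (X : Matrix R' R' Λ)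
    (Y : Matrix R R Λ) (h : ∀ a b, X a b = Y (e a) (e b)) : traceExp n X = traceExp n Y := by
  have h1 : Y = Matrix.reindexAlgEquiv ℂ Λ e X := by
    ext a b
    simp [h]
  unfold traceExp
  refine Finset.sum_congr rfl fun k _ => ?_
  rw [h1, ← map_pow]
  congr 1
  simp only [Matrix.trace, Matrix.diag, Matrix.coe_reindexAlgEquiv, Matrix.reindex_apply,
    Matrix.submatrix_apply]
  exact (Equiv.sum_comp e.symm fun a => (X ^ k) a a).symm

theorem traceExp_of_isEmpty {Λ R : Type*} [Ring Λ] [Algebra ℂ Λ] [Fintype R] {_ : DecidableEq R}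
    [IsEmpty R] (n : ℕ) (X : Matrix R R Λ) : traceExp n X = 0 := by
  simp [traceExp, Matrix.trace]

/-- In `(p + A) ∧ (p + A)`, with `p` standing for a multiple of the identity, `p ∧ p` vanishes and
the cross terms `p ∧ A + A ∧ p` cancel. This makes the curvature of a tensor product with a line
bundle the sum of the two curvatures. -/
theorem sum_wedge_tensor {R : Type*} [Fintype R] [DecidableEq R] (p : V) (A : R → R → V) (a b : R) :
    ∑ c, ExteriorAlgebra.ι ℂ ((if a = c then (1 : ℂ) else 0) • p + A a c) *
      ExteriorAlgebra.ι ℂ ((if c = b then (1 : ℂ) else 0) • p + A c b) =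
    ∑ c, ExteriorAlgebra.ι ℂ (A a c) * ExteriorAlgebra.ι ℂ (A c b) := by
  simp only [map_add, map_smul]
  simp only [add_mul, mul_add, Finset.sum_add_distrib, ite_smul, zero_smul, one_smul, ite_mul,
    mul_ite, zero_mul, mul_zero, Finset.sum_ite_eq, Finset.sum_ite_eq', Finset.mem_univ, if_true,
    ExteriorAlgebra.ι_sq_zero, ite_self, zero_add]
  rw [← add_assoc, ExteriorAlgebra.ι_add_mul_swap, zero_add]

end Algebra

/-! ### Curvature and the Chern character form -/

section Curvature

variable {M N : CornerMfd.{u}}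

/-- Every tangent space is the model `ℝⁿ`, so this single family bounds the complex dimension of all
the cotangent spaces. -/
theorem span_cotangent (n : ℕ) :
    Submodule.span ℂ (Set.range fun i : Fin n =>
      (Complex.ofRealCLM.comp (EuclideanSpace.proj (𝕜 := ℝ) i) :
        EuclideanSpace ℝ (Fin n) →L[ℝ] ℂ)) = ⊤ := by
  refine eq_top_iff.2 fun l _ => ?_
  rw [sum_smul_proj l]
  exact Submodule.sum_mem _ fun i _ => Submodule.smul_mem _ _ (Submodule.subset_span ⟨i, rfl⟩)

instance finite_cotangent (x : M) : Module.Finite ℂ (M.T x →L[ℝ] ℂ) :=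
  ⟨⟨(Set.finite_range _).toFinset, by
    rw [Set.Finite.coe_toFinset]
    exact span_cotangent M.dim⟩⟩

theorem finrank_cotangent_le (x : M) : Module.finrank ℂ (M.T x →L[ℝ] ℂ) ≤ M.dim := by
  have h := finrank_range_le_card (R := ℂ) (b := fun i : Fin M.dim =>
      (Complex.ofRealCLM.comp (EuclideanSpace.proj (𝕜 := ℝ) i) :
        EuclideanSpace ℝ (Fin M.dim) →L[ℝ] ℂ))
  unfold Set.finrank at h
  rw [span_cotangent, finrank_top, Fintype.card_fin] at h
  exact h

/-- All truncations of exponential series are justified by this vanishing. -/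
theorem exteriorPower_cotangent_eq_bot (x : M) {m : ℕ} (h : M.dim < m) :
    (⋀[ℂ]^m (M.T x →L[ℝ] ℂ)) = ⊥ :=
  exteriorPower_eq_bot ((finrank_cotangent_le x).trans_lt h)

theorem extd_mem (a : ∀ x : M, M.T x →L[ℝ] ℂ) (x : M) :
    extd a x ∈ ⋀[ℂ]^2 (M.T x →L[ℝ] ℂ) :=
  Submodule.sum_mem _ fun _ _ => ι_mul_ι_mem _ _

theorem Connection.curv_mem {E : CBundle M} (C : Connection E) (i : E.Idx) (x : M)
    (a b : E.R i) : C.curv i x a b ∈ ⋀[ℂ]^2 (M.T x →L[ℝ] ℂ) :=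
  Submodule.add_mem _ (extd_mem _ _) (Submodule.sum_mem _ fun _ _ => ι_mul_ι_mem _ _)

theorem extd_const_smul {U : Set M} {a : ∀ x : M, M.T x →L[ℝ] ℂ}
    (ha : SmoothOneFormOn U a) (c : ℂ) {x : M} (hx : x ∈ U) :
    extd (fun y => c • a y) x = c • extd a x := by
  rw [extd_fun_smul (f := fun _ => c) ha contMDiffOn_const hx, dfun_const]
  simp

/-- A bundle map which intertwines two connections intertwines their curvatures. -/
theorem curv_intertwine {E F : CBundle M} {C : Connection E} {C' : Connection F}
    {T : FiberMaps E F} (hT : T.Smooth) (h : T.Parallel C C') (i : F.Idx) (j : E.Idx) (a : F.R i)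
    (b : E.R j) {x : M} (hi : x ∈ F.U i) (hj : x ∈ E.U j) :
    ∑ d, T.mat i j d b x • C'.curv i x a d = ∑ d, T.mat i j a d x • C.curv j x d b := by
  have hU : IsOpen (F.U i ∩ E.U j) := (F.isOpen_U i).inter (E.isOpen_U j)
  have hx : x ∈ F.U i ∩ E.U j := ⟨hi, hj⟩
  have hA' : ∀ a b, SmoothOneFormOn (F.U i ∩ E.U j) (C'.form i a b) := fun a b =>
    (C'.smooth i a b).mono hU Set.inter_subset_left
  have hA : ∀ a b, SmoothOneFormOn (F.U i ∩ E.U j) (C.form j a b) := fun a b =>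
    (C.smooth j a b).mono hU Set.inter_subset_right
  have ht := hT i j
  have hs' : ∀ c, SmoothOneFormOn (F.U i ∩ E.U j) (fun y => T.mat i j c b y • C'.form i a c y) :=
    fun c => (hA' a c).fun_smul (ht c b)
  have hs : ∀ c, SmoothOneFormOn (F.U i ∩ E.U j) (fun y => T.mat i j a c y • C.form j c b y) :=
    fun c => (hA c b).fun_smul (ht a c)
  -- The exterior derivative of the relation `dT + A'T = TA`, in which `d dT` disappears.
  have key : extd (fun y => dfun (T.mat i j a b) y + ∑ c, T.mat i j c b y • C'.form i a c y) x =
      extd (fun y => ∑ c, T.mat i j a c y • C.form j c b y) x :=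
    extd_congr (SmoothOneFormOn.sum hU _ fun c _ => hs c) (fun y hy => h i j a b y hy) hx
  rw [extd_add (smoothOneFormOn_dfun hU (ht a b)) (SmoothOneFormOn.sum hU _ fun c _ => hs' c) hx,
    extd_dfun hU (ht a b) hx, zero_add, extd_sum hU _ (fun c _ => hs' c) hx,
    extd_sum hU _ (fun c _ => hs c) hx] at key
  -- The same relation eliminates the remaining `dT`, as `TA - A'T`.
  have hd : ∀ a b, ExteriorAlgebra.ι ℂ (dfun (T.mat i j a b) x) =
      ∑ e, T.mat i j a e x • ExteriorAlgebra.ι ℂ (C.form j e b x) -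
        ∑ e, T.mat i j e b x • ExteriorAlgebra.ι ℂ (C'.form i a e x) := by
    intro a b
    have := h i j a b x hx
    rw [← eq_sub_iff_add_eq] at this
    rw [this]
    simp only [map_sub, map_sum, map_smul]
  have swap : ∀ p q : M.T x →L[ℝ] ℂ, ExteriorAlgebra.ι ℂ p * ExteriorAlgebra.ι ℂ q =
      -(ExteriorAlgebra.ι ℂ q * ExteriorAlgebra.ι ℂ p) := fun p q =>
    eq_neg_of_add_eq_zero_left (ExteriorAlgebra.ι_add_mul_swap _ _)
  rw [Finset.sum_congr rfl fun c _ => extd_fun_smul (hA' a c) (ht c b) hx,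
    Finset.sum_congr rfl fun c _ => extd_fun_smul (hA c b) (ht a c) hx] at key
  simp only [hd, sub_mul, Finset.sum_mul, smul_mul_assoc, Finset.sum_add_distrib,
    Finset.sum_sub_distrib] at key
  -- After the substitution the mixed term `A' T A` occurs on both sides and cancels. The other two
  -- quadratic terms, `A' A' T` and `T A A`, complete `dA'` and `dA` to the curvatures.
  have e1 : ∑ c, ∑ e, T.mat i j c e x •
        (ExteriorAlgebra.ι ℂ (C.form j e b x) * ExteriorAlgebra.ι ℂ (C'.form i a c x)) =
      -∑ c, ∑ e, T.mat i j e c x •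
        (ExteriorAlgebra.ι ℂ (C'.form i a e x) * ExteriorAlgebra.ι ℂ (C.form j c b x)) := by
    rw [Finset.sum_comm, ← Finset.sum_neg_distrib]
    refine Finset.sum_congr rfl fun c _ => ?_
    rw [← Finset.sum_neg_distrib]
    refine Finset.sum_congr rfl fun e _ => ?_
    rw [swap, smul_neg]
  have e2 : ∑ c, ∑ e, T.mat i j e b x •
        (ExteriorAlgebra.ι ℂ (C'.form i c e x) * ExteriorAlgebra.ι ℂ (C'.form i a c x)) =
      -∑ d, T.mat i j d b x • ∑ c,
        (ExteriorAlgebra.ι ℂ (C'.form i a c x) * ExteriorAlgebra.ι ℂ (C'.form i c d x)) := by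
    rw [Finset.sum_comm, ← Finset.sum_neg_distrib]
    refine Finset.sum_congr rfl fun c _ => ?_
    rw [← smul_neg, ← Finset.sum_neg_distrib, Finset.smul_sum]
    refine Finset.sum_congr rfl fun e _ => ?_
    rw [swap]
  have e3 : ∑ c, ∑ e, T.mat i j a e x •
        (ExteriorAlgebra.ι ℂ (C.form j e c x) * ExteriorAlgebra.ι ℂ (C.form j c b x)) =
      ∑ d, T.mat i j a d x • ∑ c,
        (ExteriorAlgebra.ι ℂ (C.form j d c x) * ExteriorAlgebra.ι ℂ (C.form j c b x)) := by
    rw [Finset.sum_comm]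
    exact Finset.sum_congr rfl fun c _ => (Finset.smul_sum).symm
  rw [e1, e2, e3] at key
  simp only [Connection.curv, smul_add, Finset.sum_add_distrib]
  rw [← sub_eq_zero, ← sub_eq_zero.2 key]
  abel

open Classical in
theorem Connection.chern_eq {E : CBundle M} (C : Connection E) (x : M) :
    C.chern x = traceExp (M.dim + 1) (C.curv (Classical.choose (E.cover x)) x) := rfl

-- The additional terms are traces of degree `2k` above the dimension. The freedom in `n` allows
-- forms on manifolds of different dimensions to be compared.
open Classical in
theorem Connection.traceExp_curv {E : CBundle M} (C : Connection E) (i : E.Idx) (x : M) {n : ℕ}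
    (hn : M.dim < n) : traceExp n (C.curv i x) = traceExp (M.dim + 1) (C.curv i x) := by
  refine (Finset.sum_subset (Finset.range_mono hn) fun k _ hk => ?_).symm
  have h := trace_pow_mem (C.curv_mem i x) k
  rw [Finset.mem_range, not_lt] at hk
  rw [exteriorPower_cotangent_eq_bot x (by omega), Submodule.mem_bot] at h
  rw [h, smul_zero]

-- The maps `T c` have to be smooth and parallel near `x`, because they are differentiated; the
-- projections `T' c` onto the summands enter only as linear algebra in the fibre over `x`.
open Classical in
theorem traceExp_curv_eq_sum {K : Type*} (S : Finset K) {F : CBundle M} {E : K → CBundle M}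
    (C' : Connection F) (C : ∀ c, Connection (E c)) (T : ∀ c, FiberMaps (E c) F)
    (hT : ∀ c, (T c).Smooth) (h : ∀ c, (T c).Parallel (C c) C') {x : M}
    (T' : ∀ c, F.fiber x →ₗ[ℂ] (E c).fiber x)
    (hts : ∑ c ∈ S, T c x ∘ₗ T' c = LinearMap.id) (hst : ∀ c, T' c ∘ₗ T c x = LinearMap.id)
    (i : F.Idx) (hi : x ∈ F.U i) (j : ∀ c, (E c).Idx) (hj : ∀ c, x ∈ (E c).U (j c)) (n : ℕ) :
    traceExp n (C'.curv i x) = ∑ c ∈ S, traceExp n ((C c).curv (j c) x) := by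
  refine traceExp_of_intertwine S (F.frame i x hi) (fun c => (E c).frame (j c) x (hj c))
    (fun c => T c x) T' _ _ (fun c a b => ?_) hts hst n
  have := curv_intertwine (hT c) (h c) i (j c) a b hi (hj c)
  simpa only [FiberMaps.mat_of_mem _ _ _ hi (hj c)] using this

open Classical in
/-- The Chern character form may be computed in any local frame. -/
theorem Connection.chern_eq_traceExp {E : CBundle M} (C : Connection E) (i : E.Idx) {x : M}
    (hi : x ∈ E.U i) {n : ℕ} (hn : M.dim < n) : C.chern x = traceExp n (C.curv i x) := by
  rw [C.traceExp_curv i x hn, C.chern_eq]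
  -- The `gauge` condition says that the identity is parallel from `C` to `C`. A change of frame is
  -- thus the decomposition with one summand, read in two frames.
  have := traceExp_curv_eq_sum (K := Unit) Finset.univ (E := fun _ => E) C (fun _ => C)
    (fun _ => FiberMaps.id E) (fun _ => smooth_mat_id E) (fun _ => C.gauge) (x := x)
    (fun _ => LinearMap.id) (by ext; simp [FiberMaps.id]) (fun _ => rfl)
    (Classical.choose (E.cover x)) (Classical.choose_spec (E.cover x)) (fun _ => i) (fun _ => hi)
    (M.dim + 1)
  simpa using this

/-- Additivity of the Chern character form, for a decomposition by parallel bundle maps. -/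
theorem chern_eq_sum {K : Type*} (S : Finset K) {F : CBundle M} {E : K → CBundle M}
    (C' : Connection F) (C : ∀ c, Connection (E c)) (T : ∀ c, FiberMaps (E c) F)
    (hT : ∀ c, (T c).Smooth) (h : ∀ c, (T c).Parallel (C c) C') {x : M}
    (T' : ∀ c, F.fiber x →ₗ[ℂ] (E c).fiber x)
    (hts : ∑ c ∈ S, T c x ∘ₗ T' c = LinearMap.id) (hst : ∀ c, T' c ∘ₗ T c x = LinearMap.id) :
    C'.chern x = ∑ c ∈ S, (C c).chern x := by
  obtain ⟨i, hi⟩ := F.cover x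
  choose j hj using fun c => (E c).cover x
  rw [C'.chern_eq_traceExp i hi (Nat.lt_succ_self _),
    traceExp_curv_eq_sum S C' C T hT h T' hts hst i hi j hj]
  exact Finset.sum_congr rfl fun c _ =>
    ((C c).chern_eq_traceExp (j c) (hj c) (Nat.lt_succ_self _)).symm

theorem BundleIso.chern_eq {E F : CBundle M} (T : BundleIso E F) {C : Connection E}
    {C' : Connection F} (h : T.map.Parallel C C') : C'.chern = C.chern := by
  funext x
  let e := LinearEquiv.ofBijective (T.map x) (T.bij x)
  have := chern_eq_sum (K := Unit) Finset.univ (E := fun _ => E) C' (fun _ => C)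
    (fun _ => T.map) (fun _ => T.smooth) (fun _ => h) (x := x) (fun _ => e.symm.toLinearMap)
    (by ext v; simpa using show T.map x (e.symm v) = v from e.apply_symm_apply v) (fun _ => by ext v; exact e.symm_apply_apply v)
  simpa using this

open Classical in
theorem SmoothFormAt.matrix_pow {R : Type*} [Fintype R] {x : M}
    {X : ∀ y : M, Matrix R R (Lam M y)} (hX : ∀ a b, SmoothFormAt (fun y => X y a b) x) (k : ℕ)
    (a b : R) : SmoothFormAt (fun y => (X y ^ k) a b) x := by
  induction k generalizing a b with
  | zero =>
    refine (SmoothFormAt.const (if a = b then 1 else 0) x).congr isOpen_univ trivial fun y _ => ?_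
    rw [pow_zero, Matrix.one_apply]
    split_ifs <;> simp
  | succ k ih =>
    simp only [pow_succ, Matrix.mul_apply]
    exact SmoothFormAt.sum _ fun c _ => (ih a c).mul (hX c b)

theorem Connection.smoothFormAt_curv {E : CBundle M} (C : Connection E) (i : E.Idx) {x : M}
    (hi : x ∈ E.U i) (a b : E.R i) : SmoothFormAt (fun y => C.curv i y a b) x :=
  ((C.smooth i a b).smoothFormAt_extd hi).add
    (SmoothFormAt.sum _ fun c _ => ((C.smooth i a c).smoothFormAt hi).mul
      ((C.smooth i c b).smoothFormAt hi))

/-- The Chern character form is smooth. -/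
theorem Connection.smoothForm_chern {E : CBundle M} (C : Connection E) : SmoothForm C.chern := by
  classical
  intro x
  obtain ⟨i, hi⟩ := E.cover x
  have h : SmoothFormAt (fun y => traceExp (M.dim + 1) (C.curv i y)) x :=
    SmoothFormAt.sum _ fun k _ => SmoothFormAt.const_smul _ (SmoothFormAt.sum _ fun a _ =>
      SmoothFormAt.matrix_pow (C.smoothFormAt_curv i hi) k a a)
  refine h.congr (E.isOpen_U i) hi fun y hy => ?_
  convert C.chern_eq_traceExp i hy (Nat.lt_succ_self _)

/-- Pull-back of covectors. -/
def pullCovec (f : M → N) (x : M) : (N.T (f x) →L[ℝ] ℂ) →ₗ[ℂ] (M.T x →L[ℝ] ℂ) where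
  toFun l := l.comp (D f x)
  map_add' _ _ := rfl
  map_smul' _ _ := rfl

theorem pullForm_apply (f : M → N) (v : RawForm N) (x : M) :
    pullForm f v x = ExteriorAlgebra.map (pullCovec f x) (v (f x)) := rfl

theorem Connection.curv_pull {E : CBundle N} (C : Connection E) (f : M → N) (hf : SmoothMap f)
    (i : E.Idx) {x : M} (hi : f x ∈ E.U i) (a b : E.R i) :
    (C.pull f hf).curv i x a b = ExteriorAlgebra.map (pullCovec f x) (C.curv i (f x) a b) := by
  have h := extd_pull ((E.isOpen_U i).preimage hf.continuous) hf.contMDiffOn (C.smooth i a b)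
    (fun _ h => h) (x := x) hi
  rw [pullForm_apply] at h
  simp only [Connection.curv, map_add, map_sum, map_mul, ExteriorAlgebra.map_apply_ι]
  rw [← h]
  rfl

theorem Connection.chern_pull {E : CBundle N} (C : Connection E) (f : M → N) (hf : SmoothMap f) :
    (C.pull f hf).chern = pullForm f C.chern := by
  classical
  funext x
  obtain ⟨i, hi⟩ := E.cover (f x)
  -- The two sides are truncated according to different dimensions, so both are rewritten with a
  -- common order.
  have hM : M.dim < M.dim + N.dim + 1 := by omega
  have hN : N.dim < M.dim + N.dim + 1 := by omega
  rw [pullForm_apply, (C.pull f hf).chern_eq_traceExp i hi hM, C.chern_eq_traceExp i hi hN,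
    map_traceExp]
  congr 1
  ext a b
  exact C.curv_pull f hf i hi a b

/-- The Chern character form of a line bundle. -/
theorem Connection.chern_line {L : CBundle M} [∀ i, Unique (L.R i)] (C : Connection L) (i : L.Idx)
    {x : M} (hi : x ∈ L.U i) {n : ℕ} (hn : M.dim < n) :
    C.chern x = ∑ k ∈ Finset.range n, chCoef k • (C.curv i x default default) ^ k := by
  classical
  have h1 : C.chern x = traceExp n (Matrix.scalar Unit (C.curv i x default default)) := by
    rw [C.chern_eq_traceExp i hi hn]
    refine traceExp_reindex (Equiv.ofUnique (L.R i) Unit) _ _ _ fun a b => ?_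
    obtain rfl : a = default := Subsingleton.elim _ _
    obtain rfl : b = default := Subsingleton.elim _ _
    simp
  rw [h1]
  refine Finset.sum_congr rfl fun k _ => ?_
  rw [← map_pow]
  simp [Matrix.trace]

/-- For a matrix of size one, `A ∧ A` is the square of a covector. -/
theorem Connection.curv_line {L : CBundle M} [∀ i, Unique (L.R i)] (C : Connection L) (i : L.Idx)
    (x : M) : C.curv i x default default = extd (C.form i default default) x := by
  simp [Connection.curv]

/-- The Chern character form is multiplicative for tensor products with line bundles. -/
theorem chern_tensor_line {L F : CBundle M} [∀ i, Unique (L.R i)] (C : Connection L)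
    (C' : Connection F) : (C.tensor C').chern = C.chern * C'.chern := by
  classical
  funext x
  obtain ⟨i, hi⟩ := L.cover x
  obtain ⟨j, hj⟩ := F.cover x
  have hn := Nat.lt_succ_self M.dim
  set w : Lam M x := C.curv i x default default with hw
  have hw2 : w ∈ ⋀[ℂ]^2 (M.T x →L[ℝ] ℂ) := C.curv_mem i x _ _
  have hcurv : ∀ a b : L.R i × F.R j, (C.tensor C').curv (i, j) x a b =
      (Matrix.scalar (F.R j) w + C'.curv j x) a.2 b.2 := by
    rintro ⟨a0, a⟩ ⟨b0, b⟩
    obtain rfl : a0 = default := Subsingleton.elim _ _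
    obtain rfl : b0 = default := Subsingleton.elim _ _
    have hU := (L.tensor F).isOpen_U (i, j)
    have hx : x ∈ (L.tensor F).U (i, j) := ⟨hi, hj⟩
    have h1 := (C.smooth i default default).mono hU fun _ h => h.1
    have h2 := (C'.smooth j a b).mono hU fun _ h => h.2
    have hform : ∀ (a b : F.R j) y, (C.tensor C').form (i, j) (default, a) (default, b) y =
        (if a = b then (1 : ℂ) else 0) • C.form i default default y + C'.form j a b y := by
      intro a b y
      simp [Connection.tensor]
    have hd : extd ((C.tensor C').form (i, j) (default, a) (default, b)) x =
        (if a = b then (1 : ℂ) else 0) • extd (C.form i default default) x +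
          extd (C'.form j a b) x := by
      rw [funext (hform a b), extd_add (h1.const_smul _) h2 hx, extd_const_smul h1 _ hx]
    have hsum : ∀ f : L.R i × F.R j → Lam M x, ∑ c, f c = ∑ c, f (default, c) := by
      intro f
      rw [Fintype.sum_prod_type, Fintype.sum_unique]
    have hq : ∑ c : L.R i × F.R j,
        ExteriorAlgebra.ι ℂ ((C.tensor C').form (i, j) (default, a) c x) *
          ExteriorAlgebra.ι ℂ ((C.tensor C').form (i, j) c (default, b) x) =
        ∑ c, ExteriorAlgebra.ι ℂ (C'.form j a c x) * ExteriorAlgebra.ι ℂ (C'.form j c b x) := by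
      rw [hsum]
      simp only [hform]
      exact sum_wedge_tensor (C.form i default default x) (fun a b => C'.form j a b x) a b
    have hw' : w = extd (C.form i default default) x := by
      rw [hw, C.curv_line]
    refine (congrArg₂ (· + ·) hd hq).trans ?_
    rw [Matrix.add_apply, Matrix.scalar_apply, Matrix.diagonal_apply, hw', Connection.curv,
      ← add_assoc]
    simp only [ite_smul, one_smul, zero_smul]
  -- These products have degree `2p + 2q`, beyond the dimension, so the truncated series multiply
  -- like full exponentials.
  have h0 : ∀ p q, M.dim + 1 ≤ p + q → w ^ p * (C'.curv j x ^ q).trace = 0 := by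
    intro p q hpq
    have h1 := pow_mul_trace_mem hw2 (C'.curv_mem j x) p q
    rwa [exteriorPower_cotangent_eq_bot x (by omega), Submodule.mem_bot] at h1
  rw [Pi.mul_apply, C.chern_line i hi hn, (C.tensor C').chern_eq_traceExp (i, j) ⟨hi, hj⟩ hn,
    C'.chern_eq_traceExp j hj hn, ← traceExp_add _ w _ (commute_of_mem_two hw2) h0]
  exact traceExp_reindex (Equiv.uniqueProd (F.R j) (L.R i)) _ _ _ hcurv

/-- A frame of a zero fibre has an empty index set, so even the term of degree zero, the rank,
vanishes. -/
theorem Connection.chern_eq_zero {E : CBundle M} (C : Connection E)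
    (h : ∀ x, Subsingleton (E.fiber x)) : C.chern = 0 := by
  classical
  funext x
  obtain ⟨i, hi⟩ := E.cover x
  have := h x
  have : IsEmpty (E.R i) := by
    refine ⟨fun a => (E.frame i x hi).ne_zero a (Subsingleton.elim _ _)⟩
  rw [C.chern_eq_traceExp i hi (Nat.lt_succ_self _), traceExp_of_isEmpty]
  rfl

end Curvature

/-! ### The Chern character forms of descended line bundles -/

section ShiftCurvature

variable {G : AbLieGroup.{u}} {M N N' : CornerMfd.{u}} [MulAction G M]

instance {B : Subgroup G} {q : M → N} (hq : IsQuotient G B q) (χ : Dual G) (hχ : χ ∈ ann B) (i) :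
    Unique ((shiftBundle hq χ hχ).R i) :=
  inferInstanceAs (Unique PUnit.{u+1})

/-- The pull-back of the connection form of a descended line bundle under a map to `M`. -/
def shiftForm {B : Subgroup G} (θ : PrincipalConn (G := G) M B) (χ : Dual G) (s : N' → M) (y : N') :
    N'.T y →L[ℝ] ℂ :=
  -(((χ.d 1).comp (θ.form (s y))).comp (D s y))

theorem smoothOneFormOn_shiftForm {B : Subgroup G} (θ : PrincipalConn (G := G) M B) (χ : Dual G)
    {s : N' → M} {V : Set N'} (hV : IsOpen V) (hs : ContMDiffOn N'.I M.I ∞ s V) :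
    SmoothOneFormOn V (shiftForm θ χ s) :=
  ((θ.smooth (χ.d 1)).pull hV hs (Set.mapsTo_univ _ _)).neg

/-- Logarithmic differentials are closed. -/
theorem extd_dlog {U : Set N'} (hU : IsOpen U) {f g : N' → ℂ} (hf : SmoothFunOn U f)
    (hg : SmoothFunOn U g) (hfg : ∀ y ∈ U, f y * g y = 1) {x : N'} (hx : x ∈ U) :
    extd (fun y => g y • dfun f y) x = 0 := by
  rw [extd_fun_smul (smoothOneFormOn_dfun hU hf) hg hx, extd_dfun hU hf hx, smul_zero, add_zero]
  have h1 := dfun_mul hU hf hg hx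
  rw [dfun_congr hU hfg hx, dfun_const] at h1
  -- Differentiating `f g = 1` gives `f dg = -g df`, so `f dg ∧ df` is a multiple of `df ∧ df`; then
  -- `f` is cancelled.
  have h2 : f x • (ExteriorAlgebra.ι ℂ (dfun g x) * ExteriorAlgebra.ι ℂ (dfun f x)) = 0 := by
    have h3 : f x • dfun g x = -(g x • dfun f x) := (neg_eq_of_add_eq_zero_right h1.symm).symm
    rw [← smul_mul_assoc, ← map_smul, h3, map_neg, map_smul, neg_mul, smul_mul_assoc,
      ExteriorAlgebra.ι_sq_zero, smul_zero, neg_zero]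
  exact (smul_eq_zero.1 h2).resolve_left (left_ne_zero_of_mul_eq_one (hfg x hx))

/-- The change of the connection form under a change of local lift. -/
theorem shiftForm_smul {B : Subgroup G} (hM : IsSmoothAction G M)
    (θ : PrincipalConn (G := G) M B) {χ : Dual G} (hχ : χ ∈ ann B) {s r : N' → M} {κ : N' → G}
    {W : Set N'} (hW : IsOpen W) (hr : ContMDiffOn N'.I M.I ∞ r W)
    (hκ : ContMDiffOn N'.I (𝓡 G.dim) ∞ κ W) (e : ∀ z ∈ W, s z = κ z • r z) {y : N'} (hy : y ∈ W) :
    shiftForm θ χ s y =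
      shiftForm θ χ r y + -((χ⁻¹).val (κ y) • dfun (fun z => χ.val (κ z)) y) := by
  have hκ1 : MDifferentiableAt N'.I (𝓡 G.dim) κ y :=
    (hκ.contMDiffAt (hW.mem_nhds hy)).mdifferentiableAt (by simp)
  have hs1 : MDifferentiableAt N'.I M.I r y :=
    (hr.contMDiffAt (hW.mem_nhds hy)).mdifferentiableAt (by simp)
  have ha1 : MDifferentiableAt ((𝓡 G.dim).prod M.I) M.I (fun p : G × M => p.1 • p.2)
      (κ y, r y) := hM.smooth.mdifferentiableAt (by simp)
  have hχ1 : MDifferentiableAt (𝓡 G.dim) 𝓘(ℝ, ℂ) χ.val (κ y) :=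
    χ.smooth_val.mdifferentiableAt (by simp)
  have hd : dfun (fun z => χ.val (κ z)) y =
      (χ.d (κ y)).comp (mfderiv N'.I (𝓡 G.dim) κ y) :=
    mfderiv_comp y hχ1 hκ1
  have hds : ∀ v : N'.T y, D s y v =
      mfderiv ((𝓡 G.dim).prod M.I) M.I (fun p : G × M => p.1 • p.2) (κ y, r y)
        (mfderiv N'.I (𝓡 G.dim) κ y v, D r y v) := by
    intro v
    have h1 : D s y = mfderiv N'.I M.I (fun z => κ z • r z) y :=
      Filter.EventuallyEq.mfderiv_eq (Filter.eventually_of_mem (hW.mem_nhds hy) e)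
    have h2 : mfderiv N'.I M.I (fun z => κ z • r z) y =
        (mfderiv ((𝓡 G.dim).prod M.I) M.I (fun p : G × M => p.1 • p.2) (κ y, r y)).comp
          ((mfderiv N'.I (𝓡 G.dim) κ y).prod (mfderiv N'.I M.I r y)) := by
      have h3 := (hκ1.hasMFDerivAt.prodMk hs1.hasMFDerivAt)
      exact (HasMFDerivAt.comp y ha1.hasMFDerivAt h3).mfderiv
    rw [h1, h2]
    rfl
  -- All tangent spaces are the same model space, so the base point can be replaced by an equal one
  -- without transporting the vector.
  have hθ : ∀ (m m' : M) (_ : m = m') (v : EuclideanSpace ℝ (Fin M.dim)),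
      (θ.form m (v : M.T m) : G.lieAlg) = θ.form m' (v : M.T m') := by
    rintro m _ rfl v
    rfl
  have hinv : (χ⁻¹).val (κ y) = (χ.val (κ y))⁻¹ := Circle.coe_inv _
  ext v
  have key : χ.d 1 (θ.form (s y) (D s y v)) = χ.d 1 (θ.form (r y) (D r y v)) +
      (χ.val (κ y))⁻¹ * χ.d (κ y) (mfderiv N'.I (𝓡 G.dim) κ y v) := by
    rw [hds v]
    refine Eq.trans (congrArg (χ.d 1) (hθ _ _ (e y hy) _)) ?_
    exact θ.action χ hχ (κ y) (r y) (mfderiv N'.I (𝓡 G.dim) κ y v, D r y v)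
  rw [hd, hinv]
  change -(χ.d 1 (θ.form (s y) (D s y v))) = -(χ.d 1 (θ.form (r y) (D r y v))) +
    -((χ.val (κ y))⁻¹ * χ.d (κ y) (mfderiv N'.I (𝓡 G.dim) κ y v))
  rw [key]
  ring

/-- The curvature of a descended line bundle, pulled back by `f`, can be computed by means of any
local lift of `f`. -/
theorem pullForm_extd_shiftForm {B : Subgroup G} {q : M → N} (hM : IsSmoothAction G M)
    (θ : PrincipalConn (G := G) M B) {χ : Dual G} (hχ : χ ∈ ann B) {f : N' → N} {s : N' → M}
    {V : Set N'} (hV : IsOpen V) (hf : ContMDiffOn N'.I N.I ∞ f V)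
    (hs : ContMDiffOn N'.I M.I ∞ s V) (h : ∀ z ∈ V, q (s z) = f z) (t : LocalTriv G q) {y : N'}
    (hy : y ∈ V) (hyt : f y ∈ t.U) :
    pullForm f (extd (shiftForm θ χ t.s)) y = extd (shiftForm θ χ s) y := by
  -- Both `s` and `t.s ∘ f` lift `f`, so near `y` they differ by the smooth map `γ ∘ s` into the
  -- group.
  obtain ⟨V₁, γ, hV₁, hyV₁, hγ, e⟩ := t.translate (s y) (by rwa [h y hy])
  have hW₁ : IsOpen (V ∩ f ⁻¹' t.U) := hf.continuousOn.isOpen_inter_preimage hV t.isOpen_U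
  have hW : IsOpen ((V ∩ f ⁻¹' t.U) ∩ s ⁻¹' V₁) :=
    (hs.mono Set.inter_subset_left).continuousOn.isOpen_inter_preimage hW₁ hV₁
  set W := (V ∩ f ⁻¹' t.U) ∩ s ⁻¹' V₁ with hWdef
  have hyW : y ∈ W := ⟨⟨hy, hyt⟩, hyV₁⟩
  have hfW : ContMDiffOn N'.I N.I ∞ f W := hf.mono fun z hz => hz.1.1
  have hsW : ContMDiffOn N'.I M.I ∞ s W := hs.mono fun z hz => hz.1.1
  have hmaps : Set.MapsTo f W t.U := fun z hz => hz.1.2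
  have hr : ContMDiffOn N'.I M.I ∞ (fun z => t.s (f z)) W := t.smooth_s.comp hfW hmaps
  have hκ : ContMDiffOn N'.I (𝓡 G.dim) ∞ (fun z => γ (s z)) W := hγ.comp hsW fun z hz => hz.2
  have eW : ∀ z ∈ W, s z = γ (s z) • t.s (f z) := by
    intro z hz
    have := e (s z) hz.2 (by rw [h z hz.1.1]; exact hz.1.2)
    rwa [h z hz.1.1] at this
  have hu : SmoothFunOn W fun z => χ.val (γ (s z)) := χ.smooth_val.comp_contMDiffOn hκ
  have hu' : SmoothFunOn W fun z => (χ⁻¹).val (γ (s z)) := (χ⁻¹).smooth_val.comp_contMDiffOn hκ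
  have huu : ∀ z ∈ W, χ.val (γ (s z)) * (χ⁻¹).val (γ (s z)) = 1 := fun z _ => by
    rw [show (χ⁻¹).val (γ (s z)) = (χ.val (γ (s z)))⁻¹ from Circle.coe_inv _]
    exact mul_inv_cancel₀ (Dual.val_ne_zero _)
  have hA := smoothOneFormOn_shiftForm θ χ t.isOpen_U t.smooth_s
  have hB := smoothOneFormOn_shiftForm θ χ hW hr
  have hL := (smoothOneFormOn_dfun hW hu).fun_smul hu'
  have hcomp : ∀ z ∈ W, (shiftForm θ χ t.s (f z)).comp (D f z) =
      shiftForm θ χ (fun z => t.s (f z)) z := by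
    intro z hz
    have h1 : MDifferentiableAt N.I M.I t.s (f z) :=
      (t.smooth_s.contMDiffAt (t.isOpen_U.mem_nhds hz.1.2)).mdifferentiableAt (by simp)
    have h2 : MDifferentiableAt N'.I N.I f z :=
      (hfW.contMDiffAt (hW.mem_nhds hz)).mdifferentiableAt (by simp)
    have h3 : D (fun z => t.s (f z)) z = (D t.s (f z)).comp (D f z) := mfderiv_comp z h1 h2
    unfold shiftForm
    rw [h3]
    rfl
  rw [← extd_pull hW hfW hA hmaps hyW, extd_congr hB hcomp hyW,
    extd_congr (hB.add hL.neg) (fun z hz => shiftForm_smul hM θ hχ hW hr hκ eW hz) hyW,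
    extd_add hB hL.neg hyW]
  -- The discrepancy between the two lifts is the logarithmic differential of `χ ∘ γ ∘ s`.
  have hneg : extd (fun z => -((χ⁻¹).val (γ (s z)) • dfun (fun z => χ.val (γ (s z))) z)) y = 0 := by
    have h1 : ∀ z ∈ W, -((χ⁻¹).val (γ (s z)) • dfun (fun z => χ.val (γ (s z))) z) =
        (-1 : ℂ) • ((χ⁻¹).val (γ (s z)) • dfun (fun z => χ.val (γ (s z))) z) := by
      intro z _
      ext v
      exact (neg_one_mul _).symm
    rw [extd_congr (hL.const_smul (-1)) h1 hyW, extd_const_smul hL _ hyW,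
      extd_dlog hW hu hu' huu hyW, smul_zero]
  rw [hneg, add_zero]

end ShiftCurvature

/-! ### Compatibility of the forms `Ch(χ)` over boundary hypersurfaces. -/

namespace IteratedAction

variable {G : AbLieGroup.{u}} {A : Type u} [PartialOrder A] [OrderBot A] {R : IteratedAction G A}

/-- A collective boundary hypersurface meets itself by `inter_iff`, so `H_β(X_α)` has a point. Its
isotropy group is `B_α`, and by equivariance of the fibration this group fixes the image in `X_β`.
-/
theorem B_le {α β : A} (h : α < β) : R.B α ≤ R.B β := by
  obtain ⟨_, ⟨p, -⟩, -⟩ := (R.total.inter_iff h h).2 (Or.inl le_rfl)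
  intro b hb
  rw [← (R.quotH h).isotropy p, MulAction.mem_stabilizer_iff] at hb
  rw [← (R.quot β).isotropy (R.total.fib h p), MulAction.mem_stabilizer_iff,
    ← R.fib_equivariant h, hb]

theorem ann_le {α β : A} (h : α < β) : ann (R.B β) ≤ ann (R.B α) := fun _ hχ b hb =>
  hχ b (B_le h hb)

/-- The Chern character form of a line bundle is a series in one curvature form, and the pull-back
of that form can be computed through any local lift `s` of `f`, even one that does not factor
through a section over `Y_α`. -/
theorem IteratedPrincipalConn.pullForm_chern (θ : R.IteratedPrincipalConn) (α : A)
    {χ : Dual G} (hχ : χ ∈ ann (R.B α)) {N' : CornerMfd.{u}} {f : N' → R.base.X α} {V : Set N'}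
    (hV : IsOpen V) (hf : ContMDiffOn N'.I (R.base.X α).I ∞ f V) {s : N' → R.total.X α}
    (hs : ContMDiffOn N'.I (R.total.X α).I ∞ s V) (h : ∀ z ∈ V, R.q α (s z) = f z) {y : N'}
    (hy : y ∈ V) {n : ℕ} (hn : (R.base.X α).dim < n) :
    pullForm f (θ.chern α ⟨χ, hχ⟩) y =
      ∑ k ∈ Finset.range n, chCoef k • (extd (shiftForm (θ.conn α) χ s) y) ^ k := by
  obtain ⟨t, ht⟩ := (R.quot α).triv (f y)
  rw [← pullForm_extd_shiftForm (R.smoothX α) (θ.conn α) hχ hV hf hs h t hy ht]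
  have h1 : θ.chern α ⟨χ, hχ⟩ (f y) = _ := (θ.shift α χ hχ).chern_line t ht hn
  rw [pullForm_apply, pullForm_apply, h1]
  simp only [map_sum, map_smul, map_pow]
  refine Finset.sum_congr rfl fun k _ => ?_
  exact congrArg (fun z => chCoef k • ExteriorAlgebra.map (pullCovec f y) z ^ k)
    ((θ.shift α χ hχ).curv_line t (f y))

/-- The forms `Ch(χ)`, for characters of `G/B_β`, on `Y_α` and `Y_β` have the same pull-back to
`H_β(Y_α)`. -/
theorem IteratedPrincipalConn.chern_compat (θ : R.IteratedPrincipalConn) {α β : A} (h : α < β)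
    {χ : Dual G} (hβ : χ ∈ ann (R.B β)) :
    pullForm (R.base.fib h) (θ.chern β ⟨χ, hβ⟩) =
      pullForm (R.base.incl h) (θ.chern α ⟨χ, ann_le h hβ⟩) := by
  funext y
  -- One local section of `H_β(X_α) → H_β(Y_α)` supplies lifts of both maps: through `incl` to `X_α`
  -- and through `fib` to `X_β`. The compatibility of the principal connections is a statement at
  -- exactly these points.
  obtain ⟨t, ht⟩ := (R.quotH h).triv y
  set n := (R.base.X α).dim + (R.base.X β).dim + 1 with hn
  have hi : SmoothMap (R.total.incl h) := (R.total.isIncl h).smooth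
  have hf : SmoothMap (R.total.fib h) := (R.total.isFib h).bmap.smooth
  have hsi : ContMDiffOn (R.base.H h).I (R.total.X α).I ∞ (fun z => R.total.incl h (t.s z)) t.U :=
    hi.comp_contMDiffOn t.smooth_s
  have hsf : ContMDiffOn (R.base.H h).I (R.total.X β).I ∞ (fun z => R.total.fib h (t.s z)) t.U :=
    hf.comp_contMDiffOn t.smooth_s
  rw [θ.pullForm_chern β hβ t.isOpen_U (R.smooth_fib h).contMDiffOn hsf
      (fun z hz => by rw [← R.fib_q, t.sec z hz]) ht (show _ < n by omega),
    θ.pullForm_chern α (ann_le h hβ) t.isOpen_U (R.smooth_incl h).contMDiffOn hsi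
      (fun z hz => by rw [← R.incl_q, t.sec z hz]) ht (show _ < n by omega)]
  rw [extd_congr (smoothOneFormOn_shiftForm (θ.conn α) χ t.isOpen_U hsi) (fun z hz => ?_) ht]
  have h1 : MDifferentiableAt (R.base.H h).I (R.total.H h).I t.s z :=
    (t.smooth_s.contMDiffAt (t.isOpen_U.mem_nhds hz)).mdifferentiableAt (by simp)
  have h2 : D (fun z => R.total.incl h (t.s z)) z = (D (R.total.incl h) (t.s z)).comp (D t.s z) :=
    mfderiv_comp z (hi.mdifferentiableAt (by simp)) h1
  have h3 : D (fun z => R.total.fib h (t.s z)) z = (D (R.total.fib h) (t.s z)).comp (D t.s z) :=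
    mfderiv_comp z (hf.mdifferentiableAt (by simp)) h1
  unfold shiftForm
  rw [h2, h3]
  ext v
  exact congrArg Neg.neg (θ.compat h χ hβ (t.s z) (D t.s z v))

end IteratedAction

/-! ### The Chern character of a reduced bundle -/

section Composition

variable {M N : CornerMfd.{u}}

theorem FiberMaps.Smooth.pull {E F : CBundle N} {T : FiberMaps E F} (hT : T.Smooth) (f : M → N)
    (hf : SmoothMap f) :
    FiberMaps.Smooth (E := E.pull f hf) (F := F.pull f hf) fun x => T (f x) :=
  fun i j a b => SmoothFunOn.pull (f := f) (g := T.mat i j a b) hf.contMDiffOn (hT i j a b)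
    fun _ h => h

/-- The map `1 ⊗ P`. -/
def FiberMaps.lTensor (L : CBundle M) {E F : CBundle M} (P : FiberMaps E F) :
    FiberMaps (L.tensor E) (L.tensor F) := fun x => LinearMap.lTensor (L.fiber x) (P x)

/-- In tensor product frames the matrix of `1 ⊗ P` is the identity in the index of `L` and the
matrix of `P` in the other. -/
theorem FiberMaps.lTensor_frame (L : CBundle M) {E F : CBundle M} (P : FiberMaps E F) {x : M}
    {t : L.Idx} {k : E.Idx} {l : F.Idx} (ht : x ∈ L.U t) (hk : x ∈ E.U k) (hl : x ∈ F.U l)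
    (b : L.R t) (d : E.R k) :
    P.lTensor L x ((L.tensor E).frame (t, k) x ⟨ht, hk⟩ (b, d)) =
      ∑ c, P.mat l k c d x • (L.tensor F).frame (t, l) x ⟨ht, hl⟩ (b, c) := by
  have e1 : (L.tensor E).frame (t, k) x ⟨ht, hk⟩ (b, d) =
      L.frame t x ht b ⊗ₜ[ℂ] E.frame k x hk d := Module.Basis.tensorProduct_apply' _ _ _
  have e2 : ∀ c, (L.tensor F).frame (t, l) x ⟨ht, hl⟩ (b, c) =
      L.frame t x ht b ⊗ₜ[ℂ] F.frame l x hl c := fun c => Module.Basis.tensorProduct_apply' _ _ _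
  have e3 : P x (E.frame k x hk d) = ∑ c, P.mat l k c d x • F.frame l x hl c := by
    conv_lhs => rw [← (F.frame l x hl).sum_repr (P x (E.frame k x hk d))]
    exact Finset.sum_congr rfl fun c _ => by rw [FiberMaps.mat_of_mem _ _ _ hl hk]
  rw [e1]
  refine (LinearMap.lTensor_tmul _ _ _ _).trans ?_
  rw [e3, TensorProduct.tmul_sum]
  refine Finset.sum_congr rfl fun c _ => ?_
  rw [e2]
  exact TensorProduct.tmul_smul _ _ _

/-- Smoothness of the composite of bundle maps `1 ⊗ P` and `Q`. -/
theorem FiberMaps.Smooth.comp_lTensor {L E F F' : CBundle M} {P : FiberMaps E F} (hP : P.Smooth)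
    {Q : FiberMaps (L.tensor F) F'} (hQ : Q.Smooth) :
    FiberMaps.Smooth (E := L.tensor E) (F := F') fun x =>
      (Q x).comp (P.lTensor L x) := by
  rintro i ⟨t, k⟩ a ⟨b₁, b₂⟩ x hx
  obtain ⟨hi, ht, hk⟩ := hx
  -- A frame of the intermediate bundle near `x` turns the composite into a product of smooth
  -- matrices.
  obtain ⟨l, hl⟩ := F.cover x
  set V := (F'.U i ∩ (L.U t ∩ E.U k)) ∩ F.U l with hV
  have hVo : IsOpen V := ((F'.isOpen_U i).inter ((L.isOpen_U t).inter (E.isOpen_U k))).inter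
    (F.isOpen_U l)
  have h1 : SmoothFunOn V fun y => ∑ c, P.mat l k c b₂ y * Q.mat i (t, l) a (b₁, c) y := by
    refine contMDiffOn_finsetSum fun c _ => ?_
    exact (contDiff_mul (𝕜 := ℝ) (𝔸 := ℂ) (n := ∞)).contMDiff.comp_contMDiffOn
      (((hP l k c b₂).mono fun y hy => ⟨hy.2, hy.1.2.2⟩).prodMk_space
        ((hQ i (t, l) a (b₁, c)).mono fun y hy => ⟨hy.1.1, hy.1.2.1, hy.2⟩))
  refine (((h1.congr fun y hy => ?_).contMDiffAt (hVo.mem_nhds ⟨⟨hi, ht, hk⟩, hl⟩))).contMDiffWithinAt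
  have htl : y ∈ (L.tensor F).U (t, l) := ⟨hy.1.2.1, hy.2⟩
  have htk : y ∈ (L.tensor E).U (t, k) := hy.1.2
  refine (FiberMaps.mat_of_mem (E := L.tensor E) (j := (t, k))
    (fun x => (Q x).comp (P.lTensor L x)) a (b₁, b₂) hy.1.1 htk).trans ?_
  refine (congrArg (fun z => (F'.frame i y hy.1.1).repr (Q y z) a)
    (FiberMaps.lTensor_frame L P hy.1.2.1 hy.1.2.2 hy.2 b₁ b₂)).trans ?_
  rw [map_sum, map_sum, Finsupp.finsetSum_apply]
  refine Finset.sum_congr rfl fun c _ => ?_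
  rw [map_smul, map_smul]
  exact congrArg (fun z => P.mat l k c b₂ y * z) (FiberMaps.mat_of_mem (E := L.tensor F)
    (j := (t, l)) Q a (b₁, c) hy.1.1 htl).symm

/-- The Chern character form, as a smooth form. -/
def Connection.chernForm {E : CBundle M} (C : Connection E) : Forms M :=
  (⟨C.chern, C.smoothForm_chern⟩ : smoothForms M)

theorem Forms.ext_raw {v w : Forms M} (h : v.raw = w.raw) : v = w := Subtype.ext h

theorem Forms.raw_sum {K : Type*} (S : Finset K) (v : K → Forms M) :
    (∑ c ∈ S, v c).raw = ∑ c ∈ S, (v c).raw :=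
  map_sum (smoothForms M).subtype v S

end Composition

/-! ### Relations and pull-backs of twisted forms. -/

section TwistedForms

variable {G : AbLieGroup.{u}} {M M' : CornerMfd.{u}} {S : Subgroup (Dual G)}

theorem twisted_mul (c : S → RawForm M) (χ : S) (g : Dual G) {v w : Forms M}
    (h : w.raw = c χ * v.raw) : twisted c w g = twisted c v (χ.1 * g) :=
  (Submodule.Quotient.eq _).2 (Submodule.subset_span ⟨χ, g, v, w, h, rfl⟩)

theorem twisted_sum {K : Type*} (c : S → RawForm M) (T : Finset K) (v : K → Forms M) (g : Dual G) :
    twisted c (∑ k ∈ T, v k) g = ∑ k ∈ T, twisted c (v k) g :=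
  map_sum ((twistRel c).mkQ.comp (Finsupp.lsingle g)) v T

theorem twisted_zero (c : S → RawForm M) (g : Dual G) : twisted c 0 g = 0 :=
  map_zero ((twistRel c).mkQ.comp (Finsupp.lsingle g))

theorem restrict_twisted {c : S → RawForm M'} (f : M → M') (hf : SmoothMap f) (v : Forms M')
    (g : Dual G) : TwistedForms.restrict f hf (twisted c v g) =
      twisted (fun χ => pullForm f (c χ)) (Forms.pull f hf v) g := by
  refine (Submodule.mapQ_apply _ _ _ _).trans ?_
  simp only [pullSum, Finsupp.mapRange.linearMap_apply, Finsupp.mapRange_single]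
  rfl

/-- The augmented pull-back is well defined on twisted forms if the twistings are compatible. -/
theorem pullSum_mem_twistRel {S' : Subgroup (Dual G)} {c : S → RawForm M} {c' : S' → RawForm M'}
    {f : M → M'} (hf : SmoothMap f) (hS : S' ≤ S)
    (h : ∀ χ : S', pullForm f (c' χ) = c ⟨χ.1, hS χ.2⟩) {s : Dual G →₀ Forms M'}
    (hs : s ∈ twistRel c') : pullSum G f hf s ∈ twistRel c := by
  have hle : twistRel c' ≤ (twistRel c).comap (pullSum G f hf) := by
    refine Submodule.span_le.2 ?_
    rintro z ⟨χ, g, v, w, e, rfl⟩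
    refine Submodule.subset_span ⟨⟨χ.1, hS χ.2⟩, g, Forms.pull f hf v, Forms.pull f hf w, ?_, ?_⟩
    · rw [← h χ]
      change pullForm f w.raw = pullForm f (c' χ) * pullForm f v.raw
      rw [e, pullForm_mul]
    · rw [map_sub]
      simp [pullSum]
  exact hle hs

end TwistedForms

/-! ### The Chern forms of `W_{α,g}` and their restrictions to the boundary. -/

namespace IteratedAction

variable {G : AbLieGroup.{u}} {A : Type u} [PartialOrder A] [OrderBot A] {R : IteratedAction G A}

theorem ReducedData.smooth_comp (W : R.ReducedData) {α β : A} (h : α < β) {χ : Dual G}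
    (hχ : χ ∈ ann (R.B α)) {g g' : Dual G} (e : g' = χ * g) : (W.comp h hχ e).Smooth :=
  FiberMaps.Smooth.comp_lTensor (L := R.res h (R.shift α χ hχ)) (W.part h g').smooth
    ((W.twist α hχ e).smooth.pull (R.base.incl h) (R.smooth_incl h))

/-- The definition of `aug` fixes a classical equality test on the index set; here any other is
allowed. -/
theorem ReducedData.aug_lof (W : R.ReducedData) {α β : A} (h : α < β) (g : Dual G) (p : R.base.H h)
    [DecidableEq (AugIdx R α β g)] (c : AugIdx R α β g)
    (z : ((R.res h (R.shift α _ c.2)).tensor (R.lift h (W.W β c.1.out))).fiber p) :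
    W.aug h g p (DirectSum.lof ℂ (AugIdx R α β g) (fun c =>
      ((R.res h (R.shift α _ c.2)).tensor (R.lift h (W.W β c.1.out))).fiber p) c z) =
      W.comp h c.2 (by group) p z := by
  unfold ReducedData.aug
  convert DirectSum.toModule_lof ℂ (M := fun c : AugIdx R α β g =>
    ((R.res h (R.shift α _ c.2)).tensor (R.lift h (W.W β c.1.out))).fiber p) c z

namespace IteratedConnection

variable {θ : R.IteratedPrincipalConn} {W : R.ReducedBundle} (C : IteratedConnection θ W)

/-- The twisting isomorphism is parallel, and its source is the tensor product with a line bundle.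
-/
theorem chern_twist (α : A) (χ : ann (R.B α)) (g : Dual G) :
    (C.conn α g).chern = θ.chern α χ * (C.conn α (χ.1 * g)).chern :=
  ((W.twist α χ.2 rfl).chern_eq (C.twist α χ.2 rfl)).trans
    (chern_tensor_line (θ.shift α χ.1 χ.2) (C.conn α (χ.1 * g)))

theorem finite_support (α : A) :
    ((QuotientGroup.mk : Dual G → Dual G ⧸ ann (R.B α)) ''
      Function.support fun g => (C.conn α g).chernForm).Finite := by
  refine (W.finite α).subset (Set.image_mono fun g hg => ?_)
  by_contra hn
  simp only [Set.mem_ofPred_eq, not_exists, not_nontrivial_iff_subsingleton] at hn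
  exact hg (Forms.ext_raw ((C.conn α g).chern_eq_zero hn))

/-- The connection on a summand of the augmented pull-back. -/
def augConn {α β : A} (h : α < β) {g : Dual G} (c : AugIdx R α β g) :
    Connection ((R.res h (R.shift α _ c.2)).tensor (R.lift h (W.W β c.1.out))) :=
  ((θ.shift α _ c.2).pull (R.base.incl h) (R.smooth_incl h)).tensor
    ((C.conn β c.1.out).pull (R.base.fib h) (R.smooth_fib h))

theorem chern_augConn {α β : A} (h : α < β) {g : Dual G} (c : AugIdx R α β g) :
    (C.augConn h c).chern = pullForm (R.base.incl h) (θ.chern α ⟨_, c.2⟩) *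
      pullForm (R.base.fib h) (C.conn β c.1.out).chern := by
  have : ∀ i, Unique ((R.res h (R.shift α _ c.2)).R i) := fun i =>
    inferInstanceAs (Unique PUnit.{u+1})
  rw [augConn, chern_tensor_line, Connection.chern_pull, Connection.chern_pull]
  rfl

/-- The restriction of the Chern character form of `W_{α, g}` to `H_β(Y_α)` is the sum of the Chern
character forms of the summands of the augmented pull-back. -/
theorem pull_chernForm_eq_sum {α β : A} (h : α < β) (g : Dual G) (S : Finset (AugIdx R α β g))
    (hS : ∀ c ∉ S, ∀ y, Subsingleton ((W.W β c.1.out).fiber y)) :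
    Forms.pull (R.base.incl h) (R.smooth_incl h) (C.conn α g).chernForm =
      ∑ c ∈ S, (C.augConn h c).chernForm := by
  classical
  refine Forms.ext_raw ?_
  rw [Forms.raw_sum]
  refine ((C.conn α g).chern_pull (R.base.incl h) (R.smooth_incl h)).symm.trans ?_
  funext p
  rw [Finset.sum_apply]
  let Z : AugIdx R α β g → Type u := fun c =>
    ((R.res h (R.shift α _ c.2)).tensor (R.lift h (W.W β c.1.out))).fiber p
  -- The inverse of `T_{αβ}` followed by the projection to a summand gives the maps `T'` required
  -- for additivity. The index set may be infinite, but the summands outside `S` are zero, so the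
  -- components in `S` recover each element.
  let φ := LinearEquiv.ofBijective (W.aug h g p) (W.iso h g p)
  refine chern_eq_sum S _ (fun c => C.augConn h c) (fun c => W.comp h c.2 (by group))
    (fun c => W.smooth_comp h c.2 _) (fun c => C.aug h c.2 _)
    (fun c => (DirectSum.component ℂ (AugIdx R α β g) Z c).comp φ.symm.toLinearMap) ?_ fun c => ?_
  · ext v
    obtain ⟨d, rfl⟩ := φ.surjective v
    have hd : ∑ c ∈ S, DirectSum.lof ℂ (AugIdx R α β g) Z c
        (DirectSum.component ℂ (AugIdx R α β g) Z c d) = d := by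
      refine DirectSum.ext_component ℂ fun c' => ?_
      rw [map_sum]
      by_cases hc : c' ∈ S
      · rw [Finset.sum_eq_single_of_mem c' hc fun c _ hcc => ?_]
        · exact DirectSum.component.lof_self ℂ c' _
        · rw [DirectSum.component.of, dif_neg hcc]
      · have : Subsingleton ((W.W β c'.1.out).fiber (R.base.fib h p)) := hS c' hc _
        have : Subsingleton (Z c') := inferInstanceAs (Subsingleton
          ((R.shift α _ c'.2).fiber (R.base.incl h p) ⊗[ℂ]
            (W.W β c'.1.out).fiber (R.base.fib h p)))
        exact Subsingleton.elim _ _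
    rw [LinearMap.sum_apply, LinearMap.id_apply]
    conv_rhs => rw [← hd, map_sum]
    refine Finset.sum_congr rfl fun c _ => ?_
    refine (congrArg (fun z => W.comp h c.2 (by group) p
      (DirectSum.component ℂ (AugIdx R α β g) Z c z)) (φ.symm_apply_apply d)).trans ?_
    exact (W.aug_lof h g p c _).symm
  · ext z
    change DirectSum.component ℂ (AugIdx R α β g) Z c (φ.symm (W.comp h c.2 _ p z)) = z
    rw [← W.aug_lof h g p c z]
    refine (congrArg (DirectSum.component ℂ (AugIdx R α β g) Z c)
      (φ.symm_apply_apply (DirectSum.lof ℂ (AugIdx R α β g) Z c z))).trans ?_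
    exact DirectSum.component.lof_self ℂ (M := Z) c z

end IteratedConnection

end IteratedAction

/-! ### The Chern character as an element of the delocalized complex. -/

namespace IteratedAction

namespace IteratedConnection

variable {G : AbLieGroup.{u}} {A : Type u} [PartialOrder A] [OrderBot A] {R : IteratedAction G A}
  {θ : R.IteratedPrincipalConn} {W : R.ReducedBundle} (C : IteratedConnection θ W)

/-- The twisted form `Ch(W_{α, g}) ⊗ g`. -/
def twistedChern (α : A) (g : Dual G) : TwistedForms (θ.chern α) :=
  twisted (θ.chern α) (C.conn α g).chernForm g

/-- With `χ = g⁻¹ g'`, trivial on `B_α`, the twisting relation between the Chern forms is precisely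
a defining relation of the quotient. This is why the choice of section does not matter. -/
theorem twistedChern_eq_of_mk_eq (α : A) {g g' : Dual G}
    (e : (QuotientGroup.mk g : Dual G ⧸ ann (R.B α)) = QuotientGroup.mk g') :
    C.twistedChern α g = C.twistedChern α g' := by
  have hχ := QuotientGroup.eq.1 e
  have hg : g⁻¹ * g' * g = g' := by rw [mul_comm, mul_inv_cancel_left]
  have h := twisted_mul (θ.chern α) ⟨_, hχ⟩ g (C.chern_twist α ⟨_, hχ⟩ g)
    (v := (C.conn α (g⁻¹ * g' * g)).chernForm) (w := (C.conn α g).chernForm)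
  refine h.trans ?_
  change C.twistedChern α (g⁻¹ * g' * g) = _
  rw [hg]

/-- The components of the Chern character of `W_*`. -/
def chernCharacter (α : A) : TwistedForms (θ.chern α) :=
  ∑ᶠ b : Dual G ⧸ ann (R.B α), C.twistedChern α b.out

theorem chernCharacter_eq (α : A) (σ : Dual G ⧸ ann (R.B α) → Dual G)
    (hσ : ∀ b, (QuotientGroup.mk (σ b) : Dual G ⧸ ann (R.B α)) = b) :
    C.chernCharacter α = ∑ᶠ b, C.twistedChern α (σ b) :=
  finsum_congr fun b => C.twistedChern_eq_of_mk_eq α ((QuotientGroup.out_eq' b).trans (hσ b).symm)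

/-- The finite support rules out the default value zero of `finsum`. The set `S` may be larger than
the support, as needed for regrouping over a hypersurface. -/
theorem chernCharacter_eq_sum (α : A) (S : Finset (Dual G ⧸ ann (R.B α)))
    (hS : (W.finite α).toFinset ⊆ S) :
    C.chernCharacter α = ∑ b ∈ S, C.twistedChern α b.out := by
  refine finsum_eq_sum_of_support_subset _ fun b hb => hS ?_
  rw [Set.Finite.mem_toFinset]
  refine ⟨b.out, ?_, QuotientGroup.out_eq' b⟩
  by_contra hn
  simp only [Set.mem_ofPred_eq, not_exists, not_nontrivial_iff_subsingleton] at hn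
  refine hb ?_
  change twisted (θ.chern α) (C.conn α b.out).chernForm b.out = 0
  rw [show (C.conn α b.out).chernForm = 0 from Forms.ext_raw ((C.conn α _).chern_eq_zero hn),
    twisted_zero]

/-- For `g = c.out` this recognizes the index condition of `AugIdx` as membership in a fibre of the
restriction from the dual of `B_β` to that of `B_α`. -/
theorem mem_ann_iff (α : A) (g : Dual G) (b : Dual G ⧸ ann (R.B α)) :
    g * b.out⁻¹ ∈ ann (R.B α) ↔ (QuotientGroup.mk g : Dual G ⧸ ann (R.B α)) = b := by
  conv_rhs => rw [← QuotientGroup.out_eq' b]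
  rw [eq_comm, QuotientGroup.eq, mul_comm]

open Classical in
/-- The restriction of a component of the Chern character in terms of the augmented pull-back. -/
theorem restrict_twistedChern {α β : A} (h : α < β) (b : Dual G ⧸ ann (R.B α)) :
    TwistedForms.restrict (R.base.incl h) (R.smooth_incl h) (C.twistedChern α b.out) =
      ∑ c ∈ (W.finite β).toFinset with
          (QuotientGroup.mk c.out : Dual G ⧸ ann (R.B α)) = b,
        twisted (fun χ => pullForm (R.base.incl h) (θ.chern α χ))
          (Forms.pull (R.base.fib h) (R.smooth_fib h) (C.conn β c.out).chernForm) c.out := by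
  let S₀ : Finset {c : Dual G ⧸ ann (R.B β) // c.out * b.out⁻¹ ∈ ann (R.B α)} :=
    Finset.subtype _ (W.finite β).toFinset
  let S : Finset (AugIdx R α β b.out) := S₀
  have hS : ∀ c ∉ S, ∀ y, Subsingleton ((W.W β c.1.out).fiber y) := by
    intro c hc y
    by_contra hn
    rw [not_subsingleton_iff_nontrivial] at hn
    refine hc (Finset.mem_subtype.2 ?_)
    rw [Set.Finite.mem_toFinset]
    exact ⟨c.1.out, ⟨y, hn⟩, QuotientGroup.out_eq' c.1⟩
  rw [twistedChern, restrict_twisted, C.pull_chernForm_eq_sum h b.out S hS, twisted_sum]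
  have h1 : ∀ c ∈ S, twisted (fun χ => pullForm (R.base.incl h) (θ.chern α χ))
      (C.augConn h c).chernForm b.out =
      twisted (fun χ => pullForm (R.base.incl h) (θ.chern α χ))
        (Forms.pull (R.base.fib h) (R.smooth_fib h) (C.conn β c.1.out).chernForm) c.1.out := by
    intro c _
    -- The factor `ι^*Ch(χ)` with `χ = c.out * b.out⁻¹` is traded for `χ`: the label `b.out` becomes
    -- `c.out` and the line bundle leaves no trace.
    have h2 := twisted_mul (fun χ => pullForm (R.base.incl h) (θ.chern α χ)) ⟨_, c.2⟩ b.out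
      (C.chern_augConn h c)
      (v := Forms.pull (R.base.fib h) (R.smooth_fib h) (C.conn β c.1.out).chernForm)
      (w := (C.augConn h c).chernForm)
    refine h2.trans (congrArg _ ?_)
    exact inv_mul_cancel_right _ _
  rw [Finset.sum_congr rfl h1]
  refine (Finset.sum_subtype_eq_sum_filter (s := (W.finite β).toFinset)
    (p := fun c => c.out * b.out⁻¹ ∈ ann (R.B α))
    fun c => twisted (fun χ => pullForm (R.base.incl h) (θ.chern α χ))
      (Forms.pull (R.base.fib h) (R.smooth_fib h) (C.conn β c.out).chernForm) c.out).trans ?_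
  refine Finset.sum_congr (Finset.filter_congr fun c _ => mem_ann_iff α _ b) fun _ _ => rfl

/-- It suffices to treat one representative: two differ by twisting relations on `Y_β`, and by
`chern_compat` these pull back to twisting relations on `H_β(Y_α)`. -/
theorem isAugPullback_chernCharacter {α β : A} (h : α < β) :
    IsAugPullback (R.base.fib h) (R.smooth_fib h) (C.chernCharacter β)
      (TwistedForms.restrict (R.base.incl h) (R.smooth_incl h) (C.chernCharacter α)) := by
  classical
  intro s hs
  set Sβ := (W.finite β).toFinset with hSβ
  -- The restrictions to `B_α` of the elements of `Sβ` are included, so that summing over `Sα` the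
  -- fibres of the restriction map exhausts `Sβ`.
  set Sα := (W.finite α).toFinset ∪
    Sβ.image fun c => (QuotientGroup.mk c.out : Dual G ⧸ ann (R.B α)) with hSα
  let s₀ : Dual G →₀ Forms (R.base.X β) :=
    ∑ c ∈ Sβ, Finsupp.single c.out (C.conn β c.out).chernForm
  have hs₀ : (Submodule.Quotient.mk s₀ : TwistedForms (θ.chern β)) = C.chernCharacter β := by
    rw [C.chernCharacter_eq_sum β Sβ subset_rfl]
    exact map_sum (twistRel (θ.chern β)).mkQ _ _
  have hmem : s - s₀ ∈ twistRel (θ.chern β) :=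
    (Submodule.Quotient.eq _).1 (hs.trans hs₀.symm)
  have hpull := pullSum_mem_twistRel (c := fun χ => pullForm (R.base.incl h) (θ.chern α χ))
    (R.smooth_fib h) (ann_le h) (fun χ => θ.chern_compat h χ.2) hmem
  rw [map_sub] at hpull
  rw [(Submodule.Quotient.eq _).2 hpull, C.chernCharacter_eq_sum α Sα Finset.subset_union_left,
    map_sum (TwistedForms.restrict (R.base.incl h) (R.smooth_incl h)), Finset.sum_congr rfl fun b _ => C.restrict_twistedChern h b,
    Finset.sum_fiberwise_of_maps_to fun c hc =>
      Finset.mem_union_right _ (Finset.mem_image_of_mem _ hc)]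
  refine (map_sum ((twistRel fun χ => pullForm (R.base.incl h) (θ.chern α χ)).mkQ.comp
    (pullSum G (R.base.fib h) (R.smooth_fib h))) _ _).trans (Finset.sum_congr rfl fun c _ => ?_)
  simp only [pullSum, LinearMap.comp_apply, Finsupp.mapRange.linearMap_apply,
    Finsupp.mapRange_single]
  rfl

end IteratedConnection

end IteratedAction

end EqK

end

theorem mainTheorem8 {G : EqK.AbLieGroup.{u}} {A : Type u} [PartialOrder A] [OrderBot A] [Finite A]
    (R : EqK.IteratedAction G A) (θ : R.IteratedPrincipalConn) (W : R.ReducedBundle)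
    (C : EqK.IteratedAction.IteratedConnection θ W) :
    ∃ ch : ∀ α, EqK.Dual G → EqK.Forms (R.base.X α),
      -- the Chern character forms are smooth
      (∀ α g, (ch α g).raw = (C.conn α g).chern) ∧
      -- twisting relation
      (∀ α (χ : EqK.ann (R.B α)) (g : EqK.Dual G),
        (ch α g).raw = θ.chern α χ * (ch α (χ.1 * g)).raw) ∧
      -- finiteness of the support in the dual of `B_α`
      (∀ α, ((QuotientGroup.mk : EqK.Dual G → EqK.Dual G ⧸ EqK.ann (R.B α)) ''
        Function.support (ch α)).Finite) ∧
      -- the twisted forms `∑ Ch(W_{σ(b)}) ⊗ σ(b)`, for any section `σ` of restriction to `B_α`, are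
      -- the components of an element of the delocalized de Rham complex
      ∃ u : EqK.DelocalizedForm θ, ∀ α (σ : EqK.Dual G ⧸ EqK.ann (R.B α) → EqK.Dual G),
        (∀ b, (QuotientGroup.mk (σ b) : EqK.Dual G ⧸ EqK.ann (R.B α)) = b) →
        u.form α = ∑ᶠ b, EqK.twisted (θ.chern α) (ch α (σ b)) (σ b) := by
  refine ⟨fun α g => (C.conn α g).chernForm, fun _ _ => rfl, C.chern_twist, C.finite_support,
    ⟨C.chernCharacter, C.isAugPullback_chernCharacter⟩, fun α σ hσ => C.chernCharacter_eq α σ hσ⟩
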